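/- Let $G$ be a connected semisimple real algebraic group, i.e. the identity component of the group of real points of a semisimple linear algebraic group defined over $\mathbb R$, with Lie algebra $\mathfrak g$ and Killing form $B$. Let $K<G$ be a maximal compact subgroup, $\theta$ the associated Cartan involution of $\mathfrak g$, and $\mathfrak p=\{Y\in\mathfrak g:\theta Y=-Y\}$. Let $d$ be the distance on $G$ of the left-invariant Riemannian metric given on $\mathfrak g$ by $\langle Y,Z\rangle=-B(Y,\theta Z)$, and let $X=G/K$ be the Riemannian symmetric space, with the $G$-invariant metric given by $B$ on $T_oX=\mathfrak p$. Fix a (bi-invariant) Haar measure on $G$. Let $\Gamma<G$ be a discrete subgroup, and equip $\Gamma\backslash G$ with the induced $G$-invariant measure. For $x=\Gamma g\in\Gamma\backslash G$ let $\operatorname{inj}(x)\in[0,\infty]$ be the supremum of all $r>0$ such that $\{h\in G: d(h,g)<r\}$ injects into $\Gamma\backslash G$, and let $\operatorname{inj}(\Gamma\backslash G)=\sup_{x}\operatorname{inj}(x)$. The group $G$ acts unitarily on $L^2(G)$ and on $L^2(\Gamma\backslash G)$ by right translations. A unitary representation $\pi$ of $G$ is weakly contained in a unitary representation $\sigma$,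 written $\pi\propto\sigma$, if every diagonal matrix coefficient $g\mapsto\langle\pi(g)v,v\rangle$ of $\pi$ can be approximated, uniformly on compact subsets of $G$, by convex combinations of diagonal matrix coefficients of $\sigma$. Identify functions on $\Gamma\backslash X$ with right $K$-invariant functions on $\Gamma\backslash G$, and let $W^1(\Gamma\backslash X)\subset L^2(\Gamma\backslash X)$ be the closure of $C_c^\infty(\Gamma\backslash X)$ for the norm $\|f\|_{W^1}^2=\int|f|^2\,d\mathrm{vol}+\int\|\operatorname{grad}f\|^2\,d\mathrm{vol}$. Let $-\Delta$ be the self-adjoint operator on $L^2(\Gamma\backslash X)$ that extends the negative Laplace--Beltrami operator on $C_c^\infty(\Gamma\backslash X)$ and has domain in $W^1(\Gamma\backslash X)$: for $f\in W^1(\Gamma\backslash X)$ and $h\in L^2(\Gamma\backslash X)$, $-\Delta f=h$ means $\int\langle\operatorname{grad}f,\operatorname{grad}\psi\rangle\,d\mathrm{vol}=\int h\bar\psi\,d\mathrm{vol}$ for all $\psi\in C_c^\infty(\Gamma\backslash X)$. Its $L^2$-spectrum $\sigma(\Gamma\backslash X)$ is the set of all $\lambda\in\mathbb C$ such that $-\Delta-\lambda$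 has no bounded inverse; $\sigma(X)$ is the case of trivial $\Gamma$. If $\operatorname{inj}(\Gamma\backslash G)=\infty$, then $$L^2(G)\propto L^2(\Gamma\backslash G)\qquad\text{and}\qquad\sigma(X)\subset\sigma(\Gamma\backslash X).$$ -/

import Mathlib

open MeasureTheory Filter Topology
open scoped ENNReal NNReal ContDiff MulOpposite ComplexConjugate

noncomputable section

/-! ### Closed linear groups, their exponential map and their Lie algebra -/

instance ClosedSubgroup.instIsTopologicalGroup {A : Type*} [Group A] [TopologicalSpace A]
    [IsTopologicalGroup A] (G : ClosedSubgroup A) : IsTopologicalGroup G :=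
  inferInstanceAs (IsTopologicalGroup G.toSubgroup)

section Exponential

/-- The matrix exponential, with values in the invertible matrices. -/
def expGL {n : ℕ} (Y : Matrix (Fin n) (Fin n) ℝ) : GL (Fin n) ℝ :=
  (Matrix.isUnit_exp Y).unit

theorem coe_expGL {n : ℕ} (Y : Matrix (Fin n) (Fin n) ℝ) :
    (expGL Y : Matrix (Fin n) (Fin n) ℝ) = NormedSpace.exp Y := rfl

theorem norm_pow_sub_pow_le {A : Type*} [NormedRing A] {a b : A} {M : ℝ} (hM : 1 ≤ M)
    (ha : ‖a‖ ≤ M) (hb : ‖b‖ ≤ M) (m : ℕ) : ‖a ^ m - b ^ m‖ ≤ m * M ^ m * ‖a - b‖ := by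
  have hM0 : 0 ≤ M := zero_le_one.trans hM
  induction m with
  | zero => simp
  | succ m ih =>
    rcases Nat.eq_zero_or_pos m with rfl | hm
    · simpa using le_mul_of_one_le_left (norm_nonneg (a - b)) hM
    have key : a ^ (m + 1) - b ^ (m + 1) = a ^ m * (a - b) + (a ^ m - b ^ m) * b := by
      rw [pow_succ, pow_succ]; noncomm_ring
    have h1 : ‖a ^ m * (a - b)‖ ≤ M ^ (m + 1) * ‖a - b‖ := by
      refine (norm_mul_le _ _).trans (mul_le_mul_of_nonneg_right ?_ (norm_nonneg _))
      exact ((norm_pow_le' a hm).trans (pow_le_pow_left₀ (norm_nonneg _) ha m)).trans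
        (pow_le_pow_right₀ hM (Nat.le_succ m))
    have h2 : ‖(a ^ m - b ^ m) * b‖ ≤ m * M ^ (m + 1) * ‖a - b‖ := by
      refine (norm_mul_le _ _).trans ?_
      calc ‖a ^ m - b ^ m‖ * ‖b‖ ≤ (m * M ^ m * ‖a - b‖) * M :=
            mul_le_mul ih hb (norm_nonneg _) (by positivity)
        _ = m * M ^ (m + 1) * ‖a - b‖ := by ring
    rw [key]
    refine (norm_add_le _ _).trans ((add_le_add h1 h2).trans (le_of_eq ?_))
    push_cast; ring

/-- The Lie product formula in a real Banach algebra. -/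
theorem tendsto_exp_mul_exp_pow {A : Type*} [NormedRing A] [NormedAlgebra ℝ A] [CompleteSpace A]
    (one : ‖(1 : A)‖ ≤ 1) (X Y : A) :
    Tendsto (fun m : ℕ => (NormedSpace.exp (((m : ℝ)⁻¹) • X) *
      NormedSpace.exp (((m : ℝ)⁻¹) • Y)) ^ m) atTop (𝓝 (NormedSpace.exp (X + Y))) := by
  let _ : NormedAlgebra ℚ A := NormedAlgebra.restrictScalars ℚ ℝ A
  obtain ⟨c, hc⟩ : ∃ c : ℝ → A, c = fun t => NormedSpace.exp (t • X) * NormedSpace.exp (t • Y) :=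
    ⟨_, rfl⟩
  obtain ⟨b, hb⟩ : ∃ b : ℝ → A, b = fun t => NormedSpace.exp (t • (X + Y)) := ⟨_, rfl⟩
  have hc' : HasDerivAt c (X + Y) 0 := by
    have := (hasDerivAt_exp_smul_const (𝕂 := ℝ) X 0).mul (hasDerivAt_exp_smul_const (𝕂 := ℝ) Y 0)
    rw [hc]
    simpa only [zero_smul, NormedSpace.exp_zero, one_mul, mul_one, Pi.mul_def] using this
  have hb' : HasDerivAt b (X + Y) 0 := by
    have := hasDerivAt_exp_smul_const (𝕂 := ℝ) (X + Y) 0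
    rw [hb]
    simpa only [zero_smul, NormedSpace.exp_zero, one_mul] using this
  have h0 : Tendsto (fun m : ℕ => ((m : ℝ)⁻¹)) atTop (𝓝[≠] 0) := by
    refine tendsto_nhdsWithin_iff.2 ⟨tendsto_inv_atTop_nhds_zero_nat, ?_⟩
    filter_upwards [eventually_gt_atTop 0] with m hm
    simpa using hm.ne'
  have sc := (hc'.tendsto_slope_zero.comp h0)
  have sb := (hb'.tendsto_slope_zero.comp h0)
  have c0 : c 0 = 1 := by simp [hc]
  have b0 : b 0 = 1 := by simp [hb]
  simp only [Function.comp_def, zero_add, inv_inv, c0, b0] at sc sb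
  obtain ⟨C, hC⟩ : ∃ C : ℝ, ∀ᶠ m : ℕ in atTop,
      ‖(m : ℝ) • (c (m : ℝ)⁻¹ - 1)‖ ≤ C ∧ ‖(m : ℝ) • (b (m : ℝ)⁻¹ - 1)‖ ≤ C := by
    refine ⟨‖X + Y‖ + 1, ?_⟩
    filter_upwards [sc.norm.eventually_le_const (lt_add_one ‖X + Y‖),
      sb.norm.eventually_le_const (lt_add_one ‖X + Y‖)] with m h1 h2 using ⟨h1, h2⟩
  have hdiff : Tendsto (fun m : ℕ => Real.exp C * ‖(m : ℝ) • (c (m : ℝ)⁻¹ - b (m : ℝ)⁻¹)‖)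
      atTop (𝓝 0) := by
    have := (sc.sub sb).norm.const_mul (Real.exp C)
    simp only [sub_self, norm_zero, mul_zero] at this
    refine this.congr fun m => ?_
    rw [← smul_sub]; congr 3; abel
  have hbpow : ∀ᶠ m : ℕ in atTop, b (m : ℝ)⁻¹ ^ m = NormedSpace.exp (X + Y) := by
    filter_upwards [eventually_gt_atTop 0] with m hm
    have hm' : (m : ℝ) ≠ 0 := by exact_mod_cast hm.ne'
    rw [hb, ← NormedSpace.exp_nsmul, ← Nat.cast_smul_eq_nsmul ℝ, smul_smul, mul_inv_cancel₀ hm',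
      one_smul]
  have goal_eq : (fun m : ℕ => (NormedSpace.exp (((m : ℝ)⁻¹) • X) *
      NormedSpace.exp (((m : ℝ)⁻¹) • Y)) ^ m) = fun m : ℕ => c (m : ℝ)⁻¹ ^ m := by rw [hc]
  rw [goal_eq, tendsto_iff_norm_sub_tendsto_zero]
  refine squeeze_zero' (Eventually.of_forall fun _ => norm_nonneg _) ?_ hdiff
  filter_upwards [hC, hbpow, eventually_gt_atTop 0] with m hm hbm hpos
  have hm' : (0 : ℝ) < m := by exact_mod_cast hpos
  have bound : ∀ a : A, ‖(m : ℝ) • (a - 1)‖ ≤ C →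
      ‖a‖ ≤ Real.exp (C / m) := by
    intro a ha
    rw [norm_smul, Real.norm_of_nonneg hm'.le] at ha
    have h1 : ‖a - 1‖ ≤ C / m := by rw [le_div_iff₀ hm']; linarith
    have h2 : ‖a‖ ≤ ‖a - 1‖ + ‖(1 : A)‖ := by
      simpa using norm_add_le (a - 1) 1
    linarith [Real.add_one_le_exp (C / m)]
  have hC0 : 0 ≤ C := (norm_nonneg _).trans hm.1
  have h := norm_pow_sub_pow_le (Real.one_le_exp (div_nonneg hC0 hm'.le))
    (bound _ hm.1) (bound _ hm.2) m
  rw [hbm, ← Real.exp_nat_mul, mul_div_cancel₀ _ hm'.ne'] at h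
  rw [norm_smul, Real.norm_of_nonneg hm'.le]
  calc _ ≤ _ := h
    _ = _ := by ring

theorem tendsto_conj_exp {A : Type*} [NormedRing A] [NormedAlgebra ℝ A] [CompleteSpace A]
    (X Y : A) : Tendsto (fun t : ℝ => t⁻¹ •
      (NormedSpace.exp (t • X) * Y * NormedSpace.exp (t • (-X)) - Y)) (𝓝[≠] 0)
      (𝓝 (X * Y - Y * X)) := by
  have := (((hasDerivAt_exp_smul_const (𝕂 := ℝ) X 0).mul_const Y).mul
    (hasDerivAt_exp_smul_const (𝕂 := ℝ) (-X) 0)).tendsto_slope_zero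
  simpa only [zero_smul, NormedSpace.exp_zero, one_mul, mul_one, mul_neg, ← sub_eq_add_neg,
    zero_add, Pi.mul_def] using this

theorem tendsto_exp_mul_exp_pow_matrix {n : ℕ} (X Y : Matrix (Fin n) (Fin n) ℝ) :
    Tendsto (fun m : ℕ => (NormedSpace.exp (((m : ℝ)⁻¹) • X) *
      NormedSpace.exp (((m : ℝ)⁻¹) • Y)) ^ m) atTop (𝓝 (NormedSpace.exp (X + Y))) := by
  let _ : NormedRing (Matrix (Fin n) (Fin n) ℝ) := Matrix.linftyOpNormedRing
  let _ : NormedAlgebra ℝ (Matrix (Fin n) (Fin n) ℝ) := Matrix.linftyOpNormedAlgebra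
  have one : ‖(1 : Matrix (Fin n) (Fin n) ℝ)‖ ≤ 1 := by
    rcases Nat.eq_zero_or_pos n with rfl | hn
    · rw [Subsingleton.elim (1 : Matrix (Fin 0) (Fin 0) ℝ) 0]; simp
    · have : Nonempty (Fin n) := ⟨⟨0, hn⟩⟩
      have : NormOneClass (Matrix (Fin n) (Fin n) ℝ) := Matrix.linfty_opNormOneClass
      exact norm_one.le
  exact tendsto_exp_mul_exp_pow one X Y

theorem tendsto_conj_exp_matrix {n : ℕ} (X Y : Matrix (Fin n) (Fin n) ℝ) :
    Tendsto (fun t : ℝ => t⁻¹ •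
      (NormedSpace.exp (t • X) * Y * NormedSpace.exp (t • (-X)) - Y)) (𝓝[≠] 0)
      (𝓝 (X * Y - Y * X)) := by
  let _ : NormedRing (Matrix (Fin n) (Fin n) ℝ) := Matrix.linftyOpNormedRing
  let _ : NormedAlgebra ℝ (Matrix (Fin n) (Fin n) ℝ) := Matrix.linftyOpNormedAlgebra
  exact tendsto_conj_exp X Y

end Exponential

end

attribute [local instance 100] LieRing.ofAssociativeRing

noncomputable section

/-- The Lie algebra of a closed subgroup `G` of `GL_n(ℝ)`: all real matrices `Y` such that
`exp (t Y) ∈ G` for all real `t`, with the commutator bracket. -/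
def lieAlgebra {n : ℕ} (G : ClosedSubgroup (GL (Fin n) ℝ)) :
    LieSubalgebra ℝ (Matrix (Fin n) (Fin n) ℝ) :=
  let S : Submodule ℝ (Matrix (Fin n) (Fin n) ℝ) :=
    { carrier := {Y | ∀ t : ℝ, expGL (t • Y) ∈ G}
      add_mem' := by
        intro X Y hX hY t
        have hlim := tendsto_exp_mul_exp_pow_matrix (t • X) (t • Y)
        have hcl : IsClosed (G : Set (GL (Fin n) ℝ)) := G.isClosed'
        have hinv := tendsto_exp_mul_exp_pow_matrix (-(t • Y)) (-(t • X))
        have h1 : Tendsto (fun m : ℕ => (expGL (((m : ℝ)⁻¹) • (t • X)) *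
            expGL (((m : ℝ)⁻¹) • (t • Y))) ^ m) atTop (𝓝 (expGL (t • (X + Y)))) := by
          rw [Units.isEmbedding_embedProduct.tendsto_nhds_iff, nhds_prod_eq]
          refine Tendsto.prodMk ?_ ?_
          · simpa [Function.comp_def, Units.embedProduct, coe_expGL, smul_add] using hlim
          · refine (MulOpposite.continuous_op.tendsto _).comp ?_
            have key : ∀ Z : Matrix (Fin n) (Fin n) ℝ,
                (((expGL Z)⁻¹ : GL (Fin n) ℝ) : Matrix (Fin n) (Fin n) ℝ) =
                  NormedSpace.exp (-Z) := by
              intro Z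
              rw [Matrix.coe_units_inv, coe_expGL, Matrix.exp_neg]
            simp only [← inv_pow, mul_inv_rev, Units.val_pow_eq_pow_val, Units.val_mul, key]
            have e1 : -(t • Y) + -(t • X) = -(t • (X + Y)) := by rw [smul_add]; abel
            rw [e1] at hinv
            simpa using hinv
        refine hcl.mem_of_tendsto h1 (Eventually.of_forall fun m => ?_)
        refine pow_mem (mul_mem ?_ ?_) m
        · rw [smul_smul]; exact hX _
        · rw [smul_smul]; exact hY _
      zero_mem' := by
        intro t
        have : expGL (t • (0 : Matrix (Fin n) (Fin n) ℝ)) = 1 := by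
          ext1; simp [coe_expGL]
        rw [this]; exact one_mem G
      smul_mem' := by
        intro a Y hY t
        rw [smul_smul]; exact hY _ }
  { S with
    lie_mem' := by
      intro X Y hX hY
      have hconj : ∀ t : ℝ, NormedSpace.exp (t • X) * Y * NormedSpace.exp (t • (-X)) ∈ S := by
        intro t s
        have hXt : (((expGL (t • X))⁻¹ : GL (Fin n) ℝ) : Matrix (Fin n) (Fin n) ℝ) =
            NormedSpace.exp (t • (-X)) := by
          rw [Matrix.coe_units_inv, coe_expGL, smul_neg, Matrix.exp_neg]
        have : expGL (s • (NormedSpace.exp (t • X) * Y * NormedSpace.exp (t • (-X)))) =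
            expGL (t • X) * expGL (s • Y) * (expGL (t • X))⁻¹ := by
          ext1
          rw [coe_expGL, ← hXt, ← coe_expGL (t • X), ← smul_mul_assoc, ← mul_smul_comm,
            Matrix.exp_units_conj]
          rfl
        rw [this]
        exact mul_mem (mul_mem (hX t) (hY s)) (inv_mem (hX t))
      have hcl : IsClosed (S : Set (Matrix (Fin n) (Fin n) ℝ)) :=
        Submodule.closed_of_finiteDimensional S
      refine hcl.mem_of_tendsto (tendsto_conj_exp_matrix X Y) (Eventually.of_forall fun t => ?_)
      exact S.smul_mem _ (S.sub_mem (hconj _) hY) }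

/-- The exponential map `𝔤 → G`. -/
def expG {n : ℕ} {G : ClosedSubgroup (GL (Fin n) ℝ)} (Y : lieAlgebra G) : G :=
  ⟨expGL (Y : Matrix (Fin n) (Fin n) ℝ), by
    have h : ∀ t : ℝ, expGL (t • (Y : Matrix (Fin n) (Fin n) ℝ)) ∈ G := Y.2
    simpa using h 1⟩

/-! ### Connected semisimple real algebraic groups -/

/-- A subgroup of `GL_n(ℝ)` which is the zero locus in `GL_n(ℝ)` of a set of real polynomials in
the matrix entries, i.e. the group of real points of a linear algebraic group over `ℝ`. -/
def IsRealAlgebraic {n : ℕ} (H : Subgroup (GL (Fin n) ℝ)) : Prop :=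
  ∃ S : Set (MvPolynomial (Fin n × Fin n) ℝ), ∀ g : GL (Fin n) ℝ,
    g ∈ H ↔ ∀ p ∈ S,
      MvPolynomial.eval (fun ij => (g : Matrix (Fin n) (Fin n) ℝ) ij.1 ij.2) p = 0

/-- `G` is a connected semisimple real algebraic group: the identity component (for the Euclidean
topology) of a group of real points, with semisimple Lie algebra. -/
structure IsConnectedSemisimpleRealAlgebraic {n : ℕ} (G : ClosedSubgroup (GL (Fin n) ℝ)) :
    Prop where
  algebraic : ∃ H : Subgroup (GL (Fin n) ℝ), IsRealAlgebraic H ∧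
    (G : Set (GL (Fin n) ℝ)) = connectedComponentIn (H : Set (GL (Fin n) ℝ)) 1
  semisimple : LieAlgebra.IsSemisimple ℝ (lieAlgebra G)

/-- `K` is a maximal compact subgroup of `G` and `θ` is the Cartan involution of `𝔤` attached to
it: `θ` is an involutive automorphism of `𝔤`, the form `-B(Y, θ Z)` (`B` the Killing form) is
positive definite, and the fixed points of `θ` are the Lie algebra of `K`. -/
structure IsCartanPair {n : ℕ} {G : ClosedSubgroup (GL (Fin n) ℝ)} (K : Subgroup G)
    (θ : lieAlgebra G ≃ₗ⁅ℝ⁆ lieAlgebra G) : Prop where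
  isCompact : IsCompact (K : Set G)
  maximal : ∀ L : Subgroup G, IsCompact (L : Set G) → K ≤ L → L = K
  involutive : ∀ Y, θ (θ Y) = Y
  posDef : ∀ Y, Y ≠ 0 → 0 < -killingForm ℝ (lieAlgebra G) Y (θ Y)
  fixed : ∀ Y, θ Y = Y ↔ ∀ t : ℝ, expG (t • Y) ∈ K

/-- `e` is an orthonormal basis, for the Killing form, of the `(-1)`-eigenspace `𝔭` of `θ`, i.e. of
the tangent space of `X = G/K` at the base point. -/
structure IsOrthonormalFrame {n : ℕ} {G : ClosedSubgroup (GL (Fin n) ℝ)}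
    (θ : lieAlgebra G ≃ₗ⁅ℝ⁆ lieAlgebra G) {d : ℕ} (e : Fin d → lieAlgebra G) : Prop where
  mem : ∀ i, θ (e i) = -e i
  orthonormal : ∀ i j, killingForm ℝ (lieAlgebra G) (e i) (e j) = if i = j then 1 else 0
  spans : ∀ Y, θ Y = -Y → Y ∈ Submodule.span ℝ (Set.range e)

/-! ### The left invariant Riemannian distance on `G` -/

/-- The norm on `𝔤` of the inner product `⟨Y, Z⟩ = -B(Y, θ Z)`. -/
def cartanNorm {n : ℕ} {G : ClosedSubgroup (GL (Fin n) ℝ)}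
    (θ : lieAlgebra G ≃ₗ⁅ℝ⁆ lieAlgebra G) (Y : lieAlgebra G) : ℝ :=
  Real.sqrt (-killingForm ℝ (lieAlgebra G) Y (θ Y))

/-- `c` is a `C¹` curve `[0,1] → G` with `c'(t) = c(t) Y(t)`, `Y(t) ∈ 𝔤`. -/
def IsC1Curve {n : ℕ} {G : ClosedSubgroup (GL (Fin n) ℝ)} (c : ℝ → G) (Y : ℝ → lieAlgebra G) :
    Prop :=
  ContinuousOn Y (Set.Icc 0 1) ∧ ∀ t ∈ Set.Icc (0 : ℝ) 1, ∀ i j : Fin n,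
    HasDerivWithinAt (fun s : ℝ => ((c s : GL (Fin n) ℝ) : Matrix (Fin n) (Fin n) ℝ) i j)
      ((((c t : GL (Fin n) ℝ) : Matrix (Fin n) (Fin n) ℝ) *
        (Y t : Matrix (Fin n) (Fin n) ℝ)) i j) (Set.Icc 0 1) t

/-- The distance on `G` of the left invariant Riemannian metric which is `-B(Y, θ Z)` on `𝔤`: the
infimum of the lengths of the `C¹` curves from `g` to `h`. -/
def riemannianDist {n : ℕ} {G : ClosedSubgroup (GL (Fin n) ℝ)}
    (θ : lieAlgebra G ≃ₗ⁅ℝ⁆ lieAlgebra G) (g h : G) : ℝ≥0∞ :=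
  ⨅ (c : ℝ → G) (Y : ℝ → lieAlgebra G) (_ : IsC1Curve c Y ∧ c 0 = g ∧ c 1 = h),
    ENNReal.ofReal (∫ t in (0 : ℝ)..1, cartanNorm θ (Y t))

/-! ### The quotient `Γ\G` -/

/-- The space `Γ\G` of cosets `Γ g`. -/
def RightCosets {G : Type*} [Group G] (Γ : Subgroup G) : Type _ :=
  Quotient (QuotientGroup.rightRel Γ)

namespace RightCosets

section

variable {G : Type*} [Group G] (Γ : Subgroup G)

/-- The projection `g ↦ Γ g`. -/
def mk (g : G) : RightCosets Γ := Quotient.mk (QuotientGroup.rightRel Γ) g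

theorem mk_eq_mk {g h : G} : mk Γ g = mk Γ h ↔ h * g⁻¹ ∈ Γ :=
  Quotient.eq.trans QuotientGroup.rightRel_apply

/-- The right action of `G` on `Γ\G`, written as a left action of the opposite group:
`op g • Γ x = Γ x g`. -/
instance : MulAction Gᵐᵒᵖ (RightCosets Γ) where
  smul g := Quotient.map (fun x => x * g.unop) (by
    intro a b hab
    have hab' : b * a⁻¹ ∈ Γ := QuotientGroup.rightRel_apply.1 hab
    refine QuotientGroup.rightRel_apply.2 ?_
    have : b * g.unop * (a * g.unop)⁻¹ = b * a⁻¹ := by group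
    rwa [this])
  one_smul := by
    rintro ⟨x⟩
    exact congrArg (mk Γ) (mul_one x)
  mul_smul := by
    rintro g h ⟨x⟩
    exact congrArg (mk Γ) (mul_assoc x h.unop g.unop).symm

theorem op_smul_mk (g x : G) : MulOpposite.op g • mk Γ x = mk Γ (x * g) := rfl

variable [TopologicalSpace G]

/-- The quotient topology. -/
instance : TopologicalSpace (RightCosets Γ) :=
  inferInstanceAs (TopologicalSpace (Quotient (QuotientGroup.rightRel Γ)))

instance : MeasurableSpace (RightCosets Γ) := borel _

instance : BorelSpace (RightCosets Γ) := ⟨rfl⟩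

theorem continuous_mk : Continuous (mk Γ) := continuous_quot_mk

variable [IsTopologicalGroup G]

instance : ContinuousConstSMul Gᵐᵒᵖ (RightCosets Γ) where
  continuous_const_smul g := by
    refine continuous_quot_lift _ ?_
    exact (continuous_mk Γ).comp (continuous_mul_const g.unop)

variable [MeasurableSpace G] [BorelSpace G]

/-- The measure on `Γ\G` induced by a measure `μ` on `G`: the smallest measure which is at least
the image of `μ` restricted to `U`, for every open `U ⊆ G` that injects into `Γ\G`. If `μ` is a
Haar measure and `Γ` is discrete, this is the measure for which the injections `U → Γ\G` preserve
the measure, i.e. `∫_G f dμ = ∫_{Γ\G} ∑_{γ ∈ Γ} f(γ g) d(Γ g)`. -/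
def quotientMeasure (μ : Measure G) : Measure (RightCosets Γ) :=
  ⨆ (U : Set G) (_ : IsOpen U ∧ Set.InjOn (mk Γ) U), (μ.restrict U).map (mk Γ)

theorem le_map_quotientMeasure (μ : Measure G) [μ.IsMulRightInvariant] (g : G) :
    quotientMeasure Γ μ ≤ (quotientMeasure Γ μ).map (MulOpposite.op g • ·) := by
  refine iSup₂_le fun U hU => ?_
  have hmk : Measurable (mk Γ) := (continuous_mk Γ).measurable
  have hT : ∀ k : G, Measurable (fun x : RightCosets Γ => MulOpposite.op k • x) := fun k =>
    (continuous_const_smul (MulOpposite.op k)).measurable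
  have hV : IsOpen ((· * g) ⁻¹' U) ∧ Set.InjOn (mk Γ) ((· * g) ⁻¹' U) := by
    refine ⟨hU.1.preimage (continuous_mul_const g), fun a ha b hb hab => ?_⟩
    have : mk Γ (a * g) = mk Γ (b * g) := by
      rw [← op_smul_mk, ← op_smul_mk, hab]
    exact mul_right_cancel (hU.2 ha hb this)
  have h1 : (μ.restrict U).map (mk Γ) =
      ((μ.restrict ((· * g) ⁻¹' U)).map (mk Γ)).map (MulOpposite.op g • ·) := by
    rw [Measure.map_map (hT g) hmk]
    have : (fun x : RightCosets Γ => MulOpposite.op g • x) ∘ mk Γ = mk Γ ∘ (· * g) := rfl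
    rw [this, ← Measure.map_map hmk (continuous_mul_const g).measurable,
      ← Measure.restrict_map (continuous_mul_const g).measurable hU.1.measurableSet,
      map_mul_right_eq_self]
  rw [h1]
  exact Measure.map_mono (le_iSup₂_of_le _ hV le_rfl) (hT g)

/-- The induced measure is `G`-invariant. -/
instance (μ : Measure G) [μ.IsMulRightInvariant] :
    SMulInvariantMeasure Gᵐᵒᵖ (RightCosets Γ) (quotientMeasure Γ μ) where
  measure_preimage_smul := by
    intro g s hs
    have hT : ∀ k : Gᵐᵒᵖ, Measurable (fun x : RightCosets Γ => k • x) := fun k =>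
      (continuous_const_smul k).measurable
    refine le_antisymm ?_ ?_
    · have := le_map_quotientMeasure Γ μ (g⁻¹).unop ((fun x => g • x) ⁻¹' s)
      rw [Measure.map_apply (hT _) (hT g hs)] at this
      simpa [← Set.preimage_comp, Function.comp_def] using this
    · have := le_map_quotientMeasure Γ μ g.unop s
      rwa [Measure.map_apply (hT _) hs] at this

end

end RightCosets

/-! ### Injectivity radius -/

/-- The injectivity radius at `Γ g`: the supremum of all `r` such that the ball of radius `r` about
`g` injects into `Γ\G`. -/
def injRadiusAt {n : ℕ} {G : ClosedSubgroup (GL (Fin n) ℝ)}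
    (θ : lieAlgebra G ≃ₗ⁅ℝ⁆ lieAlgebra G) (Γ : Subgroup G) (g : G) : ℝ≥0∞ :=
  ⨆ (r : ℝ≥0) (_ : Set.InjOn (RightCosets.mk Γ) {h : G | riemannianDist θ h g < r}), (r : ℝ≥0∞)

/-- The injectivity radius of `Γ\G`. -/
def injRadius {n : ℕ} {G : ClosedSubgroup (GL (Fin n) ℝ)}
    (θ : lieAlgebra G ≃ₗ⁅ℝ⁆ lieAlgebra G) (Γ : Subgroup G) : ℝ≥0∞ :=
  ⨆ g : G, injRadiusAt θ Γ g

/-! ### Quasi-regular representations and weak containment -/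

/-- The unitary representation of `G` on `L²(Ω, ν)` given by a measure preserving right action of
`G` on `Ω`: `(g f)(x) = f(x g)`. -/
def rightRep (G : Type*) [Group G] (Ω : Type*) [MulAction Gᵐᵒᵖ Ω] [MeasurableSpace Ω]
    [MeasurableConstSMul Gᵐᵒᵖ Ω] (ν : Measure Ω) [SMulInvariantMeasure Gᵐᵒᵖ Ω ν] :
    G →* (Lp ℂ 2 ν ≃ₗᵢ[ℂ] Lp ℂ 2 ν) where
  toFun g :=
    { toFun := fun f => DomMulAct.mk (MulOpposite.op g) • f
      invFun := fun f => DomMulAct.mk (MulOpposite.op g⁻¹) • f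
      left_inv := fun f => by
        change DomMulAct.mk _ • DomMulAct.mk _ • f = f
        rw [smul_smul, ← DomMulAct.mk_mul, ← MulOpposite.op_mul]
        simp
      right_inv := fun f => by
        change DomMulAct.mk _ • DomMulAct.mk _ • f = f
        rw [smul_smul, ← DomMulAct.mk_mul, ← MulOpposite.op_mul]
        simp
      map_add' := fun f h => smul_add _ f h
      map_smul' := fun a f => smul_comm _ a f
      norm_map' := fun f => DomMulAct.norm_smul_Lp _ f }
  map_one' := by
    ext1 f
    exact one_smul (Gᵐᵒᵖᵈᵐᵃ) f
  map_mul' g h := by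
    ext1 f
    exact mul_smul (DomMulAct.mk (MulOpposite.op g)) (DomMulAct.mk (MulOpposite.op h)) f

/-- Weak containment of the unitary representation `π` in `σ`: every diagonal matrix coefficient
of `π` is approximated, uniformly on compact sets, by convex combinations of diagonal matrix
coefficients of `σ`. -/
def WeaklyContained {G : Type*} [Group G] [TopologicalSpace G]
    {V W : Type*} [NormedAddCommGroup V] [InnerProductSpace ℂ V]
    [NormedAddCommGroup W] [InnerProductSpace ℂ W]
    (π : G →* (V ≃ₗᵢ[ℂ] V)) (σ : G →* (W ≃ₗᵢ[ℂ] W)) : Prop :=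
  ∀ v : V, ∀ Q : Set G, IsCompact Q → ∀ ε : ℝ, 0 < ε →
    ∃ (m : ℕ) (a : Fin m → ℝ) (w : Fin m → W), (∀ i, 0 ≤ a i) ∧ ∑ i, a i = 1 ∧
      ∀ g ∈ Q, ‖inner ℂ v (π g v) - ∑ i, (a i : ℂ) * inner ℂ (w i) (σ g (w i))‖ < ε

/-! ### The Laplace operator on `Γ\X` and its spectrum

Functions on `Γ\X = Γ\G/K` are identified with right `K`-invariant functions on `Γ\G`. -/

section Laplace

variable {n : ℕ} {G : ClosedSubgroup (GL (Fin n) ℝ)} [MeasurableSpace G] [BorelSpace G]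

/-- The derivative of `φ` along the left invariant vector field `Y`. -/
def lieDeriv {Γ : Subgroup G} (Y : lieAlgebra G) (φ : RightCosets Γ → ℂ) (x : RightCosets Γ) : ℂ :=
  deriv (fun t : ℝ => φ (MulOpposite.op (expG (t • Y)) • x)) 0

/-- The space `C_c^∞(Γ\X)`: functions on `Γ\G` that are smooth (in exponential coordinates
`Y ↦ x exp Y`, `Y ∈ 𝔤`), right `K`-invariant and compactly supported. -/
structure IsTestFunction (K Γ : Subgroup G) (φ : RightCosets Γ → ℂ) : Prop where
  smooth : ∀ (x : RightCosets Γ) (m : ℕ) (Y : Fin m → lieAlgebra G),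
    ContDiff ℝ ∞ (fun t : Fin m → ℝ => φ (MulOpposite.op (expG (∑ i, t i • Y i)) • x))
  invariant : ∀ k ∈ K, ∀ x, φ (MulOpposite.op k • x) = φ x
  compact : HasCompactSupport φ

/-- The Dirichlet form `∫_{Γ\X} ⟨grad φ, grad ψ⟩ dvol`; `e` is an orthonormal basis of `𝔭`. -/
def dirichletForm {Γ : Subgroup G} (μ : Measure G) {d : ℕ} (e : Fin d → lieAlgebra G)
    (φ ψ : RightCosets Γ → ℂ) : ℂ :=
  ∫ x, ∑ i, lieDeriv (e i) φ x * conj (lieDeriv (e i) ψ x) ∂(RightCosets.quotientMeasure Γ μ)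

/-- The Hilbert space `L²(Γ\X)`: the `K`-invariant vectors of `L²(Γ\G)`. -/
def L2X (K Γ : Subgroup G) (μ : Measure G) [μ.IsMulRightInvariant] :
    Submodule ℂ (Lp ℂ 2 (RightCosets.quotientMeasure Γ μ)) where
  carrier := {f | ∀ k ∈ K, rightRep G (RightCosets Γ) (RightCosets.quotientMeasure Γ μ) k f = f}
  add_mem' := by
    intro f h hf hh k hk
    rw [map_add, hf k hk, hh k hk]
  zero_mem' := fun k _ => map_zero _
  smul_mem' := by
    intro a f hf k hk
    rw [map_smul, hf k hk]

/-- The sequence `φ` in `C_c^∞(Γ\X)` is Cauchy for the norm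
`‖φ‖² = ∫ |φ|² + ∫ ‖grad φ‖²` of `W¹(Γ\X)` and has the limit `f` in `L²(Γ\X)`; so `f` belongs to
the closure `W¹(Γ\X)` of `C_c^∞(Γ\X)` and `φ` converges to `f` in `W¹(Γ\X)`. -/
structure TendstoW1 (K Γ : Subgroup G) (μ : Measure G) [μ.IsMulRightInvariant] {d : ℕ}
    (e : Fin d → lieAlgebra G) (φ : ℕ → RightCosets Γ → ℂ) (f : L2X K Γ μ) : Prop where
  test : ∀ m, IsTestFunction K Γ (φ m)
  tendsto : Tendsto (fun m => eLpNorm (fun x => φ m x - f.1 x) 2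
    (RightCosets.quotientMeasure Γ μ)) atTop (𝓝 0)
  cauchy : ∀ ε : ℝ, 0 < ε → ∃ N : ℕ, ∀ m ≥ N, ∀ m' ≥ N,
    ‖dirichletForm μ e (φ m - φ m') (φ m - φ m')‖ < ε

/-- `f` is in the domain of the self-adjoint operator `-Δ` on `L²(Γ\X)` and `-Δ f = h`. This is the
(Friedrichs) extension of `-Δ` on `C_c^∞(Γ\X)` with domain in `W¹(Γ\X)`: `f ∈ W¹(Γ\X)` and
`∫ ⟨grad f, grad ψ⟩ dvol = ∫ h ψ̄ dvol` for all `ψ ∈ C_c^∞(Γ\X)`. -/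
def NegLaplacian (K Γ : Subgroup G) (μ : Measure G) [μ.IsMulRightInvariant] {d : ℕ}
    (e : Fin d → lieAlgebra G) (f h : L2X K Γ μ) : Prop :=
  ∃ φ : ℕ → RightCosets Γ → ℂ, TendstoW1 K Γ μ e φ f ∧
    ∀ ψ : RightCosets Γ → ℂ, IsTestFunction K Γ ψ →
      Tendsto (fun m => dirichletForm μ e (φ m) ψ) atTop
        (𝓝 (∫ x, h.1 x * conj (ψ x) ∂(RightCosets.quotientMeasure Γ μ)))

/-- The `L²`-spectrum `σ(Γ\X)` of `-Δ`: all complex `z` for which `-Δ - z` has no bounded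
inverse. For `Γ` trivial this is `σ(X)`. -/
def laplaceSpectrum (K Γ : Subgroup G) (μ : Measure G) [μ.IsMulRightInvariant] {d : ℕ}
    (e : Fin d → lieAlgebra G) : Set ℂ :=
  {z | ¬ ∃ R : L2X K Γ μ →L[ℂ] L2X K Γ μ,
    (∀ h, NegLaplacian K Γ μ e (R h) (h + z • R h)) ∧
    ∀ f h, NegLaplacian K Γ μ e f h → R (h - z • f) = f}

end Laplace

end

noncomputable section

/-! ### Closed subgroups of the unit group of a Banach algebra -/

section BanachAlgebra

variable {A : Type*} [NormedRing A] [NormedAlgebra ℝ A] [CompleteSpace A]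

/-! Since `G` is connected, every compact `Q ⊆ G` lies in a ball of finite radius about `1`. If the
injectivity radius is infinite, left invariance of the distance moves that ball to a centre `g`
where it injects, so `h ↦ Γ g h` is injective on `Q` (`exists_injOn_of_injRadius_eq_top`). On an
open set `U` where it is injective, this map is a measure preserving homeomorphism onto an open
subset of `Γ\G`, compatible with right translation as long as one stays in `U`
(`restrict_image_cosetMap_quotientMeasure`). Compactly supported objects on `G` can thus be copied
to `Γ\G`; the copy of a function is `pushFun`.

Weak containment: approximate a vector of `L²(G)` by `f ∈ C_c(G)`. If `U` contains `supp f` and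
`(supp f) Q`, then `f` and its copy have the same matrix coefficient on `Q`, so a single coefficient
of `L²(Γ\G)` suffices.

Spectrum: the inclusion is proved with quadratic forms, independently of the first part. By
`isFormResolvent_iff_exists_bound`, `z` lies in the resolvent set if and only if the functional `ψ ↦
∫⟨grad φ, grad ψ⟩ - z ∫ φ ψ̄` has dual `W¹` norm at least `c ‖φ‖`, with `c > 0` independent of the
test function `φ`. Suppose that this holds on `Γ\X`, and copy a test function `f` of `X` to `F` on
`Γ\X`. Pairing `F` with `ψ` gives the same value as pairing `f` with `χ ψ̃`, where `ψ̃` is the lift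
of `ψ` to `G` and `χ` is a cutoff equal to `1` near `supp f`. The `W¹` norm of `χ ψ̃` is at most a
constant times that of `ψ`. This constant depends only on bounds for `χ` and its first derivatives,
which `exists_cutoff` makes independent of `supp f`. Hence the lower bound passes to `X`.

Closed linear groups enter through the closed subgroup theorem: exponential coordinates are charts,
which gives the bounded curves in `G` and the continuity of derivatives of test functions. -/

theorem contDiff_normedSpace_exp : ContDiff ℝ ∞ (NormedSpace.exp : A → A) :=
  contDiff_iff_contDiffAt.2 fun x => (NormedSpace.exp_analytic (𝕂 := ℝ) x).contDiffAt

theorem continuous_normedSpace_exp : Continuous (NormedSpace.exp : A → A) :=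
  (contDiff_normedSpace_exp (A := A)).continuous

theorem exists_contDiffAt_log : ∃ Λ : A → A, ContDiffAt ℝ ∞ Λ 1 ∧
    ∀ᶠ Z in 𝓝 (0 : A), Λ (NormedSpace.exp Z) = Z := by
  have h1 : ContDiffAt ℝ ∞ (NormedSpace.exp : A → A) 0 := contDiff_normedSpace_exp.contDiffAt
  have h2 : HasFDerivAt (NormedSpace.exp : A → A)
      ((ContinuousLinearEquiv.refl ℝ A : A ≃L[ℝ] A) : A →L[ℝ] A) 0 :=
    (hasStrictFDerivAt_exp_zero (𝕂 := ℝ)).hasFDerivAt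
  have hn : (∞ : WithTop ℕ∞) ≠ 0 := by simp
  refine ⟨h1.localInverse h2 hn, by simpa using h1.to_localInverse h2 hn, ?_⟩
  exact (h1.hasStrictFDerivAt' h2 hn).eventually_left_inverse

/-- The powers of `exp (Y k)` with exponent `⌊t / ‖Y k‖⌋` converge to `exp (t Z)`, the rounding
error being at most `‖Y k‖`. Closedness of `S` is required only at exponentials, because the
matrices of a closed subgroup of `GL_n` need not be closed among all matrices. -/
theorem exp_smul_mem_of_tendsto {S : Submonoid A}
    (hcl : ∀ Z, NormedSpace.exp Z ∈ closure (S : Set A) → NormedSpace.exp Z ∈ S)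
    {Y : ℕ → A} {Z : A} (hY : ∀ k, NormedSpace.exp (Y k) ∈ S) (hY0 : ∀ k, Y k ≠ 0)
    (hlim : Tendsto Y atTop (𝓝 0)) (hZ : Tendsto (fun k => ‖Y k‖⁻¹ • Y k) atTop (𝓝 Z))
    {t : ℝ} (ht : 0 ≤ t) : NormedSpace.exp (t • Z) ∈ S := by
  let _ : NormedAlgebra ℚ A := NormedAlgebra.restrictScalars ℚ ℝ A
  apply hcl
  have hr : Tendsto (fun k => ‖Y k‖) atTop (𝓝 0) := by simpa using hlim.norm
  have h1 : Tendsto (fun k => (⌊t / ‖Y k‖⌋₊ : ℝ) * ‖Y k‖) atTop (𝓝 t) := by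
    have : Tendsto (fun k => t - ‖Y k‖) atTop (𝓝 t) := by simpa using hr.const_sub t
    refine tendsto_of_tendsto_of_tendsto_of_le_of_le this tendsto_const_nhds ?_ ?_
    · intro k
      have hp : 0 < ‖Y k‖ := norm_pos_iff.2 (hY0 k)
      have := Nat.lt_floor_add_one (t / ‖Y k‖)
      rw [div_lt_iff₀ hp] at this
      change t - ‖Y k‖ ≤ _
      nlinarith
    · intro k
      have hp : 0 < ‖Y k‖ := norm_pos_iff.2 (hY0 k)
      have := Nat.floor_le (div_nonneg ht hp.le)
      rwa [le_div_iff₀ hp] at this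
  have h2 : Tendsto (fun k => NormedSpace.exp (Y k) ^ ⌊t / ‖Y k‖⌋₊) atTop
      (𝓝 (NormedSpace.exp (t • Z))) := by
    refine ((continuous_normedSpace_exp.tendsto _).comp (h1.smul hZ)).congr fun k => ?_
    have hp : ‖Y k‖ ≠ 0 := norm_ne_zero_iff.2 (hY0 k)
    rw [Function.comp_apply, smul_smul, mul_assoc, mul_inv_cancel₀ hp, mul_one,
      Nat.cast_smul_eq_nsmul, NormedSpace.exp_nsmul]
  exact mem_closure_of_tendsto h2 (Eventually.of_forall fun k => pow_mem (hY k) _)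

variable [FiniteDimensional ℝ A]

/-- Otherwise there are nonzero `Y k → 0` in `M` with `exp (Y k) ∈ S`. By compactness of the unit
sphere their directions subconverge to a unit vector of `M`, whose one-parameter group lies in `S`;
it therefore lies in `L ⊓ M = 0`. -/
theorem eq_zero_of_exp_mem {S : Submonoid A}
    (hcl : ∀ Z, NormedSpace.exp Z ∈ closure (S : Set A) → NormedSpace.exp Z ∈ S)
    (hinv : ∀ Z, NormedSpace.exp Z ∈ S → NormedSpace.exp (-Z) ∈ S)
    {L M : Submodule ℝ A} (hL : ∀ Y, (∀ t : ℝ, NormedSpace.exp (t • Y) ∈ S) → Y ∈ L)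
    (hLM : Disjoint L M) : ∀ᶠ Y in 𝓝 (0 : A), Y ∈ M → NormedSpace.exp Y ∈ S → Y = 0 := by
  by_contra hcon
  rw [not_eventually] at hcon
  obtain ⟨Y, hlim, hY⟩ := exists_seq_forall_of_frequently hcon
  simp only [Classical.not_imp] at hY
  have hsph : ∀ k, ‖Y k‖⁻¹ • Y k ∈ Metric.sphere (0 : A) 1 := by
    intro k
    have hp : ‖Y k‖ ≠ 0 := norm_ne_zero_iff.2 (hY k).2.2
    simp [norm_smul, hp]
  have : ProperSpace A := FiniteDimensional.proper ℝ A
  obtain ⟨Z, hZ, ψ, hψ, hψZ⟩ := (isCompact_sphere (0 : A) 1).tendsto_subseq hsph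
  have hpos : ∀ t : ℝ, 0 ≤ t → NormedSpace.exp (t • Z) ∈ S := fun t ht =>
    exp_smul_mem_of_tendsto hcl (Y := Y ∘ ψ) (fun k => (hY _).2.1) (fun k => (hY _).2.2)
      (hlim.comp hψ.tendsto_atTop) hψZ ht
  have hZL : Z ∈ L := by
    refine hL Z fun t => ?_
    rcases le_total 0 t with ht | ht
    · exact hpos t ht
    · simpa using hinv _ (hpos (-t) (by linarith))
  have hZM : Z ∈ M := by
    have hc : IsClosed (M : Set A) := Submodule.closed_of_finiteDimensional M
    exact hc.mem_of_tendsto hψZ (Eventually.of_forall fun k => M.smul_mem _ (hY _).1)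
  have : Z = 0 := by
    have := hLM.le_bot (Submodule.mem_inf.2 ⟨hZL, hZM⟩)
    simpa using this
  simp [this] at hZ

/-- The closed subgroup theorem: near `1` every element of `S` is the exponential of a small element
of the Lie algebra `L` of `S`. -/
theorem eventually_exists_exp_eq {S : Submonoid A}
    (hcl : ∀ Z, NormedSpace.exp Z ∈ closure (S : Set A) → NormedSpace.exp Z ∈ S)
    (hinv : ∀ Z, NormedSpace.exp Z ∈ S → NormedSpace.exp (-Z) ∈ S)
    {L : Submodule ℝ A} (hL : ∀ Y, Y ∈ L ↔ ∀ t : ℝ, NormedSpace.exp (t • Y) ∈ S)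
    {O : Set A} (hO : O ∈ 𝓝 (0 : A)) :
    ∀ᶠ s in 𝓝 (1 : A), s ∈ S → ∃ X ∈ L, X ∈ O ∧ NormedSpace.exp X = s := by
  let _ : NormedAlgebra ℚ A := NormedAlgebra.restrictScalars ℚ ℝ A
  obtain ⟨M, hM⟩ := L.exists_isCompl
  -- At `0` the map `(X, Y) ↦ exp X * exp Y` on `L × M` has derivative `X + Y`, which is onto. Hence
  -- it sends neighbourhoods of `0` onto neighbourhoods of `1`.
  have hd : HasStrictFDerivAt (fun q : L × M => NormedSpace.exp (q.1 : A) * NormedSpace.exp (q.2 : A))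
      (L.subtypeL.coprod M.subtypeL) 0 := by
    have he : HasStrictFDerivAt (NormedSpace.exp : A → A) (1 : A →L[ℝ] A) 0 :=
      hasStrictFDerivAt_exp_zero (𝕂 := ℝ)
    have e1 : HasStrictFDerivAt (fun q : L × M => NormedSpace.exp (q.1 : A))
        ((1 : A →L[ℝ] A).comp (L.subtypeL.comp (ContinuousLinearMap.fst ℝ L M))) 0 :=
      HasStrictFDerivAt.comp (f := fun q : L × M => (q.1 : A)) (0 : L × M) (by simpa using he)
        (L.subtypeL.comp (ContinuousLinearMap.fst ℝ L M)).hasStrictFDerivAt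
    have e2 : HasStrictFDerivAt (fun q : L × M => NormedSpace.exp (q.2 : A))
        ((1 : A →L[ℝ] A).comp (M.subtypeL.comp (ContinuousLinearMap.snd ℝ L M))) 0 :=
      HasStrictFDerivAt.comp (f := fun q : L × M => (q.2 : A)) (0 : L × M) (by simpa using he)
        (M.subtypeL.comp (ContinuousLinearMap.snd ℝ L M)).hasStrictFDerivAt
    refine (e1.mul' e2).congr_fderiv ?_
    ext q <;> simp
  have hr : (L.subtypeL.coprod M.subtypeL).range = ⊤ := by
    rw [ContinuousLinearMap.range_coprod]
    simpa using hM.sup_eq_top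
  have hmap := hd.map_nhds_eq_of_surj hr
  have hset : {q : L × M | (q.1 : A) ∈ O ∧ ((q.2 : A) ∈ M → NormedSpace.exp (q.2 : A) ∈ S →
      (q.2 : A) = 0)} ∈ 𝓝 (0 : L × M) := by
    have c1 : Tendsto (fun q : L × M => (q.1 : A)) (𝓝 0) (𝓝 0) :=
      (continuous_subtype_val.comp continuous_fst).tendsto' _ _ rfl
    have c2 : Tendsto (fun q : L × M => (q.2 : A)) (𝓝 0) (𝓝 0) :=
      (continuous_subtype_val.comp continuous_snd).tendsto' _ _ rfl
    exact (c1.eventually hO).and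
      (c2.eventually (eq_zero_of_exp_mem hcl hinv (fun Y => (hL Y).2) hM.disjoint))
  have himg := image_mem_map (m := fun q : L × M =>
    NormedSpace.exp (q.1 : A) * NormedSpace.exp (q.2 : A)) hset
  rw [hmap] at himg
  simp only [Prod.fst_zero, Prod.snd_zero, ZeroMemClass.coe_zero, NormedSpace.exp_zero,
    mul_one] at himg
  filter_upwards [himg] with s hs hsS
  obtain ⟨⟨X, Y⟩, ⟨hX, hY⟩, rfl⟩ := hs
  refine ⟨X, X.2, hX, ?_⟩
  have hXS : NormedSpace.exp (X : A) ∈ S := by simpa using (hL X).1 X.2 1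
  have hexp : NormedSpace.exp (-(X : A)) * NormedSpace.exp (X : A) = 1 := by
    rw [← NormedSpace.exp_add_of_commute ((Commute.refl (X : A)).neg_left)]; simp
  -- If `exp X * exp Y` is in `S`, so is the transversal factor `exp Y`, and a small such `Y` in `M`
  -- vanishes.
  have hYS : NormedSpace.exp (Y : A) ∈ S := by
    have := S.mul_mem (hinv _ hXS) hsS
    simpa [← mul_assoc, hexp] using this
  have hY0 : (Y : A) = 0 := hY Y.2 hYS
  simp [hY0]

/-- Right multiplication by `exp (s Y)`, read in exponential coordinates of `L`, is smooth: take the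
logarithm of the product. By the closed subgroup theorem this logarithm lies in `L`. -/
theorem exists_contDiffAt_mul_exp {S : Submonoid A}
    (hcl : ∀ Z, NormedSpace.exp Z ∈ closure (S : Set A) → NormedSpace.exp Z ∈ S)
    (hinv : ∀ Z, NormedSpace.exp Z ∈ S → NormedSpace.exp (-Z) ∈ S)
    {L : Submodule ℝ A} (hL : ∀ Y, Y ∈ L ↔ ∀ t : ℝ, NormedSpace.exp (t • Y) ∈ S)
    {m : ℕ} (b : Module.Basis (Fin m) ℝ L) {Y : A} (hY : Y ∈ L) :
    ∃ Θ : (Fin m → ℝ) × ℝ → (Fin m → ℝ), ContDiffAt ℝ ∞ Θ 0 ∧ ∀ᶠ p in 𝓝 (0 : (Fin m → ℝ) × ℝ),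
      NormedSpace.exp (∑ i, p.1 i • (b i : A)) * NormedSpace.exp (p.2 • Y) =
        NormedSpace.exp (∑ i, Θ p i • (b i : A)) := by
  obtain ⟨Λ, hΛ, hΛ'⟩ := exists_contDiffAt_log (A := A)
  -- Composing with a linear projection onto `L` makes `Θ` defined and smooth before it is known
  -- that the logarithm lies in `L`.
  obtain ⟨P, hP⟩ := L.subtype.exists_leftInverse_of_injective L.ker_subtype
  have hP' : ∀ X (hX : X ∈ L), P X = ⟨X, hX⟩ := fun X hX => LinearMap.congr_fun hP ⟨X, hX⟩
  obtain ⟨u, hu⟩ : ∃ u : (Fin m → ℝ) × ℝ → A, u = fun p =>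
    NormedSpace.exp (∑ i, p.1 i • (b i : A)) * NormedSpace.exp (p.2 • Y) := ⟨_, rfl⟩
  have huc : ContDiff ℝ ∞ u := by
    rw [hu]
    refine ContDiff.mul (contDiff_normedSpace_exp.comp ?_) (contDiff_normedSpace_exp.comp ?_)
    · fun_prop
    · fun_prop
  have hu0 : u 0 = 1 := by simp [hu]
  obtain ⟨T, hT⟩ : ∃ T : A →L[ℝ] (Fin m → ℝ), ∀ X, T X = b.equivFun (P X) :=
    ⟨LinearMap.toContinuousLinearMap (b.equivFun.toLinearMap ∘ₗ P), fun X => rfl⟩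
  refine ⟨fun p => T (Λ (u p)), ?_, ?_⟩
  · refine T.contDiff.contDiffAt.comp _ (ContDiffAt.comp _ ?_ huc.contDiffAt)
    rwa [hu0]
  · have h1 : Tendsto u (𝓝 0) (𝓝 1) := huc.continuous.tendsto' _ _ hu0
    filter_upwards [h1.eventually (eventually_exists_exp_eq hcl hinv hL hΛ')] with p hp
    have hmem : ∀ X ∈ L, NormedSpace.exp X ∈ S := fun X hX => by simpa using (hL X).1 hX 1
    have hpS : u p ∈ S := by
      rw [hu]
      exact S.mul_mem (hmem _ (L.sum_mem fun i _ => L.smul_mem _ (b i).2))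
        (hmem _ (L.smul_mem _ hY))
    obtain ⟨X, hX, hXO, hXe⟩ := hp hpS
    have e1 : ∑ i, T (Λ (u p)) i • (b i : A) = X := by
      have hXO' : Λ (NormedSpace.exp X) = X := hXO
      rw [← hXe, hXO', hT, hP' X hX]
      have := congrArg L.subtype (b.sum_equivFun ⟨X, hX⟩)
      rw [map_sum] at this
      simpa only [map_smul, Submodule.subtype_apply] using this
    change _ = NormedSpace.exp (∑ i, T (Λ (u p)) i • (b i : A))
    rw [e1, hXe, hu]

end BanachAlgebra

/-! ### Closed linear groups -/

theorem Matrix.isOpenEmbedding_units_val (n : ℕ) :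
    IsOpenEmbedding (Units.val : GL (Fin n) ℝ → Matrix (Fin n) (Fin n) ℝ) := by
  -- An auxiliary norm that makes the matrices a Banach algebra; its topology is the product
  -- topology of the statement.
  let _ : NormedRing (Matrix (Fin n) (Fin n) ℝ) := Matrix.linftyOpNormedRing
  let _ : NormedAlgebra ℝ (Matrix (Fin n) (Fin n) ℝ) := Matrix.linftyOpNormedAlgebra
  exact Units.isOpenEmbedding_val

instance (n : ℕ) : SecondCountableTopology (GL (Fin n) ℝ) :=
  have : SecondCountableTopology (Matrix (Fin n) (Fin n) ℝ) :=
    inferInstanceAs (SecondCountableTopology (Fin n → Fin n → ℝ))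
  (Matrix.isOpenEmbedding_units_val n).isEmbedding.secondCountableTopology

instance (n : ℕ) : LocallyCompactSpace (GL (Fin n) ℝ) :=
  have : LocallyCompactSpace (Matrix (Fin n) (Fin n) ℝ) :=
    inferInstanceAs (LocallyCompactSpace (Fin n → Fin n → ℝ))
  (Matrix.isOpenEmbedding_units_val n).locallyCompactSpace

section ClosedLinearGroup

variable {n : ℕ} {G : ClosedSubgroup (GL (Fin n) ℝ)}

theorem ClosedSubgroup.isClosedEmbedding_subtype_val (G : ClosedSubgroup (GL (Fin n) ℝ)) :
    IsClosedEmbedding (Subtype.val : G → GL (Fin n) ℝ) :=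
  IsClosed.isClosedEmbedding_subtypeVal G.isClosed'

instance : SecondCountableTopology G :=
  G.isClosedEmbedding_subtype_val.isEmbedding.secondCountableTopology

instance : LocallyCompactSpace G := G.isClosedEmbedding_subtype_val.locallyCompactSpace

/-- The matrix of an element of `G`. -/
abbrev ClosedSubgroup.toMatrix (g : G) : Matrix (Fin n) (Fin n) ℝ := ((g : GL (Fin n) ℝ) : Matrix _ _ ℝ)

theorem isEmbedding_toMatrix :
    IsEmbedding (ClosedSubgroup.toMatrix : G → Matrix (Fin n) (Fin n) ℝ) :=
  (Matrix.isOpenEmbedding_units_val n).isEmbedding.comp G.isClosedEmbedding_subtype_val.isEmbedding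

theorem toMatrix_mul (g h : G) :
    ClosedSubgroup.toMatrix (g * h) = ClosedSubgroup.toMatrix g * ClosedSubgroup.toMatrix h := rfl

theorem toMatrix_one : ClosedSubgroup.toMatrix (1 : G) = 1 := rfl

theorem toMatrix_expG (Y : lieAlgebra G) :
    ClosedSubgroup.toMatrix (expG Y) = NormedSpace.exp (Y : Matrix (Fin n) (Fin n) ℝ) := rfl

theorem toMatrix_injective :
    Function.Injective (ClosedSubgroup.toMatrix : G → Matrix (Fin n) (Fin n) ℝ) :=
  isEmbedding_toMatrix.injective

theorem expG_zero : expG (0 : lieAlgebra G) = 1 :=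
  toMatrix_injective (by rw [toMatrix_expG, toMatrix_one]; simp)

theorem expG_add_smul (s t : ℝ) (Y : lieAlgebra G) :
    expG ((s + t) • Y) = expG (s • Y) * expG (t • Y) := by
  apply toMatrix_injective
  rw [toMatrix_mul, toMatrix_expG, toMatrix_expG, toMatrix_expG, add_smul]
  exact Matrix.exp_add_of_commute _ _ (((Commute.refl (Y : Matrix (Fin n) (Fin n) ℝ)).smul_left s).smul_right t)

theorem expG_neg (Y : lieAlgebra G) : expG (-Y) = (expG Y)⁻¹ := by
  have := expG_add_smul (-1) 1 Y
  rw [neg_add_cancel, zero_smul, expG_zero, one_smul, neg_one_smul] at this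
  exact eq_inv_of_mul_eq_one_left this.symm

theorem continuous_expG : Continuous (expG : lieAlgebra G → G) := by
  refine isEmbedding_toMatrix.continuous_iff.2 ?_
  have : Continuous (NormedSpace.exp : Matrix (Fin n) (Fin n) ℝ → Matrix (Fin n) (Fin n) ℝ) := by
    let _ : NormedRing (Matrix (Fin n) (Fin n) ℝ) := Matrix.linftyOpNormedRing
    let _ : NormedAlgebra ℝ (Matrix (Fin n) (Fin n) ℝ) := Matrix.linftyOpNormedAlgebra
    exact continuous_normedSpace_exp
  exact this.comp continuous_subtype_val

/-- The matrices of the elements of `G`. -/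
def matrixSubmonoid (G : ClosedSubgroup (GL (Fin n) ℝ)) :
    Submonoid (Matrix (Fin n) (Fin n) ℝ) :=
  G.toSubgroup.toSubmonoid.map (Units.coeHom _)

theorem mem_matrixSubmonoid {a : Matrix (Fin n) (Fin n) ℝ} :
    a ∈ matrixSubmonoid G ↔ ∃ g : G, ClosedSubgroup.toMatrix g = a := by
  constructor
  · rintro ⟨g, hg, rfl⟩; exact ⟨⟨g, hg⟩, rfl⟩
  · rintro ⟨g, rfl⟩; exact ⟨g.1, g.2, rfl⟩

theorem exp_mem_matrixSubmonoid_iff {Z : Matrix (Fin n) (Fin n) ℝ} :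
    NormedSpace.exp Z ∈ matrixSubmonoid G ↔ expGL Z ∈ G := by
  constructor
  · rintro ⟨g, hg, h⟩
    have : g = expGL Z := Units.ext h
    exact this ▸ hg
  · intro h; exact ⟨_, h, rfl⟩

/-- `G` is closed in `GL_n(ℝ)` only, but exponentials are invertible, so a limit of elements of `G`
that is an exponential stays in `G`. -/
theorem exp_mem_of_mem_closure (Z : Matrix (Fin n) (Fin n) ℝ)
    (hZ : NormedSpace.exp Z ∈ closure (matrixSubmonoid G : Set (Matrix (Fin n) (Fin n) ℝ))) :
    NormedSpace.exp Z ∈ matrixSubmonoid G := by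
  rw [exp_mem_matrixSubmonoid_iff]
  have hcl : IsClosed (G : Set (GL (Fin n) ℝ)) := G.isClosed'
  have := (Matrix.isOpenEmbedding_units_val n).isInducing.closure_eq_preimage_closure_image
    (G : Set (GL (Fin n) ℝ))
  rw [hcl.closure_eq] at this
  change expGL Z ∈ (G : Set (GL (Fin n) ℝ))
  rw [this]
  exact hZ

theorem exp_neg_mem_matrixSubmonoid (Z : Matrix (Fin n) (Fin n) ℝ)
    (hZ : NormedSpace.exp Z ∈ matrixSubmonoid G) : NormedSpace.exp (-Z) ∈ matrixSubmonoid G := by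
  rw [exp_mem_matrixSubmonoid_iff] at hZ ⊢
  have : expGL (-Z) = (expGL Z)⁻¹ := by
    ext1
    rw [Matrix.coe_units_inv, coe_expGL, coe_expGL, Matrix.exp_neg]
  rw [this]
  exact inv_mem hZ

theorem mem_lieAlgebra_iff (Y : Matrix (Fin n) (Fin n) ℝ) :
    Y ∈ (lieAlgebra G).toSubmodule ↔ ∀ t : ℝ, NormedSpace.exp (t • Y) ∈ matrixSubmonoid G := by
  simp only [exp_mem_matrixSubmonoid_iff]
  exact Iff.rfl

/-- The exponential map is open at `0`. -/
theorem image_expG_mem_nhds {O : Set (lieAlgebra G)} (hO : O ∈ 𝓝 0) : expG '' O ∈ 𝓝 (1 : G) := by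
  obtain ⟨O', hO', hOO'⟩ := mem_nhds_subtype _ _ _ |>.1 hO
  have key : ∀ᶠ s in 𝓝 (1 : Matrix (Fin n) (Fin n) ℝ), s ∈ matrixSubmonoid G →
      ∃ X ∈ (lieAlgebra G).toSubmodule, X ∈ O' ∧ NormedSpace.exp X = s := by
    let _ : NormedRing (Matrix (Fin n) (Fin n) ℝ) := Matrix.linftyOpNormedRing
    let _ : NormedAlgebra ℝ (Matrix (Fin n) (Fin n) ℝ) := Matrix.linftyOpNormedAlgebra
    exact eventually_exists_exp_eq exp_mem_of_mem_closure exp_neg_mem_matrixSubmonoid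
      mem_lieAlgebra_iff hO'
  have h1 : Tendsto (ClosedSubgroup.toMatrix : G → _) (𝓝 1) (𝓝 1) :=
    isEmbedding_toMatrix.continuous.tendsto' _ _ rfl
  filter_upwards [h1.eventually key] with g hg
  obtain ⟨X, hX, hXO, hXe⟩ := hg (mem_matrixSubmonoid.2 ⟨g, rfl⟩)
  exact ⟨⟨X, hX⟩, hOO' hXO, toMatrix_injective hXe⟩

theorem map_expG_nhds_zero : map (expG : lieAlgebra G → G) (𝓝 0) = 𝓝 1 := by
  refine le_antisymm (continuous_expG.tendsto' _ _ expG_zero) ?_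
  intro s hs
  exact mem_of_superset (image_expG_mem_nhds hs) (Set.image_preimage_subset _ _)

theorem exists_contDiffAt_mul_expG {m : ℕ} (b : Module.Basis (Fin m) ℝ (lieAlgebra G))
    (Y : lieAlgebra G) :
    ∃ Θ : (Fin m → ℝ) × ℝ → (Fin m → ℝ), ContDiffAt ℝ ∞ Θ 0 ∧ ∀ᶠ p in 𝓝 (0 : (Fin m → ℝ) × ℝ),
      expG (∑ i, p.1 i • b i) * expG (p.2 • Y) = expG (∑ i, Θ p i • b i) := by
  have key : ∃ Θ : (Fin m → ℝ) × ℝ → (Fin m → ℝ), ContDiffAt ℝ ∞ Θ 0 ∧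
      ∀ᶠ p in 𝓝 (0 : (Fin m → ℝ) × ℝ),
      NormedSpace.exp (∑ i, p.1 i • (b i : Matrix (Fin n) (Fin n) ℝ)) *
        NormedSpace.exp (p.2 • (Y : Matrix (Fin n) (Fin n) ℝ)) =
        NormedSpace.exp (∑ i, Θ p i • (b i : Matrix (Fin n) (Fin n) ℝ)) := by
    let _ : NormedRing (Matrix (Fin n) (Fin n) ℝ) := Matrix.linftyOpNormedRing
    let _ : NormedAlgebra ℝ (Matrix (Fin n) (Fin n) ℝ) := Matrix.linftyOpNormedAlgebra
    exact exists_contDiffAt_mul_exp (L := (lieAlgebra G).toSubmodule) exp_mem_of_mem_closure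
      exp_neg_mem_matrixSubmonoid mem_lieAlgebra_iff b Y.2
  obtain ⟨Θ, hΘ, h⟩ := key
  have coe_sum : ∀ c : Fin m → ℝ, ((∑ i, c i • b i : lieAlgebra G) : Matrix (Fin n) (Fin n) ℝ) =
      ∑ i, c i • (b i : Matrix (Fin n) (Fin n) ℝ) := fun c => by
    have := map_sum (lieAlgebra G).toSubmodule.subtype (fun i => c i • b i) Finset.univ
    exact this
  refine ⟨Θ, hΘ, h.mono fun p hp => toMatrix_injective ?_⟩
  rw [toMatrix_mul, toMatrix_expG, toMatrix_expG, toMatrix_expG, coe_sum, coe_sum]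
  exact hp

theorem hasDerivAt_toMatrix_expG (Y : lieAlgebra G) (t : ℝ) (i j : Fin n) :
    HasDerivAt (fun s : ℝ => ClosedSubgroup.toMatrix (expG (s • Y)) i j)
      ((ClosedSubgroup.toMatrix (expG (t • Y)) * (Y : Matrix (Fin n) (Fin n) ℝ)) i j) t := by
  have key : ∀ T : Matrix (Fin n) (Fin n) ℝ →ₗ[ℝ] ℝ,
      HasDerivAt (fun s : ℝ => T (NormedSpace.exp (s • (Y : Matrix (Fin n) (Fin n) ℝ))))
        (T (NormedSpace.exp (t • (Y : Matrix (Fin n) (Fin n) ℝ)) * Y)) t := by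
    intro T
    let _ : NormedRing (Matrix (Fin n) (Fin n) ℝ) := Matrix.linftyOpNormedRing
    let _ : NormedAlgebra ℝ (Matrix (Fin n) (Fin n) ℝ) := Matrix.linftyOpNormedAlgebra
    exact (LinearMap.toContinuousLinearMap T).hasFDerivAt.comp_hasDerivAt t
      (hasDerivAt_exp_smul_const (𝕂 := ℝ) (Y : Matrix (Fin n) (Fin n) ℝ) t)
  exact key (Matrix.entryLinearMap ℝ ℝ i j)

/-- Matrix entries are smooth along exponential charts. -/
theorem contDiff_toMatrix_mul_expG {m : ℕ} (Y : Fin m → lieAlgebra G) (g : G) (i j : Fin n) :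
    ContDiff ℝ ∞ fun t : Fin m → ℝ =>
      ClosedSubgroup.toMatrix (g * expG (∑ l, t l • Y l)) i j := by
  have coe_sum : ∀ c : Fin m → ℝ, ((∑ i, c i • Y i : lieAlgebra G) : Matrix (Fin n) (Fin n) ℝ) =
      ∑ i, c i • (Y i : Matrix (Fin n) (Fin n) ℝ) := fun c => by
    have := map_sum (lieAlgebra G).toSubmodule.subtype (fun i => c i • Y i) Finset.univ
    exact this
  have key : ∀ T : Matrix (Fin n) (Fin n) ℝ →ₗ[ℝ] ℝ, ContDiff ℝ ∞ fun t : Fin m → ℝ =>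
      T (NormedSpace.exp (∑ l, t l • (Y l : Matrix (Fin n) (Fin n) ℝ))) := by
    intro T
    let _ : NormedRing (Matrix (Fin n) (Fin n) ℝ) := Matrix.linftyOpNormedRing
    let _ : NormedAlgebra ℝ (Matrix (Fin n) (Fin n) ℝ) := Matrix.linftyOpNormedAlgebra
    refine (LinearMap.toContinuousLinearMap T).contDiff.comp (contDiff_normedSpace_exp.comp ?_)
    fun_prop
  simp only [toMatrix_mul, toMatrix_expG, coe_sum]
  exact key ((Matrix.entryLinearMap ℝ ℝ i j) ∘ₗ (LinearMap.mulLeft ℝ (ClosedSubgroup.toMatrix g)))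

end ClosedLinearGroup

/-! ### Bounded sets for the Riemannian distance -/

section Distance

variable {n : ℕ} {G : ClosedSubgroup (GL (Fin n) ℝ)}

theorem toMatrix_mul_toMatrix_inv (g : G) :
    ClosedSubgroup.toMatrix g * ClosedSubgroup.toMatrix g⁻¹ = 1 := by
  rw [← toMatrix_mul, mul_inv_cancel, toMatrix_one]

theorem isClosedEmbedding_lieAlgebra_val (G : ClosedSubgroup (GL (Fin n) ℝ)) :
    IsClosedEmbedding (Subtype.val : lieAlgebra G → Matrix (Fin n) (Fin n) ℝ) :=
  IsClosed.isClosedEmbedding_subtypeVal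
    (Submodule.closed_of_finiteDimensional (lieAlgebra G).toSubmodule)

instance : LocallyCompactSpace (lieAlgebra G) :=
  have : LocallyCompactSpace (Matrix (Fin n) (Fin n) ℝ) :=
    inferInstanceAs (LocallyCompactSpace (Fin n → Fin n → ℝ))
  (isClosedEmbedding_lieAlgebra_val G).locallyCompactSpace

instance : IsTopologicalAddGroup (lieAlgebra G) :=
  inferInstanceAs (IsTopologicalAddGroup (lieAlgebra G).toSubmodule)

/-- `g⁻¹ Y g` for `g ∈ G` and `Y ∈ 𝔤`. -/
def conjLie (g : G) (Y : lieAlgebra G) : lieAlgebra G :=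
  ⟨ClosedSubgroup.toMatrix g⁻¹ * (Y : Matrix (Fin n) (Fin n) ℝ) * ClosedSubgroup.toMatrix g, by
    intro s
    have hY : expGL (s • (Y : Matrix (Fin n) (Fin n) ℝ)) ∈ G := Y.2 s
    have : expGL (s • (ClosedSubgroup.toMatrix g⁻¹ * (Y : Matrix (Fin n) (Fin n) ℝ) *
        ClosedSubgroup.toMatrix g)) =
        (g : GL (Fin n) ℝ)⁻¹ * expGL (s • (Y : Matrix (Fin n) (Fin n) ℝ)) * (g : GL (Fin n) ℝ) := by
      ext1
      rw [coe_expGL, ← smul_mul_assoc, ← mul_smul_comm]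
      have := Matrix.exp_units_conj' (g : GL (Fin n) ℝ) (s • (Y : Matrix (Fin n) (Fin n) ℝ))
      exact this
    rw [this]
    exact mul_mem (mul_mem (inv_mem g.2) hY) g.2⟩

theorem IsC1Curve.const_mul {c : ℝ → G} {Y : ℝ → lieAlgebra G} (h : IsC1Curve c Y) (g : G) :
    IsC1Curve (fun t => g * c t) Y := by
  refine ⟨h.1, fun t ht i j => ?_⟩
  have := HasDerivWithinAt.fun_sum (u := Finset.univ) fun k _ =>
    (h.2 t ht k j).const_mul (ClosedSubgroup.toMatrix g i k)
  refine this.congr_deriv ?_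
  rw [← Matrix.mul_apply, ← mul_assoc]
  rfl

/-- Product rule for left logarithmic derivatives: if `c' = c Y` and `e' = e Z`, then `(c e)' = c e
(e⁻¹ Y e + Z)`. -/
theorem IsC1Curve.mul_expG {c : ℝ → G} {Y : ℝ → lieAlgebra G} (h : IsC1Curve c Y)
    (hc : ContinuousOn Y (Set.Icc 0 1)) (Z : lieAlgebra G) :
    IsC1Curve (fun t => c t * expG (t • Z)) (fun t => conjLie (expG (t • Z)) (Y t) + Z) := by
  have hexp : Continuous fun t : ℝ => expG (t • Z) :=
    continuous_expG.comp (continuous_id.smul continuous_const)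
  have hE : Continuous fun t : ℝ => ClosedSubgroup.toMatrix (expG (t • Z)) :=
    isEmbedding_toMatrix.continuous.comp hexp
  have hE' : Continuous fun t : ℝ => ClosedSubgroup.toMatrix (expG (t • Z))⁻¹ :=
    isEmbedding_toMatrix.continuous.comp hexp.inv
  refine ⟨ContinuousOn.add ?_ continuousOn_const, fun t ht i j => ?_⟩
  · refine continuousOn_iff_continuous_domRestrict.2 (continuous_induced_rng.2 ?_)
    have hY : Continuous fun t : Set.Icc (0 : ℝ) 1 => (Y t : Matrix (Fin n) (Fin n) ℝ) :=
      continuous_subtype_val.comp (continuousOn_iff_continuous_domRestrict.1 hc)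
    exact ((hE'.comp continuous_subtype_val).mul hY).mul (hE.comp continuous_subtype_val)
  · have := HasDerivWithinAt.fun_sum (u := Finset.univ) fun k _ =>
      (h.2 t ht i k).fun_mul (hasDerivAt_toMatrix_expG Z t k j).hasDerivWithinAt
    refine this.congr_deriv (Eq.symm ?_)
    change (ClosedSubgroup.toMatrix (c t) * ClosedSubgroup.toMatrix (expG (t • Z)) *
      (ClosedSubgroup.toMatrix (expG (t • Z))⁻¹ * (Y t : Matrix (Fin n) (Fin n) ℝ) *
        ClosedSubgroup.toMatrix (expG (t • Z)) + (Z : Matrix (Fin n) (Fin n) ℝ))) i j = _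
    rw [Finset.sum_add_distrib]
    simp only [← Matrix.mul_apply]
    rw [← Matrix.add_apply]
    refine congrFun (congrFun ?_ i) j
    rw [mul_add, mul_assoc, ← mul_assoc (ClosedSubgroup.toMatrix (expG (t • Z))),
      ← mul_assoc (ClosedSubgroup.toMatrix (expG (t • Z))), toMatrix_mul_toMatrix_inv, one_mul,
      mul_assoc, mul_assoc]

/-- The endpoints of the curves in `G` that start at `1` and whose velocity has entries bounded by
`B`. -/
def reachable (G : ClosedSubgroup (GL (Fin n) ℝ)) (B : ℝ) : Set G :=
  {x | ∃ (c : ℝ → G) (Y : ℝ → lieAlgebra G), IsC1Curve c Y ∧ c 0 = 1 ∧ c 1 = x ∧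
    ∀ t ∈ Set.Icc (0 : ℝ) 1, ∀ i j, |(Y t : Matrix (Fin n) (Fin n) ℝ) i j| ≤ B}

theorem reachable_mono {B B' : ℝ} (h : B ≤ B') : reachable G B ⊆ reachable G B' := by
  rintro x ⟨c, Y, h1, h2, h3, h4⟩
  exact ⟨c, Y, h1, h2, h3, fun t ht i j => (h4 t ht i j).trans h⟩

theorem one_mem_reachable : (1 : G) ∈ reachable G 0 := by
  refine ⟨fun _ => 1, fun _ => 0, ⟨continuousOn_const, fun t _ i j => ?_⟩, rfl, rfl, ?_⟩
  · have : ((((1 : G) : GL (Fin n) ℝ) : Matrix (Fin n) (Fin n) ℝ) *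
      ((0 : lieAlgebra G) : Matrix (Fin n) (Fin n) ℝ)) i j = 0 := by simp
    rw [this]
    exact hasDerivWithinAt_const _ _ _
  · intro t _ i j; simp

theorem exists_bound_toMatrix {T : Type*} [TopologicalSpace T] {C : Set T} (hC : IsCompact C)
    {f : T → Matrix (Fin n) (Fin n) ℝ} (hf : ContinuousOn f C) :
    ∃ M : ℝ, 0 ≤ M ∧ ∀ x ∈ C, ∀ i j, |f x i j| ≤ M := by
  have h : ∀ ij : Fin n × Fin n, ∃ M : ℝ, ∀ x ∈ C, |f x ij.1 ij.2| ≤ M := fun ij => by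
    have hc : ContinuousOn (fun x => f x ij.1 ij.2) C := fun x hx =>
      ((continuous_id.matrix_elem ij.1 ij.2).tendsto _).comp (hf x hx)
    obtain ⟨M, hM⟩ := hC.exists_bound_of_continuousOn hc
    exact ⟨M, hM⟩
  choose M hM using h
  refine ⟨∑ ij, |M ij|, Finset.sum_nonneg fun _ _ => abs_nonneg _, fun x hx i j => ?_⟩
  exact ((hM (i, j) x hx).trans (le_abs_self _)).trans
    (Finset.single_le_sum (f := fun ij => |M ij|) (fun _ _ => abs_nonneg _) (Finset.mem_univ (i, j)))

theorem abs_mul_mul_le {a b c : Matrix (Fin n) (Fin n) ℝ} {α β : ℝ} (hα : 0 ≤ α)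
    (ha : ∀ i j, |a i j| ≤ α) (hb : ∀ i j, |b i j| ≤ β) (hc : ∀ i j, |c i j| ≤ α) (i j : Fin n) :
    |(a * b * c) i j| ≤ n * (n * (α * β) * α) := by
  have hab : ∀ i j, |(a * b) i j| ≤ n * (α * β) := fun i j => by
    rw [Matrix.mul_apply]
    refine (Finset.abs_sum_le_sum_abs _ _).trans ((Finset.sum_le_card_nsmul _ _ (α * β) ?_).trans ?_)
    · intro k _
      rw [abs_mul]
      exact mul_le_mul (ha i k) (hb k j) (abs_nonneg _) hα
    · simp
  rw [Matrix.mul_apply]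
  refine (Finset.abs_sum_le_sum_abs _ _).trans
    ((Finset.sum_le_card_nsmul _ _ (n * (α * β) * α) ?_).trans ?_)
  · intro k _
    rw [abs_mul]
    exact mul_le_mul (hab i k) (hc k j) (abs_nonneg _) ((abs_nonneg _).trans (hab i k))
  · simp

/-- Concatenating curves would destroy the `C¹` condition. Instead the curve to `x` is multiplied
pointwise by `t ↦ exp (t Z)`, and the new velocity is bounded because conjugation by `exp (t Z)` is
bounded on the compact set `[0,1] × O`. -/
theorem exists_reachable_mul_expG {O : Set (lieAlgebra G)} (hO : IsCompact O) (B : ℝ) :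
    ∃ B', ∀ x ∈ reachable G B, ∀ Z ∈ O, x * expG Z ∈ reachable G B' := by
  have hC : IsCompact (Set.Icc (0 : ℝ) 1 ×ˢ O) := isCompact_Icc.prod hO
  have hexp : Continuous fun p : ℝ × lieAlgebra G => expG (p.1 • p.2) :=
    continuous_expG.comp (continuous_fst.smul continuous_snd)
  obtain ⟨α, hα, h1⟩ := exists_bound_toMatrix hC
    (isEmbedding_toMatrix.continuous.comp hexp).continuousOn
  obtain ⟨α', hα', h1'⟩ := exists_bound_toMatrix hC
    (isEmbedding_toMatrix.continuous.comp hexp.inv).continuousOn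
  obtain ⟨β, hβ, h2⟩ := exists_bound_toMatrix hO
    (continuous_subtype_val (p := fun Y => Y ∈ lieAlgebra G)).continuousOn
  refine ⟨n * (n * (max α α' * B) * max α α') + β, ?_⟩
  rintro x ⟨c, Y, hcY, h0, h3, hB⟩ Z hZ
  refine ⟨_, _, hcY.mul_expG hcY.1 Z, by simp [h0, expG_zero], by simp [h3], fun t ht i j => ?_⟩
  have e : ((conjLie (expG (t • Z)) (Y t) + Z : lieAlgebra G) : Matrix (Fin n) (Fin n) ℝ) i j =
      (ClosedSubgroup.toMatrix (expG (t • Z))⁻¹ * (Y t : Matrix (Fin n) (Fin n) ℝ) *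
        ClosedSubgroup.toMatrix (expG (t • Z))) i j + (Z : Matrix (Fin n) (Fin n) ℝ) i j := rfl
  rw [e]
  refine (abs_add_le _ _).trans (add_le_add (abs_mul_mul_le (le_max_of_le_left hα) ?_ ?_ ?_ i j)
    (h2 Z hZ i j))
  · exact fun i j => (h1' (t, Z) ⟨ht, hZ⟩ i j).trans (le_max_right _ _)
  · exact hB t ht
  · exact fun i j => (h1 (t, Z) ⟨ht, hZ⟩ i j).trans (le_max_left _ _)

/-- The points that have a neighbourhood inside some `reachable G B` form an open and closed set
containing `1`, hence all of `G`. Compactness then gives one `B` for the whole of `Q`. -/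
theorem IsCompact.exists_subset_reachable [PreconnectedSpace G] {Q : Set G} (hQ : IsCompact Q) :
    ∃ B, Q ⊆ reachable G B := by
  obtain ⟨O, hO, hO0⟩ := exists_compact_mem_nhds (0 : lieAlgebra G)
  have hV : expG '' O ∈ 𝓝 (1 : G) := image_expG_mem_nhds hO0
  let D : Set G := {x | ∃ B, ∀ᶠ y in 𝓝 x, y ∈ reachable G B}
  have h1 : (1 : G) ∈ D := by
    obtain ⟨B, hB⟩ := exists_reachable_mul_expG hO 0
    refine ⟨B, mem_of_superset hV ?_⟩
    rintro _ ⟨Z, hZ, rfl⟩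
    simpa using hB 1 one_mem_reachable Z hZ
  have hopen : IsOpen D := by
    refine isOpen_iff_mem_nhds.2 fun x ⟨B, hB⟩ => ?_
    filter_upwards [eventually_eventually_nhds.2 hB] with y hy using ⟨B, hy⟩
  have hclosed : IsClosed D := by
    refine isClosed_of_closure_subset fun x hx => ?_
    -- A point `z` of `D` close to `x` satisfies `x = z exp Z` with `Z ∈ O`; right translation by
    -- `exp Z` carries a good neighbourhood of `z` to one of `x`.
    have hW : {z : G | z⁻¹ * x ∈ expG '' O} ∈ 𝓝 x := by
      have : Tendsto (fun z : G => z⁻¹ * x) (𝓝 x) (𝓝 1) :=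
        (continuous_inv.mul continuous_const).tendsto' _ _ (inv_mul_cancel x)
      exact this hV
    obtain ⟨z, hz, B, hB⟩ := mem_closure_iff_nhds.1 hx _ hW
    obtain ⟨Z, hZ, hZe⟩ := hz
    obtain ⟨B', hB'⟩ := exists_reachable_mul_expG hO B
    refine ⟨B', ?_⟩
    have : Tendsto (fun y : G => y * (expG Z)⁻¹) (𝓝 x) (𝓝 z) :=
      (continuous_mul_const _).tendsto' _ _ (by rw [hZe]; group)
    filter_upwards [this.eventually hB] with y hy
    simpa using hB' _ hy Z hZ
  have huniv : D = Set.univ := IsClopen.eq_univ ⟨hclosed, hopen⟩ ⟨1, h1⟩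
  refine hQ.induction_on (p := fun s => ∃ B, s ⊆ reachable G B) ⟨0, Set.empty_subset _⟩ ?_ ?_ ?_
  · rintro s t hst ⟨B, hB⟩; exact ⟨B, hst.trans hB⟩
  · rintro s t ⟨B, hB⟩ ⟨B', hB'⟩
    exact ⟨max B B', Set.union_subset (hB.trans (reachable_mono (le_max_left _ _)))
      (hB'.trans (reachable_mono (le_max_right _ _)))⟩
  · intro x _
    obtain ⟨B, hB⟩ : x ∈ D := huniv ▸ Set.mem_univ x
    exact ⟨_, mem_nhdsWithin_of_mem_nhds hB, B, fun y hy => hy⟩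

theorem continuous_cartanNorm (θ : lieAlgebra G ≃ₗ⁅ℝ⁆ lieAlgebra G) :
    Continuous (cartanNorm θ) := by
  refine Real.continuous_sqrt.comp (Continuous.neg ?_)
  let b := Module.finBasis ℝ (lieAlgebra G)
  have h1 : ∀ T : lieAlgebra G →ₗ[ℝ] ℝ, Continuous T := fun T => T.continuous_of_finiteDimensional
  have : (fun Y => killingForm ℝ (lieAlgebra G) Y (θ Y)) = fun Y =>
      ∑ i, b.coord i Y * killingForm ℝ (lieAlgebra G) (b i) (θ Y) := by
    funext Y
    conv_lhs => rw [← b.sum_repr Y]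
    rw [map_sum, LinearMap.sum_apply]
    refine Finset.sum_congr rfl fun i _ => ?_
    rw [map_smul, LinearMap.smul_apply, b.sum_repr, smul_eq_mul]
    rfl
  rw [this]
  refine continuous_finsetSum _ fun i _ => (h1 _).mul ?_
  exact h1 ((killingForm ℝ (lieAlgebra G) (b i)) ∘ₗ (θ.toLinearEquiv.toLinearMap))

theorem riemannianDist_mul_left_le (θ : lieAlgebra G ≃ₗ⁅ℝ⁆ lieAlgebra G) (g x y : G) :
    riemannianDist θ (g * x) (g * y) ≤ riemannianDist θ x y := by
  refine le_iInf fun c => le_iInf fun Y => le_iInf fun h => ?_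
  exact iInf_le_of_le (fun t => g * c t) (iInf_le_of_le Y (iInf_le_of_le
    ⟨h.1.const_mul g, congrArg (g * ·) h.2.1, congrArg (g * ·) h.2.2⟩ le_rfl))

theorem IsCompact.exists_riemannianDist_le [PreconnectedSpace G]
    (θ : lieAlgebra G ≃ₗ⁅ℝ⁆ lieAlgebra G) {Q : Set G} (hQ : IsCompact Q) :
    ∃ r : ℝ≥0, ∀ x ∈ Q, riemannianDist θ x 1 ≤ r := by
  -- A curve from `1` to `x⁻¹`, translated on the left by `x`, runs from `x` to `1`.
  obtain ⟨B, hB⟩ := hQ.inv.exists_subset_reachable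
  have hc : IsCompact {Y : lieAlgebra G | ∀ i j, |(Y : Matrix (Fin n) (Fin n) ℝ) i j| ≤ B} := by
    have : IsCompact {Y : Matrix (Fin n) (Fin n) ℝ | ∀ i j, |Y i j| ≤ B} := by
      have : {Y : Matrix (Fin n) (Fin n) ℝ | ∀ i j, |Y i j| ≤ B} =
          Set.pi Set.univ fun _ : Fin n => Set.pi Set.univ fun _ : Fin n => Set.Icc (-B) B := by
        ext Y
        exact ⟨fun h i _ j _ => abs_le.1 (h i j),
          fun h i j => abs_le.2 (h i (Set.mem_univ i) j (Set.mem_univ j))⟩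
      rw [this]
      exact isCompact_univ_pi fun _ => isCompact_univ_pi fun _ => isCompact_Icc
    exact (isClosedEmbedding_lieAlgebra_val G).isCompact_preimage this
  obtain ⟨M, hM⟩ := hc.exists_bound_of_continuousOn (continuous_cartanNorm θ).continuousOn
  refine ⟨M.toNNReal, fun x hx => ?_⟩
  obtain ⟨c, Y, hcY, h0, h1, hY⟩ := hB (Set.inv_mem_inv.2 hx)
  refine iInf_le_of_le (fun t => x * c t) (iInf_le_of_le Y (iInf_le_of_le
    ⟨hcY.const_mul x, by simp [h0], by simp [h1]⟩ ?_))
  refine ENNReal.ofReal_le_ofReal ?_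
  have := intervalIntegral.norm_integral_le_of_norm_le_const (a := (0 : ℝ)) (b := 1) (C := M)
    (f := fun t => cartanNorm θ (Y t)) fun t ht => ?_
  · simpa using (le_abs_self _).trans this
  · rw [Set.uIoc_of_le zero_le_one] at ht
    exact hM _ (hY t ⟨ht.1.le, ht.2⟩)

/-- If `Γ\G` has infinite injectivity radius, then every compact subset of `G` has a translate that
injects into `Γ\G`. -/
theorem exists_injOn_of_injRadius_eq_top [PreconnectedSpace G]
    {θ : lieAlgebra G ≃ₗ⁅ℝ⁆ lieAlgebra G} {Γ : Subgroup G} (hinj : injRadius θ Γ = ⊤)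
    {Q : Set G} (hQ : IsCompact Q) : ∃ g : G, Set.InjOn (fun h => RightCosets.mk Γ (g * h)) Q := by
  obtain ⟨r, hr⟩ := hQ.exists_riemannianDist_le θ
  have hlt : (r : ℝ≥0∞) < injRadius θ Γ := hinj ▸ ENNReal.coe_lt_top
  obtain ⟨g, hg⟩ := lt_iSup_iff.1 hlt
  obtain ⟨r', hr'⟩ := lt_iSup_iff.1 hg
  obtain ⟨hI, hrr⟩ := lt_iSup_iff.1 hr'
  have hmem : ∀ x ∈ Q, g * x ∈ {h : G | riemannianDist θ h g < r'} := fun x hx => by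
    have := riemannianDist_mul_left_le θ g x 1
    rw [mul_one] at this
    exact (this.trans (hr x hx)).trans_lt hrr
  exact ⟨g, fun x hx y hy hxy => mul_left_cancel (hI (hmem x hx) (hmem y hy) hxy)⟩

theorem IsConnectedSemisimpleRealAlgebraic.preconnectedSpace
    (hG : IsConnectedSemisimpleRealAlgebraic G) : PreconnectedSpace G := by
  obtain ⟨H, -, hH⟩ := hG.algebraic
  have : IsPreconnected (G : Set (GL (Fin n) ℝ)) := by
    rw [hH]; exact isPreconnected_connectedComponentIn
  exact isPreconnected_iff_preconnectedSpace.1 this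

end Distance

/-! ### Topology and measure of `Γ\G` -/

namespace RightCosets

variable {G : Type*} [Group G] {Γ : Subgroup G}

theorem mk_surjective (Γ : Subgroup G) : Function.Surjective (mk Γ) := Quotient.mk_surjective

theorem mk_mul_of_mem {γ : G} (hγ : γ ∈ Γ) (x : G) : mk Γ (γ * x) = mk Γ x := by
  rw [mk_eq_mk]
  have : x * (γ * x)⁻¹ = γ⁻¹ := by group
  rw [this]
  exact inv_mem hγ

theorem exists_mul_eq_of_mk_eq {x y : G} (h : mk Γ x = mk Γ y) : ∃ γ ∈ Γ, γ * x = y :=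
  ⟨y * x⁻¹, (mk_eq_mk Γ).1 h, by group⟩

/-- The map `h ↦ Γ g h`. -/
def cosetMap (Γ : Subgroup G) (g h : G) : RightCosets Γ := mk Γ (g * h)

theorem op_smul_cosetMap (g h k : G) :
    MulOpposite.op k • cosetMap Γ g h = cosetMap Γ g (h * k) := by
  rw [cosetMap, op_smul_mk, mul_assoc]; rfl

theorem cosetMap_surjective (Γ : Subgroup G) (g : G) : Function.Surjective (cosetMap Γ g) := by
  intro x
  obtain ⟨a, rfl⟩ := mk_surjective Γ x
  exact ⟨g⁻¹ * a, by simp [cosetMap]⟩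

theorem cosetMap_bot_injective (g : G) : Function.Injective (cosetMap (⊥ : Subgroup G) g) := by
  intro x y h
  have := (mk_eq_mk _).1 h
  rw [Subgroup.mem_bot] at this
  have h2 : g * y = g * x := mul_inv_eq_one.1 this
  exact (mul_left_cancel h2).symm

/-- The function on `Γ\G` which is `f h` at `Γ g h` for `h ∈ U`, and vanishes off `Γ g U`. -/
def pushFun (Γ : Subgroup G) (g : G) (U : Set G) (f : G → ℂ) : RightCosets Γ → ℂ :=
  Function.extend (fun h : U => cosetMap Γ g h) (fun h => f h) 0

section PushFun

variable {g : G} {U : Set G} {f : G → ℂ}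

theorem pushFun_cosetMap (hU : Set.InjOn (cosetMap Γ g) U) {h : G} (hh : h ∈ U) :
    pushFun Γ g U f (cosetMap Γ g h) = f h :=
  Function.Injective.extend_apply (g := fun h : U => f h) (Set.injOn_iff_injective.1 hU) 0 ⟨h, hh⟩

theorem pushFun_eq_zero {x : RightCosets Γ} (hx : x ∉ cosetMap Γ g '' U) :
    pushFun Γ g U f x = 0 :=
  Function.extend_apply' _ _ _ (by rintro ⟨h, rfl⟩; exact hx ⟨h, h.2, rfl⟩)

theorem support_pushFun_subset (hU : Set.InjOn (cosetMap Γ g) U) :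
    Function.support (pushFun Γ g U f) ⊆ cosetMap Γ g '' (U ∩ Function.support f) := by
  intro x hx
  by_cases h : x ∈ cosetMap Γ g '' U
  · obtain ⟨h, hh, rfl⟩ := h
    refine ⟨h, ⟨hh, ?_⟩, rfl⟩
    rwa [Function.mem_support, pushFun_cosetMap hU hh] at hx
  · exact absurd (pushFun_eq_zero h) hx

end PushFun

section Topology

variable [TopologicalSpace G] [IsTopologicalGroup G]

theorem isOpenMap_mk (Γ : Subgroup G) : IsOpenMap (mk Γ) := by
  intro U hU
  change IsOpen (mk Γ ⁻¹' (mk Γ '' U))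
  have : mk Γ ⁻¹' (mk Γ '' U) = ⋃ γ : Γ, (fun x => (γ : G) * x) ⁻¹' U := by
    ext x
    simp only [Set.mem_preimage, Set.mem_image, Set.mem_iUnion]
    constructor
    · rintro ⟨y, hy, hxy⟩
      obtain ⟨γ, hγ, rfl⟩ := exists_mul_eq_of_mk_eq hxy.symm
      exact ⟨⟨γ, hγ⟩, hy⟩
    · rintro ⟨γ, hγ⟩
      exact ⟨_, hγ, mk_mul_of_mem γ.2 x⟩
  rw [this]
  exact isOpen_iUnion fun γ => hU.preimage (continuous_const_mul (γ : G))

theorem continuous_cosetMap (Γ : Subgroup G) (g : G) : Continuous (cosetMap Γ g) :=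
  (continuous_mk Γ).comp (continuous_const_mul g)

theorem isOpenMap_cosetMap (Γ : Subgroup G) (g : G) : IsOpenMap (cosetMap Γ g) :=
  (isOpenMap_mk Γ).comp (isOpenMap_mul_left g)

theorem map_nhds_cosetMap (Γ : Subgroup G) (g h : G) :
    map (cosetMap Γ g) (𝓝 h) = 𝓝 (cosetMap Γ g h) :=
  le_antisymm (continuous_cosetMap Γ g).continuousAt ((isOpenMap_cosetMap Γ g).nhds_le h)

/-- A discrete subgroup is closed, so `b a⁻¹ ∉ Γ` is an open condition on `(a, b)`, and the open map
`mk Γ` carries a product neighbourhood to separating neighbourhoods. -/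
instance [T2Space G] [DiscreteTopology Γ] : T2Space (RightCosets Γ) := by
  have hcl : IsClosed (Γ : Set G) := Subgroup.isClosed_of_discrete
  refine ⟨fun x y hxy => ?_⟩
  obtain ⟨a, rfl⟩ := mk_surjective Γ x
  obtain ⟨b, rfl⟩ := mk_surjective Γ y
  have hab : b * a⁻¹ ∉ (Γ : Set G) := fun h => hxy ((mk_eq_mk Γ).2 h)
  have hc : Continuous fun p : G × G => p.2 * p.1⁻¹ := continuous_snd.mul continuous_fst.inv
  have hev : ∀ᶠ p in 𝓝 (a, b), p.2 * p.1⁻¹ ∉ (Γ : Set G) :=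
    (hc.tendsto (a, b)).eventually (hcl.isOpen_compl.mem_nhds hab)
  rw [nhds_prod_eq] at hev
  obtain ⟨s, hs, t, ht, hst⟩ := mem_prod_iff.1 hev
  obtain ⟨s', hs's, hs'o, has⟩ := mem_nhds_iff.1 hs
  obtain ⟨t', ht't, ht'o, hbt⟩ := mem_nhds_iff.1 ht
  refine ⟨mk Γ '' s', mk Γ '' t', isOpenMap_mk Γ _ hs'o, isOpenMap_mk Γ _ ht'o,
    ⟨a, has, rfl⟩, ⟨b, hbt, rfl⟩, ?_⟩
  rw [Set.disjoint_left]
  rintro _ ⟨u, hu, rfl⟩ ⟨v, hv, huv⟩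
  exact hst (Set.mk_mem_prod (hs's hu) (ht't hv)) ((mk_eq_mk Γ).1 huv.symm)

/-- Take `U` so small that `U U⁻¹` meets `Γ` only in `1`. -/
theorem exists_isOpen_injOn_mk (Γ : Subgroup G) [DiscreteTopology Γ] (g : G) :
    ∃ U : Set G, IsOpen U ∧ g ∈ U ∧ Set.InjOn (mk Γ) U := by
  obtain ⟨W, hW, hW1⟩ : ∃ W ∈ 𝓝 (1 : G), ∀ γ ∈ W, γ ∈ Γ → γ = 1 := by
    have : ({1} : Set Γ) ∈ 𝓝 (1 : Γ) := (isOpen_discrete _).mem_nhds rfl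
    obtain ⟨W, hW, hW'⟩ := (mem_nhds_subtype _ _ _).1 this
    refine ⟨W, hW, fun γ hγ hγΓ => ?_⟩
    have h1 : (⟨γ, hγΓ⟩ : Γ) = 1 := hW' hγ
    exact congrArg Subtype.val h1
  have hc : Continuous fun p : G × G => p.2 * p.1⁻¹ := continuous_snd.mul continuous_fst.inv
  have hev : ∀ᶠ p in 𝓝 (g, g), p.2 * p.1⁻¹ ∈ W :=
    (hc.tendsto' (g, g) 1 (mul_inv_cancel g)).eventually hW
  rw [nhds_prod_eq] at hev
  obtain ⟨s, hs, hss⟩ := mem_prod_same_iff.1 hev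
  obtain ⟨U, hUs, hUo, hgU⟩ := mem_nhds_iff.1 hs
  refine ⟨U, hUo, hgU, fun a ha b hb hab => ?_⟩
  have h1 := hW1 _ (hss (Set.mk_mem_prod (hUs ha) (hUs hb))) ((mk_eq_mk Γ).1 hab)
  exact (mul_inv_eq_one.1 h1).symm

section PushFun

variable [T2Space G] [DiscreteTopology Γ] {g : G} {U : Set G} {f : G → ℂ}

theorem tsupport_pushFun_subset (hU : Set.InjOn (cosetMap Γ g) U) (hf : HasCompactSupport f) :
    tsupport (pushFun Γ g U f) ⊆ cosetMap Γ g '' tsupport f := by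
  have hc : IsCompact (cosetMap Γ g '' tsupport f) := hf.isCompact.image (continuous_cosetMap Γ g)
  refine closure_minimal ((support_pushFun_subset hU).trans (Set.image_mono ?_)) hc.isClosed
  exact Set.inter_subset_right.trans (subset_tsupport f)

theorem hasCompactSupport_pushFun (hU : Set.InjOn (cosetMap Γ g) U) (hf : HasCompactSupport f) :
    HasCompactSupport (pushFun Γ g U f) :=
  (hf.isCompact.image (continuous_cosetMap Γ g)).of_isClosed_subset (isClosed_tsupport _)
    (tsupport_pushFun_subset hU hf)

theorem continuous_pushFun (hUo : IsOpen U) (hU : Set.InjOn (cosetMap Γ g) U)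
    (hf : HasCompactSupport f) (hfU : tsupport f ⊆ U) (hfc : Continuous f) :
    Continuous (pushFun Γ g U f) := by
  refine continuous_iff_continuousAt.2 fun x => ?_
  by_cases hx : x ∈ cosetMap Γ g '' tsupport f
  · obtain ⟨h, hh, rfl⟩ := hx
    rw [ContinuousAt, ← map_nhds_cosetMap, tendsto_map'_iff, pushFun_cosetMap hU (hfU hh)]
    refine (hfc.tendsto h).congr' ?_
    filter_upwards [hUo.mem_nhds (hfU hh)] with y hy
    exact (pushFun_cosetMap hU hy).symm
  · have hc : IsClosed (cosetMap Γ g '' tsupport f) :=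
      (hf.isCompact.image (continuous_cosetMap Γ g)).isClosed
    refine (continuousAt_const (y := (0 : ℂ))).congr ?_
    filter_upwards [hc.isOpen_compl.mem_nhds hx] with y hy
    by_contra h0
    exact hy (tsupport_pushFun_subset hU hf (subset_tsupport _ (Ne.symm h0)))

end PushFun

variable [SecondCountableTopology G] [MeasurableSpace G] [BorelSpace G]

/-- Over the image of `U` the supremum defining `quotientMeasure` is attained by `U` itself. Any
other injecting `V` is cut into countably many pieces that elements of `Γ` move into `U`. The moved
pieces are disjoint because `V` injects, so by left invariance `V` contributes no more than `U`. -/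
theorem restrict_image_mk_quotientMeasure (μ : Measure G) [μ.IsMulLeftInvariant]
    [DiscreteTopology Γ] {U : Set G} (hUo : IsOpen U) (hU : Set.InjOn (mk Γ) U) :
    (quotientMeasure Γ μ).restrict (mk Γ '' U) = (μ.restrict U).map (mk Γ) := by
  have hmk : Measurable (mk Γ) := (continuous_mk Γ).measurable
  have hW : MeasurableSet (mk Γ '' U) := (isOpenMap_mk Γ U hUo).measurableSet
  have : Countable Γ := countable_of_Lindelof_of_discrete
  have key : ∀ V : Set G, IsOpen V → Set.InjOn (mk Γ) V → ∀ E : Set (RightCosets Γ),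
      MeasurableSet E → E ⊆ mk Γ '' U → μ (mk Γ ⁻¹' E ∩ V) ≤ μ (mk Γ ⁻¹' E ∩ U) := by
    intro V hVo hV E hE hEU
    -- `A γ` is the part of `V` over `E` that lies in `γ U`, and `A' γ = γ⁻¹ A γ` is its translate
    -- inside `U`.
    let A : Γ → Set G := fun γ => mk Γ ⁻¹' E ∩ V ∩ (fun x => (γ : G)⁻¹ * x) ⁻¹' U
    have hA : ∀ γ, MeasurableSet (A γ) := fun γ => ((hmk hE).inter hVo.measurableSet).inter
      (hUo.preimage (continuous_const_mul _)).measurableSet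
    let A' : Γ → Set G := fun γ => (fun x => (γ : G) * x) ⁻¹' A γ
    have hA' : ∀ γ, MeasurableSet (A' γ) := fun γ => (continuous_const_mul (γ : G)).measurable (hA γ)
    have hcov : mk Γ ⁻¹' E ∩ V ⊆ ⋃ γ, A γ := by
      rintro x ⟨hxE, hxV⟩
      obtain ⟨u, hu, hux⟩ := hEU hxE
      obtain ⟨γ, hγ, rfl⟩ := exists_mul_eq_of_mk_eq hux
      exact Set.mem_iUnion.2 ⟨⟨γ, hγ⟩, ⟨hxE, hxV⟩, by simpa using hu⟩
    have hdisj : Pairwise (Function.onFun Disjoint A') := by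
      intro γ γ' hne
      rw [Function.onFun, Set.disjoint_left]
      rintro x ⟨⟨-, hx⟩, -⟩ ⟨⟨-, hx'⟩, -⟩
      have := hV hx hx' (by rw [mk_mul_of_mem γ.2, mk_mul_of_mem γ'.2])
      exact hne (Subtype.ext (mul_right_cancel this))
    have hsub : ⋃ γ, A' γ ⊆ mk Γ ⁻¹' E ∩ U := by
      refine Set.iUnion_subset fun γ => ?_
      rintro x ⟨⟨hxE, -⟩, hxU⟩
      refine ⟨?_, by simpa using hxU⟩
      have : mk Γ ((γ : G) * x) ∈ E := hxE
      rwa [mk_mul_of_mem γ.2] at this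
    calc μ (mk Γ ⁻¹' E ∩ V) ≤ ∑' γ, μ (A γ) := (measure_mono hcov).trans (measure_iUnion_le _)
      _ = ∑' γ, μ (A' γ) := by
          congr 1; funext γ
          exact (measure_preimage_mul μ (γ : G) (A γ)).symm
      _ = μ (⋃ γ, A' γ) := (measure_iUnion hdisj hA').symm
      _ ≤ _ := measure_mono hsub
  -- Off the image of `U` only the trivial bound by the measure itself is used; that term disappears
  -- on restriction to the image.
  have hle : quotientMeasure Γ μ ≤
      (μ.restrict U).map (mk Γ) + (quotientMeasure Γ μ).restrict (mk Γ '' U)ᶜ := by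
    refine iSup₂_le fun V hV => Measure.le_iff.2 fun E hE => ?_
    have hVle : (μ.restrict V).map (mk Γ) ≤ quotientMeasure Γ μ :=
      le_iSup₂_of_le (f := fun (V : Set G) (_ : IsOpen V ∧ Set.InjOn (mk Γ) V) =>
        (μ.restrict V).map (mk Γ)) V hV le_rfl
    rw [← measure_inter_add_sdiff E hW, Measure.add_apply]
    refine add_le_add ?_ ?_
    · rw [Measure.map_apply hmk (hE.inter hW), Measure.restrict_apply (hmk (hE.inter hW))]
      refine (key V hV.1 hV.2 _ (hE.inter hW) Set.inter_subset_right).trans ?_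
      rw [Measure.map_apply hmk hE, Measure.restrict_apply (hmk hE)]
      exact measure_mono (Set.inter_subset_inter_left _ (Set.preimage_mono Set.inter_subset_left))
    · rw [Measure.restrict_apply hE]
      exact hVle _
  have hsupp : ((μ.restrict U).map (mk Γ)).restrict (mk Γ '' U) = (μ.restrict U).map (mk Γ) := by
    rw [Measure.restrict_map hmk hW, Measure.restrict_restrict (hmk hW),
      Set.inter_eq_self_of_subset_right (Set.subset_preimage_image _ _)]
  refine le_antisymm ?_ ?_
  · refine (Measure.restrict_mono le_rfl hle).trans ?_
    rw [Measure.restrict_add, hsupp, Measure.restrict_restrict hW, Set.inter_compl_self,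
      Measure.restrict_empty, add_zero]
  · rw [← hsupp]
    refine Measure.restrict_mono le_rfl ?_
    exact le_iSup₂_of_le (f := fun (V : Set G) (_ : IsOpen V ∧ Set.InjOn (mk Γ) V) =>
        (μ.restrict V).map (mk Γ)) U ⟨hUo, hU⟩ le_rfl

/-- Open sets that inject into `Γ\G` do so in a measure preserving way. -/
theorem restrict_image_cosetMap_quotientMeasure (μ : Measure G) [μ.IsMulLeftInvariant]
    [DiscreteTopology Γ] {g : G} {U : Set G} (hUo : IsOpen U) (hU : Set.InjOn (cosetMap Γ g) U) :
    (quotientMeasure Γ μ).restrict (cosetMap Γ g '' U) = (μ.restrict U).map (cosetMap Γ g) := by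
  have hmk : Measurable (mk Γ) := (continuous_mk Γ).measurable
  have hVo : IsOpen ((g * ·) '' U) := isOpenMap_mul_left g U hUo
  have hV : Set.InjOn (mk Γ) ((g * ·) '' U) := by
    rintro _ ⟨a, ha, rfl⟩ _ ⟨b, hb, rfl⟩ hab
    exact congrArg (g * ·) (hU ha hb hab)
  have h1 := restrict_image_mk_quotientMeasure μ hVo hV
  rw [Set.image_image] at h1
  refine h1.trans ?_
  have hpre : (g * ·) ⁻¹' ((g * ·) '' U) = U := Set.preimage_image_eq _ (mul_right_injective g)
  have h2 : μ.restrict ((g * ·) '' U) = (μ.restrict U).map (g * ·) := by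
    have := Measure.restrict_map (μ := μ) (continuous_const_mul g).measurable hVo.measurableSet
    rwa [map_mul_left_eq_self, hpre] at this
  rw [h2, Measure.map_map hmk (continuous_const_mul g).measurable]
  rfl

theorem setIntegral_image_cosetMap (μ : Measure G) [μ.IsMulLeftInvariant] [DiscreteTopology Γ]
    {g : G} {U : Set G} (hUo : IsOpen U) (hU : Set.InjOn (cosetMap Γ g) U)
    {E : Type*} [NormedAddCommGroup E] [NormedSpace ℝ E] [SecondCountableTopology E]
    {Φ : RightCosets Γ → E} (hΦ : Continuous Φ) :
    ∫ x in cosetMap Γ g '' U, Φ x ∂(quotientMeasure Γ μ) = ∫ h in U, Φ (cosetMap Γ g h) ∂μ := by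
  rw [restrict_image_cosetMap_quotientMeasure μ hUo hU,
    integral_map (continuous_cosetMap Γ g).aemeasurable hΦ.aestronglyMeasurable]

theorem integral_eq_setIntegral_cosetMap (μ : Measure G) [μ.IsMulLeftInvariant]
    [DiscreteTopology Γ] {g : G} {U : Set G} (hUo : IsOpen U) (hU : Set.InjOn (cosetMap Γ g) U)
    {E : Type*} [NormedAddCommGroup E] [NormedSpace ℝ E] [SecondCountableTopology E]
    {Φ : RightCosets Γ → E} (hΦ : Continuous Φ) (hsupp : ∀ x ∉ cosetMap Γ g '' U, Φ x = 0) :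
    ∫ x, Φ x ∂(quotientMeasure Γ μ) = ∫ h in U, Φ (cosetMap Γ g h) ∂μ := by
  rw [← setIntegral_image_cosetMap μ hUo hU hΦ, setIntegral_eq_integral_of_forall_compl_eq_zero hsupp]

instance [LocallyCompactSpace G] (μ : Measure G) [μ.IsMulLeftInvariant] [IsFiniteMeasureOnCompacts μ]
    [DiscreteTopology Γ] : IsFiniteMeasureOnCompacts (quotientMeasure Γ μ) where
  lt_top_of_isCompact := by
    intro C hC
    refine hC.induction_on (p := fun s => quotientMeasure Γ μ s < ⊤) (by simp)
      (fun s t hst ht => (measure_mono hst).trans_lt ht)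
      (fun s t hs ht => (measure_union_le s t).trans_lt (ENNReal.add_lt_top.2 ⟨hs, ht⟩)) ?_
    intro x _
    obtain ⟨g, rfl⟩ := mk_surjective Γ x
    obtain ⟨U, hUo, hgU, hU⟩ := exists_isOpen_injOn_mk Γ g
    obtain ⟨Q, hQ, hgQ, hQU⟩ := exists_compact_subset hUo hgU
    refine ⟨mk Γ '' interior Q, mem_nhdsWithin_of_mem_nhds
      ((isOpenMap_mk Γ _ isOpen_interior).mem_nhds ⟨g, hgQ, rfl⟩), ?_⟩
    have h1 := restrict_image_mk_quotientMeasure μ isOpen_interior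
      (hU.mono (interior_subset.trans hQU))
    rw [← Measure.restrict_apply_self, h1]
    rw [Measure.map_apply (continuous_mk Γ).measurable
      (isOpenMap_mk Γ _ isOpen_interior).measurableSet]
    refine (measure_mono (Set.subset_univ _)).trans_lt ?_
    rw [Measure.restrict_apply_univ]
    exact (measure_mono interior_subset).trans_lt hQ.measure_lt_top

end Topology

end RightCosets

/-! ### Weak containment of the regular representation -/

theorem inner_toLp_toLp {Ω : Type*} [MeasurableSpace Ω] {ν : Measure Ω} {f g : Ω → ℂ}
    (hf : MemLp f 2 ν) (hg : MemLp g 2 ν) :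
    inner ℂ (hf.toLp f) (hg.toLp g) = ∫ x, conj (f x) * g x ∂ν := by
  rw [L2.inner_def]
  refine integral_congr_ae ?_
  filter_upwards [hf.coeFn_toLp, hg.coeFn_toLp] with x h1 h2
  rw [h1, h2, RCLike.inner_apply, mul_comm]

theorem rightRep_toLp {G : Type*} [Group G] {Ω : Type*} [MulAction Gᵐᵒᵖ Ω] [MeasurableSpace Ω]
    [MeasurableConstSMul Gᵐᵒᵖ Ω] {ν : Measure Ω} [SMulInvariantMeasure Gᵐᵒᵖ Ω ν] (g : G)
    {f : Ω → ℂ} (hf : MemLp f 2 ν) :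
    rightRep G Ω ν g (hf.toLp f) =
      (hf.comp_measurePreserving (measurePreserving_smul (MulOpposite.op g) ν)).toLp
        (fun x => f (MulOpposite.op g • x)) := rfl

theorem inner_rightRep_toLp {G : Type*} [Group G] {Ω : Type*} [MulAction Gᵐᵒᵖ Ω]
    [MeasurableSpace Ω] [MeasurableConstSMul Gᵐᵒᵖ Ω] {ν : Measure Ω}
    [SMulInvariantMeasure Gᵐᵒᵖ Ω ν] (g : G) {f : Ω → ℂ} (hf : MemLp f 2 ν) :
    inner ℂ (hf.toLp f) (rightRep G Ω ν g (hf.toLp f)) =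
      ∫ x, conj (f x) * f (MulOpposite.op g • x) ∂ν := by
  rw [rightRep_toLp, inner_toLp_toLp]

/-- The bound does not depend on the isometry `T`, so approximating the vector approximates its
coefficient uniformly on the group. -/
theorem norm_coefficient_sub_le {V : Type*} [NormedAddCommGroup V] [InnerProductSpace ℂ V]
    (T : V ≃ₗᵢ[ℂ] V) (v w : V) :
    ‖inner ℂ v (T v) - inner ℂ w (T w)‖ ≤ ‖v - w‖ * (‖v‖ + ‖w‖) := by
  have h : inner ℂ v (T v) - inner ℂ w (T w) = inner ℂ (v - w) (T v) + inner ℂ w (T (v - w)) := by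
    rw [map_sub, inner_sub_left, inner_sub_right]; ring
  rw [h]
  refine (norm_add_le _ _).trans ?_
  have h1 := norm_inner_le_norm (𝕜 := ℂ) (v - w) (T v)
  have h2 := norm_inner_le_norm (𝕜 := ℂ) w (T (v - w))
  rw [T.norm_map] at h1 h2
  linarith

open RightCosets in
/-- If every compact subset of `G` has a cosetMap that injects into `Γ\G`, then `L²(G)` is weakly
contained in `L²(Γ\G)`. -/
theorem weaklyContained_of_exists_injOn {G : Type*} [Group G] [TopologicalSpace G]
    [IsTopologicalGroup G] [T2Space G] [SecondCountableTopology G] [LocallyCompactSpace G]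
    [MeasurableSpace G] [BorelSpace G] (μ : Measure G) [μ.IsHaarMeasure] [μ.IsMulRightInvariant]
    (Γ : Subgroup G) [DiscreteTopology Γ]
    (hinj : ∀ Q : Set G, IsCompact Q → ∃ g : G, Set.InjOn (cosetMap Γ g) Q) :
    WeaklyContained (rightRep G G μ) (rightRep G (RightCosets Γ) (quotientMeasure Γ μ)) := by
  intro v Q hQ ε hε
  -- If `‖v - w‖ ≤ δ ≤ 1` then `‖v‖ + ‖w‖ ≤ 2 ‖v‖ + 1`, the factor in the coefficient estimate.
  obtain ⟨δ, hδ0, hδ1, hδ⟩ : ∃ δ : ℝ, 0 < δ ∧ δ ≤ 1 ∧ δ * (2 * ‖v‖ + 1) < ε := by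
    have hp : 0 < 2 * ‖v‖ + 1 := by positivity
    refine ⟨min 1 (ε / 2 / (2 * ‖v‖ + 1)), lt_min one_pos (by positivity), min_le_left _ _, ?_⟩
    calc _ ≤ ε / 2 / (2 * ‖v‖ + 1) * (2 * ‖v‖ + 1) :=
          mul_le_mul_of_nonneg_right (min_le_right _ _) hp.le
      _ = ε / 2 := by field_simp
      _ < ε := by linarith
  obtain ⟨f, hfs, hfv, hfc, hfm⟩ := (Lp.memLp v).exists_hasCompactSupport_eLpNorm_sub_le
    (by simp) (ε := ENNReal.ofReal δ) (by simpa using hδ0)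
  let w := hfm.toLp f
  have hvw : ‖v - w‖ ≤ δ := by
    have : v - w = ((Lp.memLp v).sub hfm).toLp _ := by
      rw [MemLp.toLp_sub (Lp.memLp v) hfm, Lp.toLp_coeFn]
    rw [this, Lp.norm_toLp]
    exact ENNReal.toReal_le_of_le_ofReal hδ0.le hfv
  have hS : IsCompact (tsupport f) := hfs
  -- The injecting set must contain `h` and `h q` for all `h ∈ supp f` and `q ∈ Q`.
  obtain ⟨C, hC, hCs⟩ := exists_compact_superset (hS.union (hS.mul hQ))
  obtain ⟨g, hg⟩ := hinj C hC
  have hUo : IsOpen (interior C) := isOpen_interior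
  have hU : Set.InjOn (cosetMap Γ g) (interior C) := hg.mono interior_subset
  have hSU : tsupport f ⊆ interior C := Set.subset_union_left.trans hCs
  have hFc : Continuous (pushFun Γ g (interior C) f) := continuous_pushFun hUo hU hfs hSU hfc
  have hFm : MemLp (pushFun Γ g (interior C) f) 2 (quotientMeasure Γ μ) :=
    hFc.memLp_of_hasCompactSupport (hasCompactSupport_pushFun hU hfs)
  refine ⟨1, fun _ => 1, fun _ => hFm.toLp _, fun _ => zero_le_one, by simp, fun q hq => ?_⟩
  -- For `q ∈ Q` the two coefficients agree exactly; the only error comes from replacing `v` by `f`.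
  have hcoef : inner ℂ (hFm.toLp _) (rightRep G (RightCosets Γ) (quotientMeasure Γ μ) q
      (hFm.toLp _)) = inner ℂ w (rightRep G G μ q w) := by
    rw [inner_rightRep_toLp, inner_rightRep_toLp, integral_eq_setIntegral_cosetMap μ hUo hU]
    · rw [← setIntegral_eq_integral_of_forall_compl_eq_zero (s := interior C)
        (f := fun x => conj (f x) * f (MulOpposite.op q • x))]
      · refine setIntegral_congr_fun hUo.measurableSet fun h hh => ?_
        change conj (pushFun Γ g (interior C) f (cosetMap Γ g h)) *
          pushFun Γ g (interior C) f (MulOpposite.op q • cosetMap Γ g h) = conj (f h) * f (h * q)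
        rw [pushFun_cosetMap hU hh, op_smul_cosetMap]
        by_cases h0 : f h = 0
        · simp [h0]
        · have : h * q ∈ interior C :=
            hCs (Set.mem_union_right _ (Set.mul_mem_mul (subset_tsupport f h0) hq))
          rw [pushFun_cosetMap hU this]
      · intro x hx
        rw [image_eq_zero_of_notMem_tsupport fun h => hx (hSU h)]
        simp
    · exact (Complex.continuous_conj.comp hFc).mul (hFc.comp (continuous_const_smul _))
    · intro x hx
      rw [pushFun_eq_zero hx]
      simp
  rw [Fin.sum_univ_one, hcoef]
  simp only [Complex.ofReal_one, one_mul]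
  refine (norm_coefficient_sub_le _ _ _).trans_lt (lt_of_le_of_lt ?_ hδ)
  have hw : ‖w‖ ≤ ‖v‖ + 1 := by
    have := norm_sub_norm_le w v
    rw [norm_sub_rev] at this
    linarith
  exact mul_le_mul hvw (by linarith) (by positivity) hδ0.le

/-! ### The spectrum of the operator defined by a quadratic form -/

section Operators

/-- The inverse is `1 + T (1 - S T)⁻¹ S`. -/
theorem isUnit_one_sub_comp_comm {X Y : Type*} [NormedAddCommGroup X] [NormedSpace ℂ X]
    [NormedAddCommGroup Y] [NormedSpace ℂ Y] {S : X →L[ℂ] Y} {T : Y →L[ℂ] X}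
    (h : IsUnit (1 - S ∘L T)) : IsUnit (1 - T ∘L S) := by
  obtain ⟨u, hu⟩ := h
  have h1 : ∀ y, (u⁻¹).1 y - S (T ((u⁻¹).1 y)) = y := fun y => by
    have := congrArg (fun F : Y →L[ℂ] Y => F y) u.mul_inv
    rw [hu] at this
    simpa using this
  have h2 : ∀ y, (u⁻¹).1 (y - S (T y)) = y := fun y => by
    have := congrArg (fun F : Y →L[ℂ] Y => F y) u.inv_mul
    rw [hu] at this
    simpa using this
  refine ⟨⟨1 - T ∘L S, 1 + T ∘L (u⁻¹).1 ∘L S, ?_, ?_⟩, rfl⟩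
  · ext x
    have := congrArg T (h1 (S x))
    rw [map_sub] at this
    change x + T ((u⁻¹).1 (S x)) - T (S (x + T ((u⁻¹).1 (S x)))) = x
    rw [map_add, map_add, ← this]; abel
  · ext x
    have := congrArg T (h2 (S x))
    rw [map_sub, map_sub] at this
    change x - T (S x) + T ((u⁻¹).1 (S (x - T (S x)))) = x
    rw [map_sub, map_sub, map_sub, this]; abel

/-- For a normal operator the orthogonal complement of the range is the kernel, so a lower bound
gives dense range as well as injectivity and closed range. -/
theorem isUnit_iff_exists_bound_of_isStarNormal {X : Type*} [NormedAddCommGroup X]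
    [InnerProductSpace ℂ X] [CompleteSpace X] {D : X →L[ℂ] X} (hD : IsStarNormal D) :
    IsUnit D ↔ ∃ c : ℝ, 0 < c ∧ ∀ x, c * ‖x‖ ≤ ‖D x‖ := by
  rw [ContinuousLinearMap.isUnit_iff_bijective,
    ContinuousLinearMap.bijective_iff_dense_range_and_antilipschitz]
  constructor
  · rintro ⟨-, K, hK⟩
    -- The constant `K` may be `0`; `K + 1` can be inverted.
    refine ⟨(K + 1 : ℝ)⁻¹, by positivity, fun x => ?_⟩
    have h1 : ‖x‖ ≤ K * ‖D x‖ := by simpa using hK.le_mul_dist x 0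
    rw [inv_mul_le_iff₀ (by positivity)]
    nlinarith [norm_nonneg (D x)]
  · rintro ⟨c, hc, h⟩
    constructor
    · rw [Submodule.topologicalClosure_eq_top_iff, ContinuousLinearMap.IsStarNormal.orthogonal_range hD]
      refine (Submodule.eq_bot_iff _).2 fun x hx => ?_
      have hx0 : D x = 0 := hx
      have := h x
      rw [hx0, norm_zero] at this
      exact norm_le_zero_iff.1 (by nlinarith [norm_nonneg x])
    · refine ⟨⟨c⁻¹, by positivity⟩, AddMonoidHomClass.antilipschitz_of_bound D fun x => ?_⟩
      have := h x
      change ‖x‖ ≤ c⁻¹ * ‖D x‖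
      rw [inv_mul_eq_div, le_div_iff₀ hc]
      linarith

end Operators

/-! ### Resolvent criterion for the operator of a nonnegative form on abstract Hilbert spaces. -/

section FormOperator

variable {H N E V : Type*} [NormedAddCommGroup H] [InnerProductSpace ℂ H] [NormedAddCommGroup N]
  [InnerProductSpace ℂ N] [AddCommGroup E] [Module ℂ E] [NormedAddCommGroup V]
  [InnerProductSpace ℂ V]

/-- `f` is in the domain of the operator of the form `φ, ψ ↦ ⟪b ψ, b φ⟫` on `E`, and is mapped to
`h`. -/
def FormOperator (a : E →ₗ[ℂ] H) (b : E →ₗ[ℂ] N) (f h : H) : Prop :=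
  ∃ φ : ℕ → E, Tendsto (fun m => a (φ m)) atTop (𝓝 f) ∧ CauchySeq (fun m => b (φ m)) ∧
    ∀ ψ, Tendsto (fun m => inner ℂ (b ψ) (b (φ m))) atTop (𝓝 (inner ℂ (a ψ) h))

/-- `z` is in the resolvent set of the operator of the form `φ, ψ ↦ ⟪b ψ, b φ⟫`. -/
def IsFormResolvent (a : E →ₗ[ℂ] H) (b : E →ₗ[ℂ] N) (z : ℂ) : Prop :=
  ∃ R : H →L[ℂ] H, (∀ h, FormOperator a b (R h) (h + z • R h)) ∧
    ∀ f h, FormOperator a b f h → R (h - z • f) = f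

/-- The Hilbert space `V`, with maps `ι : E → V` and `j : V → H`, is the completion of `E` for the
norm `‖a φ‖² + ‖b φ‖²`. -/
structure IsFormDomain (a : E →ₗ[ℂ] H) (b : E →ₗ[ℂ] N) (ι : E →ₗ[ℂ] V) (j : V →L[ℂ] H) : Prop where
  dense : DenseRange ι
  comp : ∀ φ, j (ι φ) = a φ
  inner_eq : ∀ ψ φ, inner ℂ (ι ψ) (ι φ) = inner ℂ (a ψ) (a φ) + inner ℂ (b ψ) (b φ)

namespace IsFormDomain

variable {a : E →ₗ[ℂ] H} {b : E →ₗ[ℂ] N} {ι : E →ₗ[ℂ] V} {j : V →L[ℂ] H}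

theorem norm_sq (hV : IsFormDomain a b ι j) (φ : E) : ‖ι φ‖ ^ 2 = ‖a φ‖ ^ 2 + ‖b φ‖ ^ 2 := by
  have := hV.inner_eq φ φ
  simp only [inner_self_eq_norm_sq_to_K] at this
  exact_mod_cast this

theorem norm_le_of_forall (hV : IsFormDomain a b ι j) {C : ℝ} (hC : 0 ≤ C) {x : V}
    (h : ∀ ψ, ‖inner ℂ (ι ψ) x‖ ≤ C * ‖ι ψ‖) : ‖x‖ ≤ C := by
  have key : ∀ w : V, ‖inner ℂ w x‖ ≤ C * ‖w‖ := fun w =>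
    hV.dense.induction_on (p := fun w => ‖inner ℂ w x‖ ≤ C * ‖w‖) w
      (isClosed_le (by fun_prop) (by fun_prop)) h
  have h1 := key x
  rw [inner_self_eq_norm_sq_to_K] at h1
  rcases (norm_nonneg x).eq_or_lt with h0 | h0
  · rwa [← h0]
  · have h2 : ‖x‖ * ‖x‖ ≤ C * ‖x‖ := by simpa [sq] using h1
    exact le_of_mul_le_mul_right h2 h0

theorem eq_of_forall_inner (hV : IsFormDomain a b ι j) {x y : V}
    (h : ∀ ψ, inner ℂ (ι ψ) x = inner ℂ (ι ψ) y) : x = y := by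
  have : ‖x - y‖ ≤ 0 := hV.norm_le_of_forall le_rfl fun ψ => by
    rw [inner_sub_right, h, sub_self]; simp
  exact sub_eq_zero.1 (norm_le_zero_iff.1 this)

variable [CompleteSpace V] [CompleteSpace H]

open ContinuousLinearMap (adjoint)

/-- If `v ∈ V` is the limit of `ι (φ m)`, the weak equation with `⟪a ψ, f⟫` added to both sides
reads `⟪ι ψ, v⟫ = ⟪j (ι ψ), f + h⟫`, that is, `v = j* (f + h)`. So `j j*` is the inverse of `1 +`
the operator. -/
theorem formOperator_iff (hV : IsFormDomain a b ι j) (f h : H) :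
    FormOperator a b f h ↔ f = j (adjoint j (f + h)) := by
  constructor
  · rintro ⟨φ, hf, hb, hψ⟩
    have hcau : CauchySeq fun m => ι (φ m) := by
      rw [Metric.cauchySeq_iff] at hb ⊢
      have ha := Metric.cauchySeq_iff.1 hf.cauchySeq
      intro ε hε
      obtain ⟨N₁, h1⟩ := ha (ε / 2) (by positivity)
      obtain ⟨N₂, h2⟩ := hb (ε / 2) (by positivity)
      refine ⟨max N₁ N₂, fun m hm k hk => ?_⟩
      have e1 := h1 m (le_of_max_le_left hm) k (le_of_max_le_left hk)
      have e2 := h2 m (le_of_max_le_right hm) k (le_of_max_le_right hk)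
      rw [dist_eq_norm, ← map_sub] at e1 e2 ⊢
      have e3 := hV.norm_sq (φ m - φ k)
      nlinarith [norm_nonneg (ι (φ m - φ k)), norm_nonneg (a (φ m - φ k)),
        norm_nonneg (b (φ m - φ k))]
    obtain ⟨v, hv⟩ := cauchySeq_tendsto_of_complete hcau
    have hjv : j v = f := by
      refine tendsto_nhds_unique ((j.continuous.tendsto v).comp hv) ?_
      simpa only [Function.comp_def, hV.comp] using hf
    have hveq : v = adjoint j (f + h) := by
      refine hV.eq_of_forall_inner fun ψ => ?_
      rw [ContinuousLinearMap.adjoint_inner_right, hV.comp, inner_add_right]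
      refine tendsto_nhds_unique (tendsto_const_nhds.inner hv) ?_
      simp only [hV.inner_eq]
      exact (tendsto_const_nhds.inner hf).add (hψ ψ)
    rw [← hveq, hjv]
  · intro hf
    obtain ⟨u, hu, hlim⟩ := mem_closure_iff_seq_limit.1 (hV.dense (adjoint j (f + h)))
    choose φ hφ using hu
    obtain rfl : (fun m => ι (φ m)) = u := funext hφ
    have ha : Tendsto (fun m => a (φ m)) atTop (𝓝 f) := by
      have := (j.continuous.tendsto _).comp hlim
      rw [← hf] at this
      simpa only [Function.comp_def, hV.comp] using this
    refine ⟨φ, ha, ?_, fun ψ => ?_⟩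
    · have hcau := hlim.cauchySeq
      rw [Metric.cauchySeq_iff] at hcau ⊢
      intro ε hε
      obtain ⟨N₁, h1⟩ := hcau ε hε
      refine ⟨N₁, fun m hm k hk => ?_⟩
      have e1 := h1 m hm k hk
      rw [dist_eq_norm, ← map_sub] at e1 ⊢
      have e3 := hV.norm_sq (φ m - φ k)
      nlinarith [norm_nonneg (ι (φ m - φ k)), norm_nonneg (a (φ m - φ k)),
        norm_nonneg (b (φ m - φ k))]
    · have h1 : Tendsto (fun m => inner ℂ (ι ψ) (ι (φ m))) atTop
          (𝓝 (inner ℂ (ι ψ) (adjoint j (f + h)))) := tendsto_const_nhds.inner hlim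
      have h2 : Tendsto (fun m => inner ℂ (a ψ) (a (φ m))) atTop (𝓝 (inner ℂ (a ψ) f)) :=
        tendsto_const_nhds.inner ha
      rw [ContinuousLinearMap.adjoint_inner_right, hV.comp, inner_add_right] at h1
      simp only [hV.inner_eq] at h1
      simpa using h1.sub h2

/-- Write `T` for the operator. As `(1 + T)⁻¹ = j j*`, the equation `(T - z) f = k` is equivalent to
`(1 - (1 + z) j j*) f = j j* k`. Hence `R = j j* (1 - (1 + z) j j*)⁻¹`, and conversely `1 + (1 + z)
R` is the inverse; there is no division by `1 + z`. -/
theorem isFormResolvent_iff_isUnit (hV : IsFormDomain a b ι j) (z : ℂ) :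
    IsFormResolvent a b z ↔ IsUnit (1 - ((1 + z) • j) ∘L adjoint j) := by
  simp only [IsFormResolvent, hV.formOperator_iff]
  constructor
  · rintro ⟨R, h1, h2⟩
    have e1 : ∀ h, R h = j (adjoint j h) + (1 + z) • j (adjoint j (R h)) := fun h => by
      conv_lhs => rw [h1 h]
      simp only [map_add, map_smul, add_smul, one_smul]
      abel
    have e2 : ∀ k, R (k - (1 + z) • j (adjoint j k)) = j (adjoint j k) := fun k => by
      have := h2 (j (adjoint j k)) (k - j (adjoint j k)) (by rw [add_sub_cancel])
      rwa [sub_sub, ← one_smul ℂ (j (adjoint j k)), smul_smul, mul_one, ← add_smul, one_smul] at this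
    refine ⟨⟨1 - ((1 + z) • j) ∘L adjoint j, 1 + (1 + z) • R, ?_, ?_⟩, rfl⟩
    · ext h
      change h + (1 + z) • R h - (1 + z) • j (adjoint j (h + (1 + z) • R h)) = h
      rw [map_add, map_add, map_smul, map_smul, ← e1]
      abel
    · ext h
      change h - (1 + z) • j (adjoint j h) + (1 + z) • R (h - (1 + z) • j (adjoint j h)) = h
      rw [e2]
      abel
  · rintro ⟨u, hu⟩
    have h1 : ∀ y, (u⁻¹).1 y - (1 + z) • j (adjoint j ((u⁻¹).1 y)) = y := fun y => by
      have := congrArg (fun F : H →L[ℂ] H => F y) u.mul_inv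
      rw [hu] at this
      exact this
    have h2 : ∀ y, (u⁻¹).1 (y - (1 + z) • j (adjoint j y)) = y := fun y => by
      have := congrArg (fun F : H →L[ℂ] H => F y) u.inv_mul
      rw [hu] at this
      exact this
    refine ⟨j ∘L adjoint j ∘L (u⁻¹).1, fun h => ?_, fun f h hf => ?_⟩
    · change j (adjoint j ((u⁻¹).1 h)) = j (adjoint j (j (adjoint j ((u⁻¹).1 h)) +
        (h + z • j (adjoint j ((u⁻¹).1 h)))))
      have : j (adjoint j ((u⁻¹).1 h)) + (h + z • j (adjoint j ((u⁻¹).1 h))) = (u⁻¹).1 h := by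
        refine Eq.trans ?_ (sub_eq_iff_eq_add.1 (h1 h)).symm
        rw [add_smul, one_smul]; abel
      rw [this]
    · change j (adjoint j ((u⁻¹).1 (h - z • f))) = f
      have : h - z • f = (f + h) - (1 + z) • j (adjoint j (f + h)) := by
        rw [← hf, add_smul, one_smul]; abel
      rw [this, h2, ← hf]

/-- A complex number `z` is in the resolvent set of the operator of a nonnegative form if and only if
the form `⟪b ψ, b φ⟫ - z ⟪a ψ, a φ⟫` is bounded below for the norm of the form domain. -/
theorem isFormResolvent_iff (hV : IsFormDomain a b ι j) (z : ℂ) :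
    IsFormResolvent a b z ↔ ∃ c : ℝ, 0 < c ∧ ∀ (φ : E) (C : ℝ), 0 ≤ C →
      (∀ ψ, ‖inner ℂ (b ψ) (b φ) - z * inner ℂ (a ψ) (a φ)‖ ≤ C * ‖ι ψ‖) → c * ‖ι φ‖ ≤ C := by
  -- Exchanging `j j*` for `j* j` moves the question from `H` to `V`, where the form itself can be
  -- read off.
  have hcomm : IsUnit (1 - ((1 + z) • j) ∘L adjoint j) ↔ IsUnit (1 - adjoint j ∘L ((1 + z) • j)) :=
    ⟨isUnit_one_sub_comp_comm, isUnit_one_sub_comp_comm⟩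
  have hnormal : IsStarNormal (1 - adjoint j ∘L ((1 + z) • j)) := by
    have hsa : IsSelfAdjoint (adjoint j ∘L j) := ContinuousLinearMap.IsPositive.isSelfAdjoint
      (ContinuousLinearMap.isPositive_adjoint_comp_self j)
    have e : (1 : V →L[ℂ] V) - adjoint j ∘L ((1 + z) • j) = 1 - (1 + z) • (adjoint j ∘L j) := by
      rw [ContinuousLinearMap.comp_smul]
    rw [e]
    refine ⟨?_⟩
    rw [star_sub, star_one, star_smul, hsa.star_eq]
    exact ((Commute.one_left _).sub_left (Commute.sub_right (Commute.one_right _)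
      (((Commute.refl _).smul_left _).smul_right _)))
  -- The identity of `V` contributes `⟪a ψ, a φ⟫ + ⟪b ψ, b φ⟫`, which turns the factor `1 + z` into
  -- `z`.
  have hinner : ∀ ψ φ, inner ℂ (ι ψ) ((1 - adjoint j ∘L ((1 + z) • j)) (ι φ)) =
      inner ℂ (b ψ) (b φ) - z * inner ℂ (a ψ) (a φ) := fun ψ φ => by
    change inner ℂ (ι ψ) (ι φ - adjoint j ((1 + z) • j (ι φ))) = _
    rw [inner_sub_right, ContinuousLinearMap.adjoint_inner_right, hV.inner_eq, hV.comp, hV.comp,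
      inner_smul_right]
    ring
  rw [hV.isFormResolvent_iff_isUnit, hcomm, isUnit_iff_exists_bound_of_isStarNormal hnormal]
  constructor
  · rintro ⟨c, hc, h⟩
    refine ⟨c, hc, fun φ C hC hψ => (h _).trans (hV.norm_le_of_forall hC fun ψ => ?_)⟩
    rw [hinner]
    exact hψ ψ
  · rintro ⟨c, hc, h⟩
    refine ⟨c, hc, fun x => hV.dense.induction_on
      (p := fun x => c * ‖x‖ ≤ ‖(1 - adjoint j ∘L ((1 + z) • j)) x‖) x
      (isClosed_le (by fun_prop) (by fun_prop)) fun φ => h φ _ (norm_nonneg _) fun ψ => ?_⟩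
    rw [← hinner, mul_comm]
    exact norm_inner_le_norm _ _

end IsFormDomain

/-- `V` is the closure of `{(a φ, b φ)}` in `H ⊕ N`, and `j` is the first projection. Injectivity of
`j`, i.e. closability of the form, plays no role in the criterion. -/
theorem exists_isFormDomain (a : E →ₗ[ℂ] H) (b : E →ₗ[ℂ] N) [CompleteSpace H] [CompleteSpace N] :
    ∃ (V : Submodule ℂ (WithLp 2 (H × N))) (_ : CompleteSpace V) (ι : E →ₗ[ℂ] V) (j : V →L[ℂ] H),
      IsFormDomain a b ι j := by
  let Φ : E →ₗ[ℂ] WithLp 2 (H × N) :=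
    (WithLp.linearEquiv 2 ℂ (H × N)).symm.toLinearMap ∘ₗ (a.prod b)
  let V := (LinearMap.range Φ).topologicalClosure
  let ι : E →ₗ[ℂ] V := Φ.codRestrict V fun φ => Submodule.le_topologicalClosure _ ⟨φ, rfl⟩
  refine ⟨V, (Submodule.isClosed_topologicalClosure _).completeSpace_coe, ι,
    (WithLp.fstL 2 ℂ H N).comp V.subtypeL, ?_, fun _ => rfl, fun _ _ => ?_⟩
  · intro v
    rw [IsEmbedding.subtypeVal.closure_eq_preimage_closure_image]
    have : Subtype.val '' Set.range ι = (LinearMap.range Φ : Set (WithLp 2 (H × N))) := by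
      rw [← Set.range_comp]; rfl
    rw [Set.mem_preimage, this]
    exact v.2
  · exact WithLp.prod_inner_apply _ _

/-- The completion `V` is eliminated, leaving a condition on `E` alone. The quantified `C` stands
for the dual norm of the functional of `ψ`, which then need not be formed as a supremum. -/
theorem isFormResolvent_iff_exists_bound (a : E →ₗ[ℂ] H) (b : E →ₗ[ℂ] N) [CompleteSpace H]
    [CompleteSpace N] (z : ℂ) :
    IsFormResolvent a b z ↔ ∃ c : ℝ, 0 < c ∧ ∀ (φ : E) (C : ℝ), 0 ≤ C →
      (∀ ψ, ‖inner ℂ (b ψ) (b φ) - z * inner ℂ (a ψ) (a φ)‖ ≤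
        C * Real.sqrt (‖a ψ‖ ^ 2 + ‖b ψ‖ ^ 2)) → c * Real.sqrt (‖a φ‖ ^ 2 + ‖b φ‖ ^ 2) ≤ C := by
  obtain ⟨V, hVc, ι, j, hV⟩ := exists_isFormDomain a b
  rw [hV.isFormResolvent_iff]
  have hn : ∀ φ, ‖ι φ‖ = Real.sqrt (‖a φ‖ ^ 2 + ‖b φ‖ ^ 2) := fun φ => by
    rw [← hV.norm_sq, Real.sqrt_sq (norm_nonneg _)]
  simp only [hn]

end FormOperator

/-! ### Smooth functions on `Γ\G` -/

section SmoothFunctions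

open RightCosets

variable {n : ℕ} {G : ClosedSubgroup (GL (Fin n) ℝ)} {K Γ : Subgroup G}

/-- Smoothness of test functions is given only along exponential coordinates. This identity turns
limits in those coordinates into limits on `Γ\G`. -/
theorem map_expG_chart_nhds {m : ℕ} (b : Module.Basis (Fin m) ℝ (lieAlgebra G))
    (x : RightCosets Γ) :
    map (fun t : Fin m → ℝ => MulOpposite.op (expG (∑ i, t i • b i)) • x) (𝓝 0) = 𝓝 x := by
  obtain ⟨a, rfl⟩ := mk_surjective Γ x
  have h1 : map (fun t : Fin m → ℝ => ∑ i, t i • b i) (𝓝 0) = 𝓝 (0 : lieAlgebra G) := by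
    have := b.equivFun.symm.toContinuousLinearEquiv.toHomeomorph.map_nhds_eq 0
    have e : ⇑b.equivFun.symm.toContinuousLinearEquiv.toHomeomorph =
        fun t : Fin m → ℝ => ∑ i, t i • b i := by
      funext t; exact b.equivFun_symm_apply t
    rw [e] at this
    simpa using this
  have h2 : (fun t : Fin m → ℝ => MulOpposite.op (expG (∑ i, t i • b i)) • mk Γ a) =
      cosetMap Γ a ∘ expG ∘ fun t : Fin m → ℝ => ∑ i, t i • b i := rfl
  rw [h2, ← Filter.map_map, ← Filter.map_map, h1, map_expG_nhds_zero, map_nhds_cosetMap]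
  simp [cosetMap]

theorem continuous_op_expG_smul {m : ℕ} (Y : Fin m → lieAlgebra G) (x : RightCosets Γ) :
    Continuous fun t : Fin m → ℝ => MulOpposite.op (expG (∑ i, t i • Y i)) • x := by
  obtain ⟨a, rfl⟩ := mk_surjective Γ x
  change Continuous fun t : Fin m → ℝ => mk Γ (a * expG (∑ i, t i • Y i))
  refine (continuous_mk Γ).comp (continuous_const.mul (continuous_expG.comp ?_))
  exact continuous_finsetSum _ fun i _ => (continuous_apply i).smul continuous_const

theorem continuous_op_expG_smul_real (Y : lieAlgebra G) (x : RightCosets Γ) :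
    Continuous fun t : ℝ => MulOpposite.op (expG (t • Y)) • x := by
  obtain ⟨a, rfl⟩ := mk_surjective Γ x
  change Continuous fun t : ℝ => mk Γ (a * expG (t • Y))
  exact (continuous_mk Γ).comp (continuous_const.mul (continuous_expG.comp
    (continuous_id.smul continuous_const)))

theorem op_expG_zero_smul (Y : lieAlgebra G) (x : RightCosets Γ) :
    MulOpposite.op (expG ((0 : ℝ) • Y)) • x = x := by
  rw [zero_smul, expG_zero, MulOpposite.op_one, one_smul]

theorem lieDeriv_eq_of_eventuallyEq {φ ψ : RightCosets Γ → ℂ} {x : RightCosets Γ}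
    (h : φ =ᶠ[𝓝 x] ψ) (Y : lieAlgebra G) : lieDeriv Y φ x = lieDeriv Y ψ x := by
  refine Filter.EventuallyEq.deriv_eq ?_
  have : Tendsto (fun t : ℝ => MulOpposite.op (expG (t • Y)) • x) (𝓝 0) (𝓝 x) :=
    (continuous_op_expG_smul_real Y x).tendsto' _ _ (op_expG_zero_smul Y x)
  exact this.eventually h

theorem lieDeriv_zero (Y : lieAlgebra G) (x : RightCosets Γ) :
    lieDeriv Y (0 : RightCosets Γ → ℂ) x = 0 := by
  simp [lieDeriv]

theorem lieDeriv_eq_zero {φ : RightCosets Γ → ℂ} {x : RightCosets Γ} (hx : x ∉ tsupport φ)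
    (Y : lieAlgebra G) : lieDeriv Y φ x = 0 := by
  rw [lieDeriv_eq_of_eventuallyEq (ψ := 0) _ Y, lieDeriv_zero]
  filter_upwards [(isClosed_tsupport φ).isOpen_compl.mem_nhds hx] with y hy
  exact image_eq_zero_of_notMem_tsupport hy

namespace IsTestFunction

variable {φ ψ : RightCosets Γ → ℂ}

theorem hasDerivAt (hφ : IsTestFunction K Γ φ) (Y : lieAlgebra G) (x : RightCosets Γ) :
    HasDerivAt (fun t : ℝ => φ (MulOpposite.op (expG (t • Y)) • x)) (lieDeriv Y φ x) 0 := by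
  have h1 := hφ.smooth x 1 fun _ => Y
  have h2 : ContDiff ℝ ∞ fun t : ℝ => fun _ : Fin 1 => t := by fun_prop
  have h3 := (h1.comp h2).differentiable (by simp)
  have h4 := (h3 0).hasDerivAt
  simp only [Function.comp_def, Fin.sum_univ_one] at h4
  exact h4

theorem continuous (hφ : IsTestFunction K Γ φ) : Continuous φ := by
  refine continuous_iff_continuousAt.2 fun x => ?_
  have hb := hφ.smooth x _ (Module.finBasis ℝ (lieAlgebra G))
  rw [ContinuousAt, ← map_expG_chart_nhds (Module.finBasis ℝ (lieAlgebra G)) x, tendsto_map'_iff]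
  refine hb.continuous.tendsto' _ _ ?_
  simp [expG_zero]

/-- At the point `x exp t` near `x`, the derivative along `Y` is the `s`-derivative at `0` of `φ (x
exp t exp (s Y)) = φ (x exp (Θ (t, s)))`. This composes the chart expression of `φ` at `x` with the
smooth map `Θ`, so it depends continuously on `t`. -/
theorem continuous_lieDeriv (hφ : IsTestFunction K Γ φ) (Y : lieAlgebra G) :
    Continuous (lieDeriv Y φ) := by
  refine continuous_iff_continuousAt.2 fun x => ?_
  let b := Module.finBasis ℝ (lieAlgebra G)
  have hb := hφ.smooth x _ b
  obtain ⟨Θ, hΘ, hΘe⟩ := exists_contDiffAt_mul_expG b Y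
  let Ψ : (Fin (Module.finrank ℝ (lieAlgebra G)) → ℝ) × ℝ → ℂ := fun p =>
    φ (MulOpposite.op (expG (∑ i, Θ p i • b i)) • x)
  have hΨ : ContDiffAt ℝ ∞ Ψ 0 := hb.contDiffAt.comp 0 hΘ
  have hΨd : ∀ᶠ p in 𝓝 (0 : (Fin (Module.finrank ℝ (lieAlgebra G)) → ℝ) × ℝ),
      DifferentiableAt ℝ Ψ p :=
    ((hΨ.of_le (m := 1) (by exact_mod_cast le_top)).eventually (by simp)).mono
      fun p hp => hp.differentiableAt (by simp)
  have hΨc : ContinuousAt (fderiv ℝ Ψ) 0 :=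
    (hΨ.fderiv_right (m := 0) (by exact_mod_cast le_top)).continuousAt
  have hcur : Tendsto (fun t : Fin (Module.finrank ℝ (lieAlgebra G)) → ℝ => (t, (0 : ℝ)))
      (𝓝 0) (𝓝 0) := (Continuous.prodMk continuous_id continuous_const).tendsto' _ _ rfl
  have hval : ∀ᶠ t in 𝓝 (0 : Fin (Module.finrank ℝ (lieAlgebra G)) → ℝ),
      lieDeriv Y φ (MulOpposite.op (expG (∑ i, t i • b i)) • x) = fderiv ℝ Ψ (t, 0) (0, 1) := by
    rw [← Prod.mk_zero_zero] at hΘe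
    filter_upwards [hΘe.curry_nhds, hcur.eventually hΨd] with t ht htd
    have h1 : HasDerivAt (fun s : ℝ => Ψ (t, s)) (fderiv ℝ Ψ (t, 0) (0, 1)) 0 :=
      htd.hasFDerivAt.comp_hasDerivAt 0 ((hasDerivAt_const _ _).prodMk (hasDerivAt_id _))
    rw [← h1.deriv]
    refine Filter.EventuallyEq.deriv_eq ?_
    filter_upwards [ht] with s hs
    change _ = φ (MulOpposite.op (expG (∑ i, Θ (t, s) i • b i)) • x)
    rw [smul_smul, ← MulOpposite.op_mul, hs]
  rw [ContinuousAt, ← map_expG_chart_nhds b x, tendsto_map'_iff]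
  have h0 := hval.self_of_nhds
  simp only [Pi.zero_apply, zero_smul, Finset.sum_const_zero, expG_zero, MulOpposite.op_one,
    one_smul] at h0
  rw [h0]
  have hlim : Tendsto (fun t : Fin (Module.finrank ℝ (lieAlgebra G)) → ℝ =>
      fderiv ℝ Ψ (t, 0) (0, 1)) (𝓝 0) (𝓝 (fderiv ℝ Ψ (0, 0) (0, 1))) :=
    ((ContinuousLinearMap.apply ℝ ℂ ((0 : Fin (Module.finrank ℝ (lieAlgebra G)) → ℝ),
      (1 : ℝ))).continuous.tendsto _).comp (hΨc.tendsto.comp hcur)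
  exact hlim.congr' (hval.mono fun t ht => ht.symm)

theorem hasCompactSupport_lieDeriv (hφ : IsTestFunction K Γ φ) (Y : lieAlgebra G) :
    HasCompactSupport (lieDeriv Y φ) :=
  hφ.compact.mono' fun x hx => by
    by_contra h
    exact hx (lieDeriv_eq_zero h Y)

theorem add (hφ : IsTestFunction K Γ φ) (hψ : IsTestFunction K Γ ψ) :
    IsTestFunction K Γ (φ + ψ) where
  smooth x m Y := (hφ.smooth x m Y).add (hψ.smooth x m Y)
  invariant k hk x := by simp [hφ.invariant k hk, hψ.invariant k hk]
  compact := hφ.compact.add hψ.compact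

theorem smul (hφ : IsTestFunction K Γ φ) (c : ℂ) : IsTestFunction K Γ (c • φ) where
  smooth x m Y := contDiff_const.smul (hφ.smooth x m Y)
  invariant k hk x := by simp [hφ.invariant k hk]
  compact := hφ.compact.smul_left (f := fun _ => c)

theorem lieDeriv_add (hφ : IsTestFunction K Γ φ) (hψ : IsTestFunction K Γ ψ) (Y : lieAlgebra G) :
    lieDeriv Y (φ + ψ) = lieDeriv Y φ + lieDeriv Y ψ :=
  funext fun x => ((hφ.hasDerivAt Y x).add (hψ.hasDerivAt Y x)).deriv

theorem lieDeriv_smul (hφ : IsTestFunction K Γ φ) (c : ℂ) (Y : lieAlgebra G) :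
    lieDeriv Y (c • φ) = c • lieDeriv Y φ :=
  funext fun x => ((hφ.hasDerivAt Y x).const_smul c).deriv

end IsTestFunction

variable (K Γ) in
/-- The space `C_c^∞(Γ\X)`. -/
def testSpace : Submodule ℂ (RightCosets Γ → ℂ) where
  carrier := {φ | IsTestFunction K Γ φ}
  add_mem' := fun h1 h2 => h1.add h2
  zero_mem' :=
    { smooth := fun _ _ _ => contDiff_const
      invariant := fun _ _ _ => rfl
      compact := HasCompactSupport.zero }
  smul_mem' := fun c _ h => h.smul c

end SmoothFunctions

/-! ### The Dirichlet form -/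

section Dirichlet

open RightCosets

variable {n : ℕ} {G : ClosedSubgroup (GL (Fin n) ℝ)} [MeasurableSpace G] [BorelSpace G]
  {K Γ : Subgroup G} [DiscreteTopology Γ] (μ : Measure G) [μ.IsHaarMeasure]

theorem IsTestFunction.memLp {φ : RightCosets Γ → ℂ} (hφ : IsTestFunction K Γ φ) :
    MemLp φ 2 (quotientMeasure Γ μ) :=
  hφ.continuous.memLp_of_hasCompactSupport hφ.compact

theorem IsTestFunction.memLp_lieDeriv {φ : RightCosets Γ → ℂ} (hφ : IsTestFunction K Γ φ)
    (Y : lieAlgebra G) : MemLp (lieDeriv Y φ) 2 (quotientMeasure Γ μ) :=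
  (hφ.continuous_lieDeriv Y).memLp_of_hasCompactSupport (hφ.hasCompactSupport_lieDeriv Y)

variable (K Γ) in
/-- The class in `L²(Γ\G)` of the derivative of a test function. -/
def testDeriv (Y : lieAlgebra G) : testSpace K Γ →ₗ[ℂ] Lp ℂ 2 (quotientMeasure Γ μ) where
  toFun φ := (IsTestFunction.memLp_lieDeriv μ φ.2 Y).toLp _
  map_add' φ ψ := by
    rw [← MemLp.toLp_add (IsTestFunction.memLp_lieDeriv μ φ.2 Y)
      (IsTestFunction.memLp_lieDeriv μ ψ.2 Y)]
    exact MemLp.toLp_congr _ _ (by rw [← IsTestFunction.lieDeriv_add φ.2 ψ.2]; rfl)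
  map_smul' c φ := by
    rw [RingHom.id_apply, ← MemLp.toLp_const_smul c (IsTestFunction.memLp_lieDeriv μ φ.2 Y)]
    exact MemLp.toLp_congr _ _ (by rw [← IsTestFunction.lieDeriv_smul φ.2]; rfl)

variable (K Γ) in
/-- The gradient of a test function, in the frame `e`. -/
def testGrad {d : ℕ} (e : Fin d → lieAlgebra G) :
    testSpace K Γ →ₗ[ℂ] PiLp 2 fun _ : Fin d => Lp ℂ 2 (quotientMeasure Γ μ) :=
  (WithLp.linearEquiv 2 ℂ (Fin d → Lp ℂ 2 (quotientMeasure Γ μ))).symm.toLinearMap ∘ₗ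
    LinearMap.pi fun i => testDeriv K Γ μ (e i)

theorem inner_testGrad {d : ℕ} (e : Fin d → lieAlgebra G) (φ ψ : testSpace K Γ) :
    inner ℂ (testGrad K Γ μ e ψ) (testGrad K Γ μ e φ) =
      ∑ i, ∫ x, conj (lieDeriv (e i) ψ.1 x) * lieDeriv (e i) φ.1 x ∂(quotientMeasure Γ μ) := by
  rw [PiLp.inner_apply]
  exact Finset.sum_congr rfl fun i _ => inner_toLp_toLp
    (IsTestFunction.memLp_lieDeriv μ ψ.2 (e i)) (IsTestFunction.memLp_lieDeriv μ φ.2 (e i))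

theorem dirichletForm_eq_inner {d : ℕ} (e : Fin d → lieAlgebra G) (φ ψ : testSpace K Γ) :
    dirichletForm μ e φ.1 ψ.1 = inner ℂ (testGrad K Γ μ e ψ) (testGrad K Γ μ e φ) := by
  rw [inner_testGrad, dirichletForm, integral_finsetSum]
  · simp only [mul_comm]
  · intro i _
    exact (IsTestFunction.memLp_lieDeriv μ φ.2 (e i)).integrable_mul
      (IsTestFunction.memLp_lieDeriv μ ψ.2 (e i)).star

variable [μ.IsMulRightInvariant]

instance : CompleteSpace (L2X K Γ μ) := by
  have : IsClosed (L2X K Γ μ : Set (Lp ℂ 2 (quotientMeasure Γ μ))) := by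
    have h : (L2X K Γ μ : Set (Lp ℂ 2 (quotientMeasure Γ μ))) = ⋂ k ∈ K,
        {f | rightRep G (RightCosets Γ) (quotientMeasure Γ μ) k f = f} := by
      ext f
      simp only [Set.mem_iInter]
      exact Iff.rfl
    rw [h]
    exact isClosed_biInter fun k _ => isClosed_eq (LinearIsometryEquiv.continuous _) continuous_id
  exact this.completeSpace_coe

variable (K Γ) in
/-- The class of a test function in `L²(Γ\X)`. -/
def testToL2X : testSpace K Γ →ₗ[ℂ] L2X K Γ μ where
  toFun φ := ⟨(IsTestFunction.memLp μ φ.2).toLp φ.1, fun k hk => by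
    rw [rightRep_toLp]
    exact MemLp.toLp_congr _ _ (Eventually.of_forall fun x => φ.2.invariant k hk x)⟩
  map_add' φ ψ := Subtype.ext
    (MemLp.toLp_add (IsTestFunction.memLp μ φ.2) (IsTestFunction.memLp μ ψ.2))
  map_smul' c φ := Subtype.ext (MemLp.toLp_const_smul c (IsTestFunction.memLp μ φ.2))

theorem coe_testToL2X (φ : testSpace K Γ) :
    (testToL2X K Γ μ φ).1 = (IsTestFunction.memLp μ φ.2).toLp φ.1 := rfl

theorem inner_testToL2X (φ ψ : testSpace K Γ) :
    inner ℂ (testToL2X K Γ μ ψ) (testToL2X K Γ μ φ) =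
      ∫ x, conj (ψ.1 x) * φ.1 x ∂(quotientMeasure Γ μ) := by
  rw [Submodule.coe_inner, coe_testToL2X, coe_testToL2X, inner_toLp_toLp]

theorem inner_testToL2X_left (ψ : testSpace K Γ) (h : L2X K Γ μ) :
    inner ℂ (testToL2X K Γ μ ψ) h = ∫ x, h.1 x * conj (ψ.1 x) ∂(quotientMeasure Γ μ) := by
  change inner ℂ (testToL2X K Γ μ ψ).1 h.1 = _
  rw [L2.inner_def]
  refine integral_congr_ae ?_
  filter_upwards [(IsTestFunction.memLp μ ψ.2).coeFn_toLp] with x hx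
  rw [coe_testToL2X, hx, RCLike.inner_apply]

/-- Dictionary with the abstract setting: `H = L²(Γ\X)`, `E = C_c^∞(Γ\X)` and `N = L²(Γ\G)^d`.
Derivatives of a `K`-invariant function need not be `K`-invariant, which is why `N` is built from
`Γ\G`. -/
theorem negLaplacian_iff_formOperator {d : ℕ} (e : Fin d → lieAlgebra G) (f h : L2X K Γ μ) :
    NegLaplacian K Γ μ e f h ↔ FormOperator (testToL2X K Γ μ) (testGrad K Γ μ e) f h := by
  have hlim : ∀ φ : ℕ → testSpace K Γ, Tendsto (fun m => eLpNorm (fun x => (φ m).1 x - f.1 x) 2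
      (quotientMeasure Γ μ)) atTop (𝓝 0) ↔
      Tendsto (fun m => testToL2X K Γ μ (φ m)) atTop (𝓝 f) := fun φ => by
    rw [tendsto_subtype_rng]
    have := Lp.tendsto_Lp_iff_tendsto_eLpNorm'' (fun m => (φ m).1)
      (fun m => IsTestFunction.memLp μ (φ m).2) f.1 (Lp.memLp f.1) (fi := atTop)
    rw [Lp.toLp_coeFn] at this
    exact this.symm
  have hcau : ∀ φ : ℕ → testSpace K Γ, (∀ ε : ℝ, 0 < ε → ∃ N : ℕ, ∀ m ≥ N, ∀ m' ≥ N,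
      ‖dirichletForm μ e ((φ m).1 - (φ m').1) ((φ m).1 - (φ m').1)‖ < ε) ↔
      CauchySeq fun m => testGrad K Γ μ e (φ m) := fun φ => by
    have hn : ∀ m m', ‖dirichletForm μ e ((φ m).1 - (φ m').1) ((φ m).1 - (φ m').1)‖ =
        dist (testGrad K Γ μ e (φ m)) (testGrad K Γ μ e (φ m')) ^ 2 := fun m m' => by
      have := dirichletForm_eq_inner μ e (φ m - φ m') (φ m - φ m')
      rw [inner_self_eq_norm_sq_to_K, map_sub, ← dist_eq_norm] at this
      change ‖dirichletForm μ e (φ m - φ m').1 (φ m - φ m').1‖ = _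
      rw [this]
      simp
    simp only [hn]
    rw [Metric.cauchySeq_iff]
    constructor
    · intro H ε hε
      obtain ⟨N, hN⟩ := H (ε ^ 2) (by positivity)
      exact ⟨N, fun m hm m' hm' => lt_of_pow_lt_pow_left₀ 2 hε.le (hN m hm m' hm')⟩
    · intro H ε hε
      obtain ⟨N, hN⟩ := H (Real.sqrt ε) (Real.sqrt_pos.2 hε)
      refine ⟨N, fun m hm m' hm' => ?_⟩
      have := hN m hm m' hm'
      calc _ < Real.sqrt ε ^ 2 := pow_lt_pow_left₀ this dist_nonneg (by norm_num)
        _ = ε := Real.sq_sqrt hε.le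
  constructor
  · rintro ⟨φ, hφ, hψ⟩
    let φ' : ℕ → testSpace K Γ := fun m => ⟨φ m, hφ.test m⟩
    refine ⟨φ', (hlim φ').1 hφ.tendsto, (hcau φ').1 hφ.cauchy, fun ψ => ?_⟩
    rw [inner_testToL2X_left]
    simp only [← dirichletForm_eq_inner]
    exact hψ ψ.1 ψ.2
  · rintro ⟨φ, h1, h2, h3⟩
    refine ⟨fun m => (φ m).1, ⟨fun m => (φ m).2, (hlim φ).2 h1, (hcau φ).2 h2⟩, fun ψ hψ => ?_⟩
    have := h3 ⟨ψ, hψ⟩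
    rw [inner_testToL2X_left] at this
    simp only [← dirichletForm_eq_inner] at this
    exact this

theorem notMem_laplaceSpectrum_iff {d : ℕ} (e : Fin d → lieAlgebra G) (z : ℂ) :
    z ∉ laplaceSpectrum K Γ μ e ↔ IsFormResolvent (testToL2X K Γ μ) (testGrad K Γ μ e) z := by
  change ¬¬ _ ↔ _
  rw [not_not]
  simp only [negLaplacian_iff_formOperator]
  rfl

/-- The square of the norm of a test function in `W¹(Γ\X)`. -/
def energy {d : ℕ} (e : Fin d → lieAlgebra G) (φ : RightCosets Γ → ℂ) : ℝ :=
  ∫ x, ‖φ x‖ ^ 2 ∂(quotientMeasure Γ μ) +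
    ∑ i, ∫ x, ‖lieDeriv (e i) φ x‖ ^ 2 ∂(quotientMeasure Γ μ)

/-- The form `∫ ⟨grad φ, grad ψ⟩ - z ∫ φ ψ̄`. -/
def shiftedForm {d : ℕ} (e : Fin d → lieAlgebra G) (z : ℂ) (φ ψ : RightCosets Γ → ℂ) : ℂ :=
  ∑ i, ∫ x, conj (lieDeriv (e i) ψ x) * lieDeriv (e i) φ x ∂(quotientMeasure Γ μ) -
    z * ∫ x, conj (ψ x) * φ x ∂(quotientMeasure Γ μ)

theorem integral_conj_mul_self {Ω : Type*} [MeasurableSpace Ω] (ν : Measure Ω) (f : Ω → ℂ) :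
    ∫ x, conj (f x) * f x ∂ν = ((∫ x, ‖f x‖ ^ 2 ∂ν : ℝ) : ℂ) := by
  rw [← integral_complex_ofReal]
  congr 1
  funext x
  rw [RCLike.conj_mul]
  norm_cast

/-- Only integrals of test functions and of their derivatives remain, and these can be compared
between `X` and `Γ\X`. -/
theorem notMem_laplaceSpectrum_iff_exists_bound {d : ℕ} (e : Fin d → lieAlgebra G) (z : ℂ) :
    z ∉ laplaceSpectrum K Γ μ e ↔ ∃ c : ℝ, 0 < c ∧ ∀ φ, IsTestFunction K Γ φ → ∀ C : ℝ, 0 ≤ C →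
      (∀ ψ, IsTestFunction K Γ ψ → ‖shiftedForm μ e z φ ψ‖ ≤ C * Real.sqrt (energy μ e ψ)) →
      c * Real.sqrt (energy μ e φ) ≤ C := by
  rw [notMem_laplaceSpectrum_iff, isFormResolvent_iff_exists_bound]
  have hn : ∀ φ : testSpace K Γ, ‖testToL2X K Γ μ φ‖ ^ 2 + ‖testGrad K Γ μ e φ‖ ^ 2 =
      energy μ e φ.1 := fun φ => by
    have h1 := (inner_self_eq_norm_sq_to_K (𝕜 := ℂ) (testToL2X K Γ μ φ)).symm.trans
      (inner_testToL2X μ φ φ)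
    have h2 := (inner_self_eq_norm_sq_to_K (𝕜 := ℂ) (testGrad K Γ μ e φ)).symm.trans
      (inner_testGrad μ e φ φ)
    simp only [integral_conj_mul_self] at h1 h2
    rw [energy]
    congr 1
    · norm_cast at h1
      exact Complex.ofReal_injective h1
    · norm_cast at h2
      exact Complex.ofReal_injective h2
  have hs : ∀ φ ψ : testSpace K Γ, inner ℂ (testGrad K Γ μ e ψ) (testGrad K Γ μ e φ) -
      z * inner ℂ (testToL2X K Γ μ ψ) (testToL2X K Γ μ φ) = shiftedForm μ e z φ.1 ψ.1 := by
    intro φ ψ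
    rw [inner_testToL2X, inner_testGrad, shiftedForm]
  simp only [hn, hs]
  constructor
  · rintro ⟨c, hc, h⟩
    exact ⟨c, hc, fun φ hφ C hC hψ => h ⟨φ, hφ⟩ C hC fun ψ => hψ ψ.1 ψ.2⟩
  · rintro ⟨c, hc, h⟩
    exact ⟨c, hc, fun φ C hC hψ => h φ.1 φ.2 C hC fun ψ hψ' => hψ ⟨ψ, hψ'⟩⟩

end Dirichlet

/-! ### Cutoff functions on `G` -/

section Cutoff

variable {n : ℕ} {G : ClosedSubgroup (GL (Fin n) ℝ)}

/-- Smoothness in the exponential charts of `G`. -/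
def SmoothAlong {F : Type*} [NormedAddCommGroup F] [NormedSpace ℝ F] (u : G → F) : Prop :=
  ∀ (g : G) (m : ℕ) (Y : Fin m → lieAlgebra G),
    ContDiff ℝ ∞ fun t : Fin m → ℝ => u (g * expG (∑ i, t i • Y i))

theorem SmoothAlong.differentiableAt {F : Type*} [NormedAddCommGroup F] [NormedSpace ℝ F]
    {u : G → F} (hu : SmoothAlong u) (g : G) (Y : lieAlgebra G) (t : ℝ) :
    DifferentiableAt ℝ (fun t : ℝ => u (g * expG (t • Y))) t := by
  have h2 : ContDiff ℝ ∞ fun t : ℝ => fun _ : Fin 1 => t := by fun_prop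
  have h3 := ((hu g 1 fun _ => Y).comp h2).differentiable (by simp)
  simpa only [Function.comp_def, Fin.sum_univ_one] using h3 t

/-- The derivative of `u` along the left invariant vector field `Y`. -/
def groupDeriv {F : Type*} [NormedAddCommGroup F] [NormedSpace ℝ F] (Y : lieAlgebra G) (u : G → F)
    (g : G) : F := deriv (fun t : ℝ => u (g * expG (t • Y))) 0

theorem SmoothAlong.hasDerivAt {F : Type*} [NormedAddCommGroup F] [NormedSpace ℝ F]
    {u : G → F} (hu : SmoothAlong u) (Y : lieAlgebra G) (g : G) :
    HasDerivAt (fun t : ℝ => u (g * expG (t • Y))) (groupDeriv Y u g) 0 :=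
  (hu.differentiableAt g Y 0).hasDerivAt

theorem smoothAlong_toMatrix (i j : Fin n) :
    SmoothAlong fun g : G => ClosedSubgroup.toMatrix g i j :=
  fun g _ Y => contDiff_toMatrix_mul_expG Y g i j

theorem smoothAlong_toMatrix_inv (i j : Fin n) :
    SmoothAlong fun g : G => ClosedSubgroup.toMatrix g⁻¹ i j := by
  intro g m Y
  have h : ∀ t : Fin m → ℝ, ClosedSubgroup.toMatrix (g * expG (∑ i, t i • Y i))⁻¹ i j =
      ∑ k, ClosedSubgroup.toMatrix (1 * expG (∑ i, t i • -Y i)) i k *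
        ClosedSubgroup.toMatrix g⁻¹ k j := fun t => by
    simp only [smul_neg, Finset.sum_neg_distrib, expG_neg, one_mul]
    rw [mul_inv_rev, toMatrix_mul, Matrix.mul_apply]
  simp only [h]
  exact ContDiff.sum fun k _ => (contDiff_toMatrix_mul_expG _ 1 i k).mul contDiff_const

/-- The entries of `g` and `g⁻¹`. -/
def entries (g : G) : (Fin n × Fin n) ⊕ (Fin n × Fin n) → ℝ :=
  Sum.elim (fun p => ClosedSubgroup.toMatrix g p.1 p.2)
    (fun p => ClosedSubgroup.toMatrix g⁻¹ p.1 p.2)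

theorem smoothAlong_entries (α : (Fin n × Fin n) ⊕ (Fin n × Fin n)) :
    SmoothAlong fun g : G => entries g α := by
  rcases α with p | p
  · exact smoothAlong_toMatrix p.1 p.2
  · exact smoothAlong_toMatrix_inv p.1 p.2

theorem continuous_entries (α : (Fin n × Fin n) ⊕ (Fin n × Fin n)) :
    Continuous fun g : G => entries g α := by
  rcases α with p | p
  · exact isEmbedding_toMatrix.continuous.matrix_elem p.1 p.2
  · exact (isEmbedding_toMatrix.continuous.comp continuous_inv).matrix_elem p.1 p.2

/-- The coefficients that express the entries of `g * h` by those of `g`. -/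
def entriesAction (h : G) :
    (Fin n × Fin n) ⊕ (Fin n × Fin n) → (Fin n × Fin n) ⊕ (Fin n × Fin n) → ℝ
  | .inl p, .inl q => if p.1 = q.1 then entries h (.inl (q.2, p.2)) else 0
  | .inr p, .inr q => if p.2 = q.2 then entries h (.inr (p.1, q.1)) else 0
  | _, _ => 0

theorem entries_mul (g h : G) (α : (Fin n × Fin n) ⊕ (Fin n × Fin n)) :
    entries (g * h) α = ∑ β, entriesAction h α β * entries g β := by
  rcases α with ⟨i, j⟩ | ⟨i, j⟩
  · simp only [entries, Sum.elim_inl, toMatrix_mul, Matrix.mul_apply, entriesAction,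
      Fintype.sum_sum_type, Fintype.sum_prod_type, ite_mul, zero_mul, Finset.sum_const_zero,
      add_zero]
    rw [Finset.sum_comm]
    simp [mul_comm]
  · simp only [entries, Sum.elim_inr, mul_inv_rev, toMatrix_mul, Matrix.mul_apply, entriesAction,
      Fintype.sum_sum_type, Fintype.sum_prod_type, ite_mul, zero_mul, Finset.sum_const_zero,
      zero_add]
    simp

theorem smoothAlong_entriesAction (α β : (Fin n × Fin n) ⊕ (Fin n × Fin n)) :
    SmoothAlong fun g : G => entriesAction g α β := by
  rcases α with p | p <;> rcases β with q | q <;> simp only [entriesAction]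
  · split_ifs
    · exact smoothAlong_entries _
    · exact fun _ _ _ => contDiff_const
  · exact fun _ _ _ => contDiff_const
  · exact fun _ _ _ => contDiff_const
  · split_ifs
    · exact smoothAlong_entries _
    · exact fun _ _ _ => contDiff_const

theorem continuous_entriesAction (α β : (Fin n × Fin n) ⊕ (Fin n × Fin n)) :
    Continuous fun g : G => entriesAction g α β := by
  rcases α with p | p <;> rcases β with q | q <;> simp only [entriesAction]
  · split_ifs
    · exact continuous_entries _
    · exact continuous_const
  · exact continuous_const
  · exact continuous_const
  · split_ifs
    · exact continuous_entries _
    · exact continuous_const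

/-- The sum of the squares of the entries of `g` and `g⁻¹`. -/
def entriesSq (g : G) : ℝ := ∑ α, entries g α ^ 2

theorem entriesSq_nonneg (g : G) : 0 ≤ entriesSq g := Finset.sum_nonneg fun _ _ => sq_nonneg _

theorem continuous_entriesSq : Continuous (entriesSq : G → ℝ) :=
  continuous_finsetSum _ fun α _ => (continuous_entries α).pow 2

theorem entriesSq_mul_le (g h : G) :
    entriesSq (g * h) ≤ (∑ α, ∑ β, entriesAction h α β ^ 2) * entriesSq g := by
  rw [entriesSq, Finset.sum_mul]
  refine Finset.sum_le_sum fun α _ => ?_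
  rw [entries_mul]
  exact Finset.sum_mul_sq_le_sq_mul_sq _ _ _

/-- Bounding the entries of `g⁻¹` too prevents `g` from approaching a singular matrix: `g ↦ (g,
g⁻¹)` is a closed embedding. -/
theorem isCompact_entriesSq_le (R : ℝ) : IsCompact {g : G | entriesSq g ≤ R} := by
  have hemb : IsClosedEmbedding (fun g : G => Units.embedProduct (Matrix (Fin n) (Fin n) ℝ) g.1) :=
    Units.isClosedEmbedding_embedProduct.comp G.isClosedEmbedding_subtype_val
  let B := Real.sqrt R
  have hbox : IsCompact {Y : Matrix (Fin n) (Fin n) ℝ | ∀ i j, |Y i j| ≤ B} := by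
    have : {Y : Matrix (Fin n) (Fin n) ℝ | ∀ i j, |Y i j| ≤ B} =
        Set.pi Set.univ fun _ : Fin n => Set.pi Set.univ fun _ : Fin n => Set.Icc (-B) B := by
      ext Y
      exact ⟨fun h i _ j _ => abs_le.1 (h i j),
        fun h i j => abs_le.2 (h i (Set.mem_univ i) j (Set.mem_univ j))⟩
    rw [this]
    exact isCompact_univ_pi fun _ => isCompact_univ_pi fun _ => isCompact_Icc
  have hc := hemb.isCompact_preimage (hbox.prod (hbox.image MulOpposite.continuous_op))
  refine hc.of_isClosed_subset (isClosed_le continuous_entriesSq continuous_const) fun g hg => ?_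
  have hle : ∀ α, |entries g α| ≤ B := fun α => by
    refine Real.abs_le_sqrt (le_trans ?_ hg)
    exact Finset.single_le_sum (f := fun α => entries g α ^ 2) (fun _ _ => sq_nonneg _)
      (Finset.mem_univ α)
  refine ⟨fun i j => hle (.inl (i, j)), _, fun i j => hle (.inr (i, j)), rfl⟩

/-- A right `K`-invariant smooth proper function on `G` whose logarithm has bounded derivatives. -/
theorem exists_proper_function {K : Subgroup G} (hK : IsCompact (K : Set G)) :
    ∃ N : G → ℝ, (∀ g, 1 ≤ N g) ∧ SmoothAlong N ∧ Continuous N ∧ (∀ g, ∀ k ∈ K, N (g * k) = N g) ∧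
      (∀ R, IsCompact {g | N g ≤ R}) ∧
      ∀ Y : lieAlgebra G, ∃ C, ∀ g, |groupDeriv Y N g| ≤ C * N g := by
  have : CompactSpace K := isCompact_iff_compactSpace.1 hK
  let _ : MeasurableSpace K := borel K
  have : BorelSpace K := ⟨rfl⟩
  let ν : Measure K := Measure.haar
  -- `N g` is `1` plus the average of `entriesSq (g k)` over `k ∈ K`. Expanding the average gives a
  -- quadratic form in the entries with coefficients `c`, which makes smoothness evident; the
  -- integral gives `K`-invariance and `N ≥ 1`.
  let c : (Fin n × Fin n) ⊕ (Fin n × Fin n) → (Fin n × Fin n) ⊕ (Fin n × Fin n) → ℝ := fun α β =>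
    ∫ k : K, ∑ γ, entriesAction (k : G) γ α * entriesAction (k : G) γ β ∂ν
  let N : G → ℝ := fun g => 1 + ∑ α, ∑ β, c α β * (entries g α * entries g β)
  have hcont : ∀ α β, Continuous fun k : K => entriesAction (k : G) α β := fun α β =>
    (continuous_entriesAction α β).comp continuous_subtype_val
  have hint : ∀ f : K → ℝ, Continuous f → Integrable f ν := fun f hf =>
    hf.integrable_of_hasCompactSupport (HasCompactSupport.of_compactSpace f)
  have hN : ∀ g, N g = 1 + ∫ k : K, entriesSq (g * (k : G)) ∂ν := fun g => by
    have h1 : ∀ k : K, entriesSq (g * (k : G)) = ∑ α, ∑ β,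
        (∑ γ, entriesAction (k : G) γ α * entriesAction (k : G) γ β) *
          (entries g α * entries g β) := fun k => by
      simp only [entriesSq, entries_mul, sq, Finset.sum_mul_sum]
      rw [Finset.sum_comm]
      refine Finset.sum_congr rfl fun α _ => ?_
      rw [Finset.sum_comm]
      refine Finset.sum_congr rfl fun β _ => ?_
      rw [Finset.sum_mul]
      exact Finset.sum_congr rfl fun γ _ => by ring
    have hi : ∀ α β, Integrable (fun k : K =>
        (∑ γ, entriesAction (k : G) γ α * entriesAction (k : G) γ β) *
          (entries g α * entries g β)) ν := fun α β => hint _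
      ((continuous_finsetSum _ fun γ _ => (hcont γ α).mul (hcont γ β)).mul continuous_const)
    simp only [h1]
    rw [integral_finsetSum _ fun α _ => integrable_finsetSum _ fun β _ => hi α β]
    simp only [integral_finsetSum _ fun β _ => hi _ β, integral_mul_const]
    rfl
  have hqi : ∀ g : G, Integrable (fun k : K => entriesSq (g * (k : G))) ν := fun g => hint _
    (continuous_entriesSq.comp (continuous_const.mul continuous_subtype_val))
  have hN1 : ∀ g, 1 ≤ N g := fun g => by
    have hI : 0 ≤ ∫ k : K, entriesSq (g * (k : G)) ∂ν :=
      integral_nonneg fun k : K => entriesSq_nonneg (g * (k : G))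
    rw [hN]
    linarith
  have hNs : SmoothAlong N := fun g m Y => contDiff_const.add (ContDiff.sum fun α _ =>
    ContDiff.sum fun β _ => contDiff_const.mul
      ((smoothAlong_entries α g m Y).mul (smoothAlong_entries β g m Y)))
  have hNc : Continuous N := continuous_const.add (continuous_finsetSum _ fun α _ =>
    continuous_finsetSum _ fun β _ => continuous_const.mul
      ((continuous_entries α).mul (continuous_entries β)))
  -- As `K` is compact, `entriesSq g` and `entriesSq (g k)` are comparable uniformly in `k`;
  -- averaging shows that `N` dominates `entriesSq`, hence is proper.
  obtain ⟨M, hM0, hM⟩ : ∃ M : ℝ, 0 < M ∧ ∀ g, entriesSq g ≤ M * N g := by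
    obtain ⟨M, hM⟩ := isCompact_univ.exists_bound_of_continuousOn
      (f := fun k : K => ∑ α, ∑ β, entriesAction ((k : G)⁻¹) α β ^ 2) (Continuous.continuousOn
        (continuous_finsetSum _ fun α _ => continuous_finsetSum _ fun β _ =>
          (((continuous_entriesAction α β).comp continuous_inv).comp
            continuous_subtype_val).pow 2))
    have hle : ∀ g (k : K), entriesSq g ≤ M * entriesSq (g * (k : G)) := fun g k => by
      have h1 := entriesSq_mul_le (g * (k : G)) (k : G)⁻¹
      rw [mul_inv_cancel_right] at h1
      exact h1.trans (mul_le_mul_of_nonneg_right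
        ((le_abs_self _).trans (hM k (Set.mem_univ k))) (entriesSq_nonneg _))
    have hvol : 0 < ν.real Set.univ := by
      rw [measureReal_def]
      exact ENNReal.toReal_pos (NeZero.ne _) (measure_ne_top _ _)
    refine ⟨(|M| + 1) / ν.real Set.univ, by positivity, fun g => ?_⟩
    have h2 : ∫ _ : K, entriesSq g ∂ν ≤ ∫ k : K, M * entriesSq (g * (k : G)) ∂ν :=
      integral_mono (integrable_const _) ((hqi g).const_mul M) fun k => hle g k
    rw [integral_const, integral_const_mul, smul_eq_mul] at h2
    have h3 : M * ∫ k : K, entriesSq (g * (k : G)) ∂ν ≤ (|M| + 1) * N g := by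
      have hI : 0 ≤ ∫ k : K, entriesSq (g * (k : G)) ∂ν :=
        integral_nonneg fun k : K => entriesSq_nonneg (g * (k : G))
      rw [hN g]
      nlinarith [le_abs_self M, abs_nonneg M]
    rw [div_mul_eq_mul_div, le_div_iff₀ hvol]
    linarith
  refine ⟨N, hN1, hNs, hNc, fun g k hk => ?_, fun R => ?_, fun Y => ?_⟩
  · rw [hN, hN]
    congr 1
    have := integral_mul_left_eq_self (μ := ν) (fun k' : K => entriesSq (g * (k' : G))) ⟨k, hk⟩
    rw [← this]
    simp only [Subgroup.coe_mul, mul_assoc]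
  · refine (isCompact_entriesSq_le (M * R)).of_isClosed_subset (isClosed_le hNc continuous_const) ?_
    exact fun g hg => (hM g).trans (mul_le_mul_of_nonneg_left hg hM0.le)
  · let A : (Fin n × Fin n) ⊕ (Fin n × Fin n) → (Fin n × Fin n) ⊕ (Fin n × Fin n) → ℝ := fun α β =>
      groupDeriv Y (fun g => entriesAction g α β) 1
    let A₁ : ℝ := ∑ α, ∑ β, |A α β|
    have hA : ∀ α β, |A α β| ≤ A₁ := fun α β =>
      (Finset.single_le_sum (f := fun β => |A α β|) (fun _ _ => abs_nonneg _)
        (Finset.mem_univ β)).trans (Finset.single_le_sum (f := fun α => ∑ β, |A α β|)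
          (fun _ _ => Finset.sum_nonneg fun _ _ => abs_nonneg _) (Finset.mem_univ α))
    have hA0 : 0 ≤ A₁ := Finset.sum_nonneg fun _ _ => Finset.sum_nonneg fun _ _ => abs_nonneg _
    -- Along `Y` the entries change linearly, with coefficients independent of `g`. So the
    -- derivative of `N` is again quadratic in the entries, hence at most a multiple of `entriesSq`,
    -- and so of `N`.
    have hd : ∀ g α, HasDerivAt (fun t : ℝ => entries (g * expG (t • Y)) α)
        (∑ β, A α β * entries g β) 0 := fun g α => by
      simp only [entries_mul]
      have := HasDerivAt.fun_sum (u := Finset.univ) fun β _ =>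
        ((smoothAlong_entriesAction α β).hasDerivAt Y 1).mul_const (entries g β)
      simpa only [one_mul] using this
    have hdN : ∀ g, groupDeriv Y N g = ∑ α, ∑ β, c α β *
        ((∑ γ, A α γ * entries g γ) * entries g β + entries g α * ∑ γ, A β γ * entries g γ) := by
      intro g
      have := (HasDerivAt.fun_sum (u := Finset.univ) fun α _ => HasDerivAt.fun_sum
        (u := Finset.univ) fun β _ => ((hd g α).fun_mul (hd g β)).const_mul (c α β)).const_add 1
      simp only [zero_smul, expG_zero, mul_one] at this
      exact this.deriv
    let s : G → ℝ := fun g => ∑ α, |entries g α|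
    have hs0 : ∀ g, 0 ≤ s g := fun g => Finset.sum_nonneg fun _ _ => abs_nonneg _
    have hes : ∀ g α, |entries g α| ≤ s g := fun g α =>
      Finset.single_le_sum (f := fun α => |entries g α|) (fun _ _ => abs_nonneg _)
        (Finset.mem_univ α)
    have hAs : ∀ g α, |∑ γ, A α γ * entries g γ| ≤ A₁ * s g := fun g α => by
      rw [Finset.mul_sum]
      refine (Finset.abs_sum_le_sum_abs _ _).trans (Finset.sum_le_sum fun γ _ => ?_)
      rw [abs_mul]
      exact mul_le_mul_of_nonneg_right (hA α γ) (abs_nonneg _)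
    have hsq : ∀ g, s g ^ 2 ≤ Fintype.card ((Fin n × Fin n) ⊕ (Fin n × Fin n)) * entriesSq g :=
      fun g => by
        have := sq_sum_le_card_mul_sum_sq (s := Finset.univ) (f := fun α => |entries g α|)
        simp only [sq_abs, Finset.card_univ] at this
        exact this
    let C₁ : ℝ := ∑ α, ∑ β, |c α β|
    have hC₁ : 0 ≤ C₁ := Finset.sum_nonneg fun _ _ => Finset.sum_nonneg fun _ _ => abs_nonneg _
    refine ⟨C₁ * (2 * A₁ * (Fintype.card ((Fin n × Fin n) ⊕ (Fin n × Fin n)) * M)), fun g => ?_⟩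
    have h1 : |groupDeriv Y N g| ≤ C₁ * (2 * A₁ * s g ^ 2) := by
      rw [hdN, Finset.sum_mul]
      refine (Finset.abs_sum_le_sum_abs _ _).trans (Finset.sum_le_sum fun α _ => ?_)
      rw [Finset.sum_mul]
      refine (Finset.abs_sum_le_sum_abs _ _).trans (Finset.sum_le_sum fun β _ => ?_)
      rw [abs_mul]
      refine mul_le_mul_of_nonneg_left ((abs_add_le _ _).trans ?_) (abs_nonneg _)
      rw [abs_mul, abs_mul]
      have e1 := mul_le_mul (hAs g α) (hes g β) (abs_nonneg _) (mul_nonneg hA0 (hs0 g))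
      have e2 := mul_le_mul (hes g α) (hAs g β) (abs_nonneg _) (hs0 g)
      nlinarith
    refine h1.trans ?_
    have h2 : s g ^ 2 ≤ Fintype.card ((Fin n × Fin n) ⊕ (Fin n × Fin n)) * (M * N g) :=
      (hsq g).trans (mul_le_mul_of_nonneg_left (hM g) (Nat.cast_nonneg _))
    calc _ ≤ C₁ * (2 * A₁ * (Fintype.card ((Fin n × Fin n) ⊕ (Fin n × Fin n)) * (M * N g))) := by
          gcongr
      _ = _ := by ring

/-- Cutoff functions with uniformly bounded derivatives. -/
theorem exists_cutoff {K : Subgroup G} (hK : IsCompact (K : Set G)) {d : ℕ}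
    (e : Fin d → lieAlgebra G) : ∃ C : ℝ, 0 ≤ C ∧ ∀ Q : Set G, IsCompact Q →
      ∃ (χ : G → ℝ) (O : Set G), SmoothAlong χ ∧ (∀ g, ∀ k ∈ K, χ (g * k) = χ g) ∧
        HasCompactSupport χ ∧ (∀ g, |χ g| ≤ 1) ∧ IsOpen O ∧ Q ⊆ O ∧ (∀ g ∈ O, χ g = 1) ∧
        ∀ i g, |groupDeriv (e i) χ g| ≤ C := by
  obtain ⟨N, hN1, hNs, hNc, hNK, hNp, hNd⟩ := exists_proper_function hK
  choose C hC using hNd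
  -- The cutoff is `f (log N / R)`, with `f` equal to `1` on `[-1, 1]` and supported in `[-2, 2]`.
  -- Its derivative along `Y` is `f'` times `(Y N / N) / R`, which is bounded independently of `Q`
  -- because `R ≥ 1`.
  let f : ContDiffBump (0 : ℝ) := ⟨1, 2, one_pos, one_lt_two⟩
  have hf : ContDiff ℝ ∞ f := f.contDiff
  obtain ⟨B, hB⟩ : ∃ B, ∀ x, ‖deriv f x‖ ≤ B :=
    (hf.continuous_deriv (by simp)).bounded_above_of_compact_support f.hasCompactSupport.deriv
  have hB0 : 0 ≤ B := (norm_nonneg _).trans (hB 0)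
  refine ⟨∑ i, B * |C (e i)|, Finset.sum_nonneg fun i _ => by positivity, fun Q hQ => ?_⟩
  obtain ⟨b, hb⟩ := hQ.exists_bound_of_continuousOn hNc.continuousOn
  -- The summand `1` makes `log N < R` strict on `Q`, so that `χ` is `1` on an open set containing
  -- `Q`.
  let R : ℝ := max 1 (Real.log (max b 1) + 1)
  have hR : 1 ≤ R := le_max_left _ _
  have hR0 : 0 < R := by linarith
  have hNpos : ∀ g, 0 < N g := fun g => by linarith [hN1 g]
  have hlog : ∀ g, 0 ≤ Real.log (N g) := fun g => Real.log_nonneg (hN1 g)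
  have hlogc : Continuous fun g => Real.log (N g) := hNc.log fun g => (hNpos g).ne'
  let χ : G → ℝ := fun g => f (Real.log (N g) / R)
  refine ⟨χ, {g | Real.log (N g) < R}, fun g m Y => ?_, fun g k hk => ?_, ?_, fun g => ?_,
    isOpen_lt hlogc continuous_const, fun g hg => ?_, fun g hg => ?_, fun i g => ?_⟩
  · exact hf.comp (((hNs g m Y).log fun t => (hNpos _).ne').div_const R)
  · change f _ = f _
    rw [hNK g k hk]
  · refine HasCompactSupport.of_support_subset_isCompact (hNp (Real.exp (2 * R))) fun g hg => ?_
    have h1 : Real.log (N g) / R ∈ Function.support f := hg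
    rw [f.support_eq, Metric.mem_ball, dist_zero_right, Real.norm_eq_abs] at h1
    have h2 : Real.log (N g) / R < 2 := (le_abs_self _).trans_lt h1
    rw [div_lt_iff₀ hR0] at h2
    exact ((Real.log_lt_iff_lt_exp (hNpos g)).1 h2).le
  · rw [abs_of_nonneg f.nonneg]
    exact f.le_one
  · have h1 : N g ≤ max b 1 := ((le_abs_self _).trans (hb g hg)).trans (le_max_left _ _)
    have h2 : Real.log (N g) ≤ Real.log (max b 1) := Real.log_le_log (hNpos g) h1
    have h3 : Real.log (max b 1) + 1 ≤ R := le_max_right _ _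
    change Real.log (N g) < R
    linarith
  · refine f.one_of_mem_closedBall ?_
    rw [Metric.mem_closedBall, dist_zero_right, Real.norm_of_nonneg (div_nonneg (hlog g) hR0.le)]
    change _ ≤ (1 : ℝ)
    rw [div_le_one hR0]
    exact le_of_lt hg
  · have hd := hNs.hasDerivAt (e i) g
    have h0 : N (g * expG ((0 : ℝ) • e i)) = N g := by rw [zero_smul, expG_zero, mul_one]
    have hl := (hd.log (by rw [h0]; exact (hNpos g).ne')).div_const R
    have hχ := ((hf.differentiable (by simp) _).hasDerivAt).comp (0 : ℝ) hl
    have hval : groupDeriv (e i) χ g =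
        deriv f (Real.log (N (g * expG ((0 : ℝ) • e i))) / R) *
          (groupDeriv (e i) N g / N (g * expG ((0 : ℝ) • e i)) / R) := hχ.deriv
    rw [hval, h0, abs_mul]
    have h1 : |groupDeriv (e i) N g / N g / R| ≤ |C (e i)| := by
      rw [abs_div, abs_div, abs_of_pos (hNpos g), abs_of_pos hR0, div_le_iff₀ hR0,
        div_le_iff₀ (hNpos g)]
      refine (hC (e i) g).trans ?_
      have := hNpos g
      calc C (e i) * N g ≤ |C (e i)| * 1 * N g := by
            rw [mul_one]; exact mul_le_mul_of_nonneg_right (le_abs_self _) this.le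
        _ ≤ _ := by gcongr
    refine (mul_le_mul (hB _) h1 (abs_nonneg _) hB0).trans ?_
    exact Finset.single_le_sum (f := fun i => B * |C (e i)|) (fun i _ => by positivity)
      (Finset.mem_univ i)

end Cutoff

/-! ### Transfer of test functions between `X` and `Γ\X` -/

section Transfer

open RightCosets

variable {n : ℕ} {G : ClosedSubgroup (GL (Fin n) ℝ)} {K Γ : Subgroup G}

/-- The functions on `G` that define the elements of `C_c^∞(X)`. -/
structure IsGroupTestFunction (K : Subgroup G) (u : G → ℂ) : Prop where
  smooth : SmoothAlong u
  invariant : ∀ g, ∀ k ∈ K, u (g * k) = u g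
  compact : HasCompactSupport u

theorem groupDeriv_eq_of_eventuallyEq {u v : G → ℂ} {g : G} (h : u =ᶠ[𝓝 g] v)
    (Y : lieAlgebra G) : groupDeriv Y u g = groupDeriv Y v g := by
  refine Filter.EventuallyEq.deriv_eq ?_
  have hc : Continuous fun t : ℝ => g * expG (t • Y) :=
    continuous_const.mul (continuous_expG.comp (continuous_id.smul continuous_const))
  have : Tendsto (fun t : ℝ => g * expG (t • Y)) (𝓝 0) (𝓝 g) :=
    hc.tendsto' _ _ (by rw [zero_smul, expG_zero, mul_one])
  exact this.eventually h

theorem groupDeriv_eq_zero {u : G → ℂ} {g : G} (hg : g ∉ tsupport u) (Y : lieAlgebra G) :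
    groupDeriv Y u g = 0 := by
  rw [groupDeriv_eq_of_eventuallyEq (v := 0) _ Y]
  · simp [groupDeriv]
  · filter_upwards [(isClosed_tsupport u).isOpen_compl.mem_nhds hg] with y hy
    exact image_eq_zero_of_notMem_tsupport hy

theorem groupDeriv_comp_cosetMap (ψ : RightCosets Γ → ℂ) (g : G) (Y : lieAlgebra G) (h : G) :
    groupDeriv Y (fun h => ψ (cosetMap Γ g h)) h = lieDeriv Y ψ (cosetMap Γ g h) := by
  simp only [groupDeriv, lieDeriv, op_smul_cosetMap]

theorem IsTestFunction.smoothAlong {ψ : RightCosets Γ → ℂ} (hψ : IsTestFunction K Γ ψ) (g : G) :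
    SmoothAlong fun h => ψ (cosetMap Γ g h) := by
  intro h m Y
  simp only [← op_smul_cosetMap]
  exact hψ.smooth _ m Y

theorem IsTestFunction.comp_cosetMap_mul {ψ : RightCosets Γ → ℂ} (hψ : IsTestFunction K Γ ψ)
    (g h : G) {k : G} (hk : k ∈ K) : ψ (cosetMap Γ g (h * k)) = ψ (cosetMap Γ g h) := by
  rw [← op_smul_cosetMap, hψ.invariant k hk]

theorem IsTestFunction.isGroupTestFunction {f : RightCosets (⊥ : Subgroup G) → ℂ}
    (hf : IsTestFunction K ⊥ f) : IsGroupTestFunction K fun h => f (cosetMap ⊥ 1 h) where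
  smooth := hf.smoothAlong 1
  invariant h _ hk := hf.comp_cosetMap_mul 1 h hk
  compact := by
    have he : IsOpenEmbedding (cosetMap (⊥ : Subgroup G) 1) :=
      .of_continuous_injective_isOpenMap (continuous_cosetMap _ _) (cosetMap_bot_injective 1)
        (isOpenMap_cosetMap _ _)
    have hc : IsClosedEmbedding (cosetMap (⊥ : Subgroup G) 1) :=
      ⟨he.isEmbedding, by rw [(cosetMap_surjective _ _).range_eq]; exact isClosed_univ⟩
    exact hf.compact.comp_isClosedEmbedding hc

/-- `X` is treated as the quotient by the trivial group, with `g = 1` and `U = G`, so that the same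
transfer lemmas serve `X` and `Γ\X`. -/
theorem pushFun_bot_comp_cosetMap (f : RightCosets (⊥ : Subgroup G) → ℂ) :
    pushFun ⊥ 1 Set.univ (fun h => f (cosetMap ⊥ 1 h)) = f := by
  funext x
  obtain ⟨h, rfl⟩ := cosetMap_surjective ⊥ 1 x
  exact pushFun_cosetMap (cosetMap_bot_injective 1).injOn (Set.mem_univ h)

/-! ### Copying test functions of `G` to `Γ\G`: smoothness, energy and form. -/

section PushFun

variable {g : G} {U : Set G} {u : G → ℂ}

theorem lieDeriv_pushFun (hUo : IsOpen U) (hU : Set.InjOn (cosetMap Γ g) U) (Y : lieAlgebra G)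
    {h : G} (hh : h ∈ U) : lieDeriv Y (pushFun Γ g U u) (cosetMap Γ g h) = groupDeriv Y u h := by
  rw [← groupDeriv_comp_cosetMap]
  refine groupDeriv_eq_of_eventuallyEq ?_ Y
  filter_upwards [hUo.mem_nhds hh] with y hy
  exact pushFun_cosetMap hU hy

variable [DiscreteTopology Γ]

theorem IsGroupTestFunction.pushFun (hu : IsGroupTestFunction K u) (hUo : IsOpen U)
    (hU : Set.InjOn (cosetMap Γ g) U) (huU : tsupport u ⊆ U) :
    IsTestFunction K Γ (pushFun Γ g U u) where
  smooth x m Y := by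
    refine contDiff_iff_contDiffAt.2 fun t₀ => ?_
    have hc := continuous_op_expG_smul Y x
    by_cases hx : MulOpposite.op (expG (∑ i, t₀ i • Y i)) • x ∈ cosetMap Γ g '' tsupport u
    · obtain ⟨h₀, hh₀, hh₀x⟩ := hx
      -- Among the lifts of `x`, this one makes the chart pass through `h₀ ∈ U` at `t₀`; near `t₀`
      -- the copy is then `u` itself.
      let a : G := h₀ * (expG (∑ i, t₀ i • Y i))⁻¹
      have hxa : x = cosetMap Γ g a := by
        rw [← op_smul_cosetMap, hh₀x, smul_smul, ← MulOpposite.op_mul]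
        simp
      have hcont : Continuous fun t : Fin m → ℝ => a * expG (∑ i, t i • Y i) :=
        continuous_const.mul (continuous_expG.comp
          (continuous_finsetSum _ fun i _ => (continuous_apply i).smul continuous_const))
      have hU₀ : a * expG (∑ i, t₀ i • Y i) ∈ U := by
        simp only [a, inv_mul_cancel_right]
        exact huU hh₀
      refine (hu.smooth a m Y).contDiffAt.congr_of_eventuallyEq ?_
      filter_upwards [hcont.continuousAt.eventually (hUo.mem_nhds hU₀)] with t ht
      rw [hxa, op_smul_cosetMap, pushFun_cosetMap hU ht]
    · have hcl : IsClosed (cosetMap Γ g '' tsupport u) :=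
        (hu.compact.isCompact.image (continuous_cosetMap Γ g)).isClosed
      refine (contDiffAt_const (c := (0 : ℂ))).congr_of_eventuallyEq ?_
      filter_upwards [hc.continuousAt.eventually (hcl.isOpen_compl.mem_nhds hx)] with t ht
      exact image_eq_zero_of_notMem_tsupport fun h => ht (tsupport_pushFun_subset hU hu.compact h)
  invariant := by
    -- `U` need not be stable under `K`, but the support of `u` is. At a zero of the copy the same
    -- statement is applied to `k⁻¹` at the translated point.
    have key : ∀ k ∈ K, ∀ x, RightCosets.pushFun Γ g U u x ≠ 0 →
        RightCosets.pushFun Γ g U u (MulOpposite.op k • x) = RightCosets.pushFun Γ g U u x := by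
      intro k hk x hx
      obtain ⟨h, ⟨hhU, hh⟩, rfl⟩ := support_pushFun_subset hU hx
      have h1 : h * k ∈ U := huU (subset_tsupport u (by
        rw [Function.mem_support, hu.invariant h k hk]; exact hh))
      rw [op_smul_cosetMap, pushFun_cosetMap hU h1, pushFun_cosetMap hU hhU, hu.invariant h k hk]
    intro k hk x
    by_cases hx : RightCosets.pushFun Γ g U u x = 0
    · by_contra hne
      rw [hx] at hne
      have := key k⁻¹ (inv_mem hk) _ hne
      rw [smul_smul, ← MulOpposite.op_mul, mul_inv_cancel, MulOpposite.op_one, one_smul, hx] at this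
      exact hne this.symm
    · exact key k hk x hx
  compact := hasCompactSupport_pushFun hU hu.compact

variable [MeasurableSpace G] [BorelSpace G] (μ : Measure G) [μ.IsHaarMeasure]

/-- The right side involves neither `Γ`, `g` nor `U`, so all copies of `u`, on `X` or on `Γ\X`, have
the same energy. -/
theorem energy_pushFun (hu : IsGroupTestFunction K u) (hUo : IsOpen U)
    (hU : Set.InjOn (cosetMap Γ g) U) (huU : tsupport u ⊆ U) {d : ℕ} (e : Fin d → lieAlgebra G) :
    energy μ e (pushFun Γ g U u) =
      ∫ h, ‖u h‖ ^ 2 ∂μ + ∑ i, ∫ h, ‖groupDeriv (e i) u h‖ ^ 2 ∂μ := by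
  have hF : IsTestFunction K Γ (pushFun Γ g U u) := hu.pushFun hUo hU huU
  have hoff : ∀ x ∉ cosetMap Γ g '' U, x ∉ tsupport (pushFun Γ g U u) := fun x hx hx' =>
    hx (Set.image_mono huU (tsupport_pushFun_subset hU hu.compact hx'))
  rw [energy]
  congr 1
  · rw [integral_eq_setIntegral_cosetMap μ hUo hU
      (Φ := fun x => ‖RightCosets.pushFun Γ g U u x‖ ^ 2) (hF.continuous.norm.pow 2)]
    · rw [← setIntegral_eq_integral_of_forall_compl_eq_zero (s := U) (f := fun h => ‖u h‖ ^ 2)]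
      · refine setIntegral_congr_fun hUo.measurableSet fun h hh => ?_
        simp only [pushFun_cosetMap hU hh]
      · intro h hh
        rw [image_eq_zero_of_notMem_tsupport fun h' => hh (huU h')]
        simp
    · intro x hx
      rw [pushFun_eq_zero hx]
      simp
  · refine Finset.sum_congr rfl fun i _ => ?_
    rw [integral_eq_setIntegral_cosetMap μ hUo hU
      (Φ := fun x => ‖lieDeriv (e i) (RightCosets.pushFun Γ g U u) x‖ ^ 2)
      ((hF.continuous_lieDeriv (e i)).norm.pow 2)]
    · rw [← setIntegral_eq_integral_of_forall_compl_eq_zero (s := U)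
        (f := fun h => ‖groupDeriv (e i) u h‖ ^ 2)]
      · refine setIntegral_congr_fun hUo.measurableSet fun h hh => ?_
        simp only [lieDeriv_pushFun hUo hU (e i) hh]
      · intro h hh
        rw [groupDeriv_eq_zero fun h' => hh (huU h')]
        simp
    · intro x hx
      rw [lieDeriv_eq_zero (hoff x hx)]
      simp

/-- The second argument enters only through its lift to `G`, so `ψ` may be changed away from the
support of `u`. -/
theorem shiftedForm_pushFun (hu : IsGroupTestFunction K u) (hUo : IsOpen U)
    (hU : Set.InjOn (cosetMap Γ g) U) (huU : tsupport u ⊆ U) {d : ℕ} (e : Fin d → lieAlgebra G)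
    (z : ℂ) {ψ : RightCosets Γ → ℂ} (hψ : IsTestFunction K Γ ψ) :
    shiftedForm μ e z (pushFun Γ g U u) ψ =
      ∑ i, ∫ h, conj (groupDeriv (e i) (fun h => ψ (cosetMap Γ g h)) h) * groupDeriv (e i) u h ∂μ -
        z * ∫ h, conj (ψ (cosetMap Γ g h)) * u h ∂μ := by
  have hF : IsTestFunction K Γ (pushFun Γ g U u) := hu.pushFun hUo hU huU
  have hoff : ∀ x ∉ cosetMap Γ g '' U, x ∉ tsupport (pushFun Γ g U u) := fun x hx hx' =>
    hx (Set.image_mono huU (tsupport_pushFun_subset hU hu.compact hx'))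
  rw [shiftedForm]
  congr 2
  · funext i
    rw [integral_eq_setIntegral_cosetMap μ hUo hU
      (Φ := fun x => conj (lieDeriv (e i) ψ x) * lieDeriv (e i) (RightCosets.pushFun Γ g U u) x)
      ((Complex.continuous_conj.comp (hψ.continuous_lieDeriv (e i))).mul
        (hF.continuous_lieDeriv (e i)))]
    · rw [← setIntegral_eq_integral_of_forall_compl_eq_zero (s := U) (f := fun h =>
        conj (groupDeriv (e i) (fun h => ψ (cosetMap Γ g h)) h) * groupDeriv (e i) u h)]
      · refine setIntegral_congr_fun hUo.measurableSet fun h hh => ?_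
        simp only [lieDeriv_pushFun hUo hU (e i) hh, groupDeriv_comp_cosetMap]
      · intro h hh
        rw [groupDeriv_eq_zero fun h' => hh (huU h')]
        simp
    · intro x hx
      rw [lieDeriv_eq_zero (hoff x hx)]
      simp
  · rw [integral_eq_setIntegral_cosetMap μ hUo hU
      (Φ := fun x => conj (ψ x) * RightCosets.pushFun Γ g U u x)
      ((Complex.continuous_conj.comp hψ.continuous).mul hF.continuous)]
    · rw [← setIntegral_eq_integral_of_forall_compl_eq_zero (s := U)
        (f := fun h => conj (ψ (cosetMap Γ g h)) * u h)]
      · refine setIntegral_congr_fun hUo.measurableSet fun h hh => ?_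
        simp only [pushFun_cosetMap hU hh]
      · intro h hh
        rw [image_eq_zero_of_notMem_tsupport fun h' => hh (huU h')]
        simp
    · intro x hx
      rw [pushFun_eq_zero hx]
      simp

theorem integral_le_of_le_indicator (hUo : IsOpen U) (hU : Set.InjOn (cosetMap Γ g) U)
    {Φ : RightCosets Γ → ℝ} (hΦ : Continuous Φ) (hΦ0 : ∀ x, 0 ≤ Φ x)
    (hΦi : Integrable Φ (quotientMeasure Γ μ)) {w : G → ℝ} (hw0 : ∀ h, 0 ≤ w h)
    (hw : ∀ h ∈ U, w h ≤ Φ (cosetMap Γ g h)) (hwU : ∀ h ∉ U, w h = 0) :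
    ∫ h, w h ∂μ ≤ ∫ x, Φ x ∂(quotientMeasure Γ μ) := by
  have hint : IntegrableOn (fun h => Φ (cosetMap Γ g h)) U μ := by
    have h1 : Integrable Φ ((μ.restrict U).map (cosetMap Γ g)) := by
      rw [← restrict_image_cosetMap_quotientMeasure μ hUo hU]
      exact hΦi.restrict
    exact (integrable_map_measure hΦ.aestronglyMeasurable
      (continuous_cosetMap Γ g).aemeasurable).1 h1
  calc ∫ h, w h ∂μ ≤ ∫ h, U.indicator (fun h => Φ (cosetMap Γ g h)) h ∂μ := by
        refine integral_mono_of_nonneg (Eventually.of_forall hw0)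
          (hint.integrable_indicator hUo.measurableSet) (Eventually.of_forall fun h => ?_)
        by_cases hh : h ∈ U
        · simpa only [Set.indicator_of_mem hh] using hw h hh
        · simp only [Set.indicator_of_notMem hh, hwU h hh, le_refl]
    _ = ∫ x in cosetMap Γ g '' U, Φ x ∂(quotientMeasure Γ μ) := by
        rw [integral_indicator hUo.measurableSet, setIntegral_image_cosetMap μ hUo hU hΦ]
    _ ≤ _ := setIntegral_le_integral hΦi (Eventually.of_forall hΦ0)

end PushFun

/-! ### Cutting off the lifts of test functions of `Γ\X`. -/

section CutoffProduct

variable {g : G} {U : Set G} {χ : G → ℝ}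

theorem isGroupTestFunction_smul {ψ : RightCosets Γ → ℂ} (hψ : IsTestFunction K Γ ψ) (g : G)
    (hχ : SmoothAlong χ) (hχK : ∀ g, ∀ k ∈ K, χ (g * k) = χ g) (hχc : HasCompactSupport χ) :
    IsGroupTestFunction K fun h => χ h • ψ (cosetMap Γ g h) where
  smooth h m Y := (hχ h m Y).smul (hψ.smoothAlong g h m Y)
  invariant h k hk := by rw [hχK h k hk, hψ.comp_cosetMap_mul g h hk]
  compact := hχc.smul_right

variable [DiscreteTopology Γ] [MeasurableSpace G] [BorelSpace G] (μ : Measure G) [μ.IsHaarMeasure]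

/-- The lift of `ψ` is `Γ`-periodic, but `supp χ` lies in an injecting set, so each point of `Γ\G`
is counted at most once. The constant comes from `‖Y (χ ψ)‖² ≤ 2 ‖Y ψ‖² + 2 C² ‖ψ‖²`, summed over
the `d` directions. -/
theorem energy_pushFun_smul_le {ψ : RightCosets Γ → ℂ} (hψ : IsTestFunction K Γ ψ)
    (hχ : SmoothAlong χ) (hχK : ∀ g, ∀ k ∈ K, χ (g * k) = χ g) (hχc : HasCompactSupport χ)
    (hχ1 : ∀ g, |χ g| ≤ 1) {d : ℕ} (e : Fin d → lieAlgebra G) {C : ℝ}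
    (hC : ∀ i g, |groupDeriv (e i) χ g| ≤ C) (hUo : IsOpen U)
    (hU : Set.InjOn (cosetMap Γ g) U) (hχU : tsupport χ ⊆ U) :
    energy μ e (pushFun ⊥ 1 Set.univ fun h => χ h • ψ (cosetMap Γ g h)) ≤
      (2 + 2 * d * C ^ 2) * energy μ e ψ := by
  have hu := isGroupTestFunction_smul hψ g hχ hχK hχc
  have hsupp : tsupport (fun h => χ h • ψ (cosetMap Γ g h)) ⊆ U :=
    (closure_mono (Function.support_smul_subset_left χ _)).trans hχU
  rw [energy_pushFun μ hu isOpen_univ (cosetMap_bot_injective 1).injOn (Set.subset_univ _)]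
  have hψ2 : Integrable (fun x => ‖ψ x‖ ^ 2) (quotientMeasure Γ μ) :=
    (IsTestFunction.memLp μ hψ).integrable_norm_pow (by norm_num)
  have hDψ2 : ∀ i, Integrable (fun x => ‖lieDeriv (e i) ψ x‖ ^ 2) (quotientMeasure Γ μ) := fun i =>
    (IsTestFunction.memLp_lieDeriv μ hψ (e i)).integrable_norm_pow (by norm_num)
  have h1 : ∫ h, ‖χ h • ψ (cosetMap Γ g h)‖ ^ 2 ∂μ ≤ ∫ x, ‖ψ x‖ ^ 2 ∂(quotientMeasure Γ μ) := by
    refine integral_le_of_le_indicator μ hUo hU (hψ.continuous.norm.pow 2)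
      (fun x => sq_nonneg _) hψ2 (fun h => sq_nonneg _) (fun h _ => ?_) fun h hh => ?_
    · rw [norm_smul, Real.norm_eq_abs]
      exact pow_le_pow_left₀ (by positivity) (mul_le_of_le_one_left (norm_nonneg _) (hχ1 h)) 2
    · rw [image_eq_zero_of_notMem_tsupport fun h' => hh (hχU h')]
      simp
  have h2 : ∀ i, ∫ h, ‖groupDeriv (e i) (fun h => χ h • ψ (cosetMap Γ g h)) h‖ ^ 2 ∂μ ≤
      2 * ∫ x, ‖lieDeriv (e i) ψ x‖ ^ 2 ∂(quotientMeasure Γ μ) +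
        2 * C ^ 2 * ∫ x, ‖ψ x‖ ^ 2 ∂(quotientMeasure Γ μ) := fun i => by
    rw [← integral_const_mul, ← integral_const_mul,
      ← integral_add ((hDψ2 i).const_mul 2) (hψ2.const_mul (2 * C ^ 2))]
    have hcont : Continuous fun x => 2 * ‖lieDeriv (e i) ψ x‖ ^ 2 + 2 * C ^ 2 * ‖ψ x‖ ^ 2 := by
      have h₁ := hψ.continuous
      have h₂ := hψ.continuous_lieDeriv (e i)
      fun_prop
    have hint : Integrable (fun x => 2 * ‖lieDeriv (e i) ψ x‖ ^ 2 + 2 * C ^ 2 * ‖ψ x‖ ^ 2)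
        (quotientMeasure Γ μ) := ((hDψ2 i).const_mul 2).add (hψ2.const_mul (2 * C ^ 2))
    refine integral_le_of_le_indicator μ hUo hU
      (Φ := fun x => 2 * ‖lieDeriv (e i) ψ x‖ ^ 2 + 2 * C ^ 2 * ‖ψ x‖ ^ 2)
      hcont (fun x => by positivity) hint (fun h => sq_nonneg _) (fun h _ => ?_) fun h hh => ?_
    · have hd := (hχ.hasDerivAt (e i) h).fun_smul ((hψ.smoothAlong g).hasDerivAt (e i) h)
      have hval : groupDeriv (e i) (fun h => χ h • ψ (cosetMap Γ g h)) h =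
          χ h • lieDeriv (e i) ψ (cosetMap Γ g h) +
            groupDeriv (e i) χ h • ψ (cosetMap Γ g h) := by
        rw [← groupDeriv_comp_cosetMap]
        simp only [zero_smul, expG_zero, mul_one] at hd
        exact hd.deriv
      have hn : ‖groupDeriv (e i) (fun h => χ h • ψ (cosetMap Γ g h)) h‖ ≤
          ‖lieDeriv (e i) ψ (cosetMap Γ g h)‖ + C * ‖ψ (cosetMap Γ g h)‖ := by
        rw [hval]
        refine (norm_add_le _ _).trans (add_le_add ?_ ?_)
        · rw [norm_smul]
          exact mul_le_of_le_one_left (norm_nonneg _) (hχ1 h)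
        · rw [norm_smul]
          exact mul_le_mul_of_nonneg_right (hC i h) (norm_nonneg _)
      have := pow_le_pow_left₀ (norm_nonneg _) hn 2
      nlinarith [sq_nonneg (‖lieDeriv (e i) ψ (cosetMap Γ g h)‖ - C * ‖ψ (cosetMap Γ g h)‖)]
    · rw [groupDeriv_eq_zero fun h' => hh (hsupp h')]
      simp
  have h3 := Finset.sum_le_sum fun i (_ : i ∈ Finset.univ) => h2 i
  rw [Finset.sum_add_distrib, ← Finset.mul_sum, Finset.sum_const, Finset.card_univ,
    Fintype.card_fin, nsmul_eq_mul] at h3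
  rw [energy]
  have hA : 0 ≤ ∫ x, ‖ψ x‖ ^ 2 ∂(quotientMeasure Γ μ) := integral_nonneg fun x => sq_nonneg _
  have hB : 0 ≤ ∑ i, ∫ x, ‖lieDeriv (e i) ψ x‖ ^ 2 ∂(quotientMeasure Γ μ) :=
    Finset.sum_nonneg fun i _ => integral_nonneg fun x => sq_nonneg _
  have hdC : 0 ≤ 2 * (d : ℝ) * C ^ 2 := by positivity
  nlinarith [mul_nonneg hdC hB]

end CutoffProduct

/-- If every compact subset of `G` has a translate that injects into `Γ\G`, then the spectrum of
`X` is contained in the spectrum of `Γ\X`. -/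
theorem laplaceSpectrum_subset_of_exists_injOn [MeasurableSpace G] [BorelSpace G]
    [DiscreteTopology Γ] (hK : IsCompact (K : Set G)) {d : ℕ} (e : Fin d → lieAlgebra G)
    (μ : Measure G) [μ.IsHaarMeasure] [μ.IsMulRightInvariant]
    (hinj : ∀ Q : Set G, IsCompact Q → ∃ g : G, Set.InjOn (cosetMap Γ g) Q) :
    laplaceSpectrum K ⊥ μ e ⊆ laplaceSpectrum K Γ μ e := by
  intro z hz
  by_contra hzΓ
  refine absurd hz ?_
  rw [notMem_laplaceSpectrum_iff_exists_bound] at hzΓ ⊢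
  obtain ⟨c, hc, hcΓ⟩ := hzΓ
  obtain ⟨C₀, hC₀, hcut⟩ := exists_cutoff hK e
  have hD : 0 < Real.sqrt (2 + 2 * d * C₀ ^ 2) := Real.sqrt_pos.2 (by positivity)
  -- The loss in the constant is the norm of the operation `ψ ↦ χ ψ̃` on `W¹`, bounded independently
  -- of `f`.
  refine ⟨c / Real.sqrt (2 + 2 * d * C₀ ^ 2), by positivity, fun f hf C hC hfC => ?_⟩
  obtain ⟨u, hu_def⟩ : ∃ u : G → ℂ, u = fun h => f (cosetMap ⊥ 1 h) := ⟨_, rfl⟩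
  have hu : IsGroupTestFunction K u := hu_def ▸ hf.isGroupTestFunction
  have hfu : f = pushFun ⊥ 1 Set.univ u := by rw [hu_def, pushFun_bot_comp_cosetMap]
  have hbot : Set.InjOn (cosetMap (⊥ : Subgroup G) 1) Set.univ := (cosetMap_bot_injective 1).injOn
  obtain ⟨χ, O, hχ, hχK, hχc, hχ1, hO, hQO, hχO, hχd⟩ := hcut (tsupport u) hu.compact
  obtain ⟨Q, hQ, hQs⟩ := exists_compact_superset (hu.compact.isCompact.union hχc.isCompact)
  obtain ⟨g, hg⟩ := hinj Q hQ
  have hUo : IsOpen (interior Q) := isOpen_interior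
  have hU : Set.InjOn (cosetMap Γ g) (interior Q) := hg.mono interior_subset
  have huU : tsupport u ⊆ interior Q := Set.subset_union_left.trans hQs
  have hχU : tsupport χ ⊆ interior Q := Set.subset_union_right.trans hQs
  have hF : IsTestFunction K Γ (pushFun Γ g (interior Q) u) := hu.pushFun hUo hU huU
  have hEF : energy μ e (pushFun Γ g (interior Q) u) = energy μ e f := by
    rw [hfu, energy_pushFun μ hu hUo hU huU,
      energy_pushFun μ hu isOpen_univ hbot (Set.subset_univ _)]
  have key := hcΓ _ hF (C * Real.sqrt (2 + 2 * d * C₀ ^ 2)) (by positivity) fun ψ hψ => ?_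
  · rw [hEF] at key
    rw [div_mul_eq_mul_div, div_le_iff₀ hD]
    exact key
  · have hv := isGroupTestFunction_smul hψ g hχ hχK hχc
    have hψ' : IsTestFunction K ⊥
        (pushFun ⊥ 1 Set.univ fun h => χ h • ψ (cosetMap Γ g h)) :=
      hv.pushFun isOpen_univ hbot (Set.subset_univ _)
    -- On `supp u` the cutoff is `1` in a neighbourhood, so `χ ψ̃` and `ψ̃` have the same values and
    -- derivatives there; elsewhere `u` and its derivatives vanish.
    have hform : shiftedForm μ e z (pushFun Γ g (interior Q) u) ψ =
        shiftedForm μ e z f (pushFun ⊥ 1 Set.univ fun h => χ h • ψ (cosetMap Γ g h)) := by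
      rw [hfu, shiftedForm_pushFun μ hu hUo hU huU e z hψ,
        shiftedForm_pushFun μ hu isOpen_univ hbot (Set.subset_univ _) e z hψ']
      simp only [pushFun_cosetMap hbot (Set.mem_univ _)]
      congr 2
      · funext i
        congr 1
        funext h
        by_cases hh : h ∈ tsupport u
        · congr 2
          refine groupDeriv_eq_of_eventuallyEq ?_ (e i)
          filter_upwards [hO.mem_nhds (hQO hh)] with y hy
          rw [hχO y hy, one_smul]
        · rw [groupDeriv_eq_zero hh, mul_zero, mul_zero]
      · congr 1
        funext h
        by_cases hh : h ∈ tsupport u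
        · rw [hχO h (hQO hh), one_smul]
        · rw [image_eq_zero_of_notMem_tsupport hh, mul_zero, mul_zero]
    rw [hform]
    refine (hfC _ hψ').trans ?_
    rw [mul_assoc, ← Real.sqrt_mul (by positivity)]
    exact mul_le_mul_of_nonneg_left (Real.sqrt_le_sqrt
      (energy_pushFun_smul_le μ hψ hχ hχK hχc hχ1 e hχd hUo hU hχU)) hC

end Transfer

end

theorem mainTheorem8 {n : ℕ} (G : ClosedSubgroup (GL (Fin n) ℝ))
    (hG : IsConnectedSemisimpleRealAlgebraic G)
    (K : Subgroup G) (θ : lieAlgebra G ≃ₗ⁅ℝ⁆ lieAlgebra G) (hK : IsCartanPair K θ)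
    {d : ℕ} (e : Fin d → lieAlgebra G) (he : IsOrthonormalFrame θ e)
    [MeasurableSpace G] [BorelSpace G]
    (μ : Measure G) [μ.IsHaarMeasure] [μ.IsMulRightInvariant]
    (Γ : Subgroup G) [DiscreteTopology Γ] (hinj : injRadius θ Γ = ⊤) :
    WeaklyContained (rightRep G G μ)
        (rightRep G (RightCosets Γ) (RightCosets.quotientMeasure Γ μ)) ∧
      laplaceSpectrum K ⊥ μ e ⊆ laplaceSpectrum K Γ μ e := by
  have : PreconnectedSpace G := hG.preconnectedSpace
  have h : ∀ Q : Set G, IsCompact Q → ∃ g : G, Set.InjOn (RightCosets.cosetMap Γ g) Q :=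
    fun _ hQ => exists_injOn_of_injRadius_eq_top hinj hQ
  exact ⟨weaklyContained_of_exists_injOn μ Γ h,
    laplaceSpectrum_subset_of_exists_injOn hK.isCompact e μ h⟩
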